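/- A \emph{4-graph} is a topological space with finitely many components, each of which is a circle or a finite graph with all vertices of valency four. It is \emph{framed} if at every vertex the four half-edges are split into two pairs of \emph{opposite} half-edges. Going straight through vertices (from a half-edge to the opposite one) decomposes a framed 4-graph into its \emph{unicursal components} (circles without vertices are also unicursal components); any of them may be oriented. Free links are equivalence classes of framed 4-graphs (with some of their unicursal components oriented) modulo isomorphism and the three Reidemeister moves: (1) addition/removal of a loop, i.e. of a vertex joined to itself by an edge whose two ends are not opposite; (2) addition/removal of a bigon, i.e. of two distinct vertices joined by two edges whose ends are opposite at neither vertex; (3) for a triangle formed by three strands with three distinct vertices, interchanging on each strand its two crossings with the other two strands. Removing vertices in the first two moves means that the curves go straight through them. A framed 4-graph with orientations is called \emph{invertible as a free link} if it represents the same free link as the graph obtained by reversing all given orientations. Components of links are unordered. \textbf{Theorem.} Let $L$ be a framed 4-graph with exactly two unicursal components $L_1$, $L_2$, of which $L_1$ is oriented, and with an odd number of crossings. Assume that: \begin{enumerate} \item every crossing of $L$ is formed by the two different components $L_1$ and $L_2$; \item $L$ is irreducible, i.e. no decreasing second Reidemeister move can be applied to it; \item $L$ is not isomorphic to itself with the orientation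 of $L_1$ reversed; \item there is no isomorphism of $L_1\cup L_2$ onto itself (as a framed 4-graph, disregarding the orientation) that interchanges $L_1$ and $L_2$. \end{enumerate} Then the free link $L$ is not invertible: $L$ and $L$ with the orientation of $L_1$ reversed represent different free links (with one component oriented). Moreover, for each choice of an orientation of $L_2$, the resulting oriented free link with unordered components differs from the one in which the orientations of both components are reversed. \textbf{Example.} Let $L_1$ and $L_2$ meet in $11$ crossings, all of them between $L_1$ and $L_2$, such that $L_1$ meets, in its cyclic order, the crossings that have the positions $0,3,6,9,2,8,4,10,1,7,5$ (modulo $11$) in the cyclic order along $L_2$; the successive differences of positions are $3,3,3,4,6,7,6,2,6,9,6$. This $L$ satisfies (1)--(4), so it is not invertible. -/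

import Mathlib

/-- A framed `4`-graph, described by its half-edges. Its unicursal components are labelled by the
elements of `C`. A label that no half-edge carries is a circle component without vertices. -/
structure FramedFourGraph (C : Type) where
  /-- The vertices (crossings). -/
  V : Type
  /-- The half-edges at the vertices. -/
  H : Type
  finite_V : Finite V
  finite_H : Finite H
  /-- The vertex that a half-edge emanates from. -/
  vtx : H → V
  /-- Every vertex has valency four. -/
  four_valent : ∀ v, Nat.card {h // vtx h = v} = 4
  /-- The other half of the same edge. -/
  edge : H → H
  edge_edge : ∀ h, edge (edge h) = h
  edge_ne : ∀ h, edge h ≠ h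
  /-- The (formally) opposite half-edge at the same vertex: this is the framing. -/
  opp : H → H
  opp_opp : ∀ h, opp (opp h) = h
  opp_ne : ∀ h, opp h ≠ h
  vtx_opp : ∀ h, vtx (opp h) = vtx h
  /-- The unicursal component through a half-edge. -/
  comp : H → C
  /-- Two half-edges lie on the same unicursal component exactly when one gets from one to the
  other along edges and by going straight through vertices. -/
  comp_eq_iff : ∀ h k, comp h = comp k ↔ Relation.EqvGen (fun x y => y = edge x ∨ y = opp x) h k

namespace FramedFourGraph

variable {C : Type}

/-- `φ` is an isomorphism of framed `4`-graphs that acts on the unicursal components by `σ`. -/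
structure IsIso (G G' : FramedFourGraph C) (σ : Equiv.Perm C) (φ : G.H ≃ G'.H) : Prop where
  vtx_iff : ∀ h k, G'.vtx (φ h) = G'.vtx (φ k) ↔ G.vtx h = G.vtx k
  edge_eq : ∀ h, φ (G.edge h) = G'.edge (φ h)
  opp_eq : ∀ h, φ (G.opp h) = G'.opp (φ h)
  comp_eq : ∀ h, G'.comp (φ h) = σ (G.comp h)

/-- The fragment of the first Reidemeister move: an edge joins the vertex `v` to itself and its two
ends are not opposite at `v`. -/
def IsLoop (G : FramedFourGraph C) (v : G.V) : Prop :=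
  ∃ a, G.vtx a = v ∧ G.vtx (G.edge a) = v ∧ G.edge a ≠ G.opp a

/-- The fragment of the second Reidemeister move: two edges join the distinct vertices `v`, `w`,
and their ends are opposite neither at `v` nor at `w`. -/
def IsBigon (G : FramedFourGraph C) (v w : G.V) : Prop :=
  v ≠ w ∧ ∃ a b, a ≠ b ∧ G.vtx a = v ∧ G.vtx b = v ∧ G.vtx (G.edge a) = w ∧ G.vtx (G.edge b) = w ∧
    G.opp a ≠ b ∧ G.opp (G.edge a) ≠ G.edge b

/-- The fragment of the third Reidemeister move: the edges of the half-edges `a`, `b`, `c` form a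
triangle with three distinct vertices, and no two of them are opposite at a common vertex.
The edge of `a` goes from the first to the second vertex, that of `b` from the first to the third,
that of `c` from the second to the third. -/
def IsTriangle (G : FramedFourGraph C) (a b c : G.H) : Prop :=
  G.vtx a = G.vtx b ∧ G.vtx (G.edge a) = G.vtx c ∧ G.vtx (G.edge b) = G.vtx (G.edge c) ∧
    G.vtx a ≠ G.vtx c ∧ G.vtx a ≠ G.vtx (G.edge c) ∧ G.vtx c ≠ G.vtx (G.edge c) ∧
    G.opp a ≠ b ∧ G.opp (G.edge a) ≠ c ∧ G.opp (G.edge b) ≠ G.edge c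

open scoped Classical in
/-- Interchanges the two passages of a strand through the two ends of the edge of `a`. If the strand
runs through `opp a, a, edge a, opp (edge a)` in this order, then `opp a` and `edge a` are
interchanged, and so are `a` and `opp (edge a)`. -/
noncomputable def strandSwap (G : FramedFourGraph C) (a : G.H) : Equiv.Perm G.H :=
  Equiv.swap (G.opp a) (G.edge a) * Equiv.swap a (G.opp (G.edge a))

/-- Starting at `h` and going straight through vertices of `X` (from a half-edge of a vertex in `X`
to the opposite one, and along the edge of that one), one first leaves `X` at the half-edge `k`. -/
inductive PassesTo (G : FramedFourGraph C) (X : Set G.V) : G.H → G.H → Prop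
  | here (h : G.H) : G.vtx h ∉ X → PassesTo G X h h
  | next (h k : G.H) : G.vtx h ∈ X → PassesTo G X (G.edge (G.opp h)) k → PassesTo G X h k

end FramedFourGraph

/-- A framed `4`-graph in which the unicursal components in `S` (and only these) are oriented. The
orientation is the set `out` of the half-edges that it points away from their vertices: each edge of
an oriented component has exactly one such half, and so has each pair of opposite half-edges.
(A circle without vertices needs no data: its two orientations are isomorphic.) -/
structure OrientedGraph (C : Type) (S : Set C) extends FramedFourGraph C where
  out : Set H
  comp_mem : ∀ h ∈ out, comp h ∈ S
  edge_mem : ∀ h, comp h ∈ S → (edge h ∈ out ↔ h ∉ out)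
  opp_mem : ∀ h, comp h ∈ S → (opp h ∈ out ↔ h ∉ out)

namespace FramedFourGraph

variable {C : Type}

theorem comp_edge (G : FramedFourGraph C) (h : G.H) : G.comp (G.edge h) = G.comp h :=
  ((G.comp_eq_iff _ _).2 (Relation.EqvGen.rel _ _ (Or.inl rfl))).symm

theorem comp_opp (G : FramedFourGraph C) (h : G.H) : G.comp (G.opp h) = G.comp h :=
  ((G.comp_eq_iff _ _).2 (Relation.EqvGen.rel _ _ (Or.inr rfl))).symm

end FramedFourGraph

namespace OrientedGraph

variable {C : Type} {S : Set C}

/-- The orientation of every oriented component is reversed. -/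
def reverse (G : OrientedGraph C S) : OrientedGraph C S where
  toFramedFourGraph := G.toFramedFourGraph
  out := {h | G.comp h ∈ S ∧ h ∉ G.out}
  comp_mem := fun _ hh => hh.1
  edge_mem := fun h hh => by
    have := G.edge_mem h hh
    have hc := G.comp_edge h
    simp only [Set.mem_ofPred_eq, hc, hh, this, true_and]
  opp_mem := fun h hh => by
    have := G.opp_mem h hh
    have hc := G.comp_opp h
    simp only [Set.mem_ofPred_eq, hc, hh, this, true_and]

/-- Only the orientations of the components in `T ⊆ S` are kept. -/
def restrict (G : OrientedGraph C S) (T : Set C) (hT : T ⊆ S) : OrientedGraph C T where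
  toFramedFourGraph := G.toFramedFourGraph
  out := {h | G.comp h ∈ T ∧ h ∈ G.out}
  comp_mem := fun _ hh => hh.1
  edge_mem := fun h hh => by
    have := G.edge_mem h (hT hh)
    have hc := G.comp_edge h
    simp only [Set.mem_ofPred_eq, hc, hh, this, true_and]
  opp_mem := fun h hh => by
    have := G.opp_mem h (hT hh)
    have hc := G.comp_opp h
    simp only [Set.mem_ofPred_eq, hc, hh, this, true_and]

/-- Isomorphism of (partly) oriented framed `4`-graphs. The components may be permuted; oriented
components go to oriented components, and the orientations are preserved. -/
def Isomorphic (G G' : OrientedGraph C S) : Prop :=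
  ∃ (σ : Equiv.Perm C) (φ : G.H ≃ G'.H),
    G.toFramedFourGraph.IsIso G'.toFramedFourGraph σ φ ∧
      (∀ c, σ c ∈ S ↔ c ∈ S) ∧ ∀ h, φ h ∈ G'.out ↔ h ∈ G.out

/-- `G'` is obtained from `G` by erasing the vertices in `X`: the curves go straight through the
erased vertices and are otherwise unchanged. -/
def IsErasure (G : OrientedGraph C S) (X : Set G.V) (G' : OrientedGraph C S) : Prop :=
  ∃ φ : G'.H → G.H, Function.Injective φ ∧ Set.range φ = {h | G.vtx h ∉ X} ∧
    (∀ h k, G.vtx (φ h) = G.vtx (φ k) ↔ G'.vtx h = G'.vtx k) ∧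
    (∀ h, φ (G'.opp h) = G.opp (φ h)) ∧
    (∀ h, G.PassesTo X (G.edge (φ h)) (φ (G'.edge h))) ∧
    (∀ h, G.comp (φ h) = G'.comp h) ∧
    ∀ h, φ h ∈ G.out ↔ h ∈ G'.out

/-- `G'` arises from `G` by a decreasing first Reidemeister move. -/
def Reidemeister1 (G G' : OrientedGraph C S) : Prop :=
  ∃ v, G.IsLoop v ∧ G.IsErasure {v} G'

/-- `G'` arises from `G` by a decreasing second Reidemeister move. -/
def Reidemeister2 (G G' : OrientedGraph C S) : Prop :=
  ∃ v w, G.IsBigon v w ∧ G.IsErasure {v, w} G'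

/-- `G'` arises from `G` by a third Reidemeister move: on each of the three strands that form a
triangle, the two crossings with the other strands are interchanged. -/
def Reidemeister3 (G G' : OrientedGraph C S) : Prop :=
  ∃ a b c, G.IsTriangle a b c ∧ ∃ φ : G'.H ≃ G.H,
    (∀ h k, G.vtx (φ h) = G.vtx (φ k) ↔ G'.vtx h = G'.vtx k) ∧
    (∀ h, φ (G'.opp h) = G.opp (φ h)) ∧
    (∀ h, φ (G'.edge h) =
      (G.strandSwap a * G.strandSwap b * G.strandSwap c)
        (G.edge ((G.strandSwap a * G.strandSwap b * G.strandSwap c) (φ h)))) ∧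
    (∀ h, G.comp (φ h) = G'.comp h) ∧
    ∀ h, φ h ∈ G.out ↔ h ∈ G'.out

/-- One step of the equivalence that defines free links. -/
def Step (G G' : OrientedGraph C S) : Prop :=
  G.Isomorphic G' ∨ G.Reidemeister1 G' ∨ G.Reidemeister2 G' ∨ G.Reidemeister3 G'

end OrientedGraph

/-- Free links whose components are indexed by `C` (as an unordered index set) and in which the
components in `S` are oriented: framed `4`-graphs modulo the equivalence relation generated by
isomorphisms and the three Reidemeister moves. -/
def FreeLink (C : Type) (S : Set C) : Type 1 :=
  Quot (OrientedGraph.Step (C := C) (S := S))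

namespace OrientedGraph

variable {C : Type} {S : Set C}

/-- The free link represented by a framed `4`-graph. -/
def freeLink (G : OrientedGraph C S) : FreeLink C S :=
  Quot.mk _ G

/-- The free link of `G` is equal to the one with all its orientations reversed. -/
def IsInvertible (G : OrientedGraph C S) : Prop :=
  G.freeLink = G.reverse.freeLink

/-- No decreasing second Reidemeister move can be applied. -/
def Irreducible (G : OrientedGraph C S) : Prop :=
  ∀ v w, ¬ G.IsBigon v w

/-- Every crossing lies on both components. -/
def AllCrossingsMixed {T : Set (Fin 2)} (G : OrientedGraph (Fin 2) T) : Prop :=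
  ∀ (v : G.V) (i : Fin 2), ∃ h, G.vtx h = v ∧ G.comp h = i

/-- Some automorphism of the framed `4`-graph, regardless of orientations, interchanges the two
components. -/
def HasComponentSwap {T : Set (Fin 2)} (G : OrientedGraph (Fin 2) T) : Prop :=
  ∃ φ : G.H ≃ G.H, G.toFramedFourGraph.IsIso G.toFramedFourGraph (Equiv.swap 0 1) φ

end OrientedGraph

/-- The crossings that `L₁` meets, in their order along `L₁`, each named by its position along
`L₂`. The successive differences modulo `11` are `3, 3, 3, 4, 6, 7, 6, 2, 6, 9, 6`. -/
def examplePosition : Fin 11 → Fin 11 :=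
  ![0, 3, 6, 9, 2, 8, 4, 10, 1, 7, 5]

/-- The half-edge `(i, k, true)` leaves and `(i, k, false)` enters the `k`-th crossing along the
`i`-th component. -/
def exampleGraph : FramedFourGraph (Fin 2) where
  V := Fin 11
  H := Fin 2 × Fin 11 × Bool
  finite_V := inferInstance
  finite_H := inferInstance
  vtx := fun h => if h.1 = 0 then examplePosition h.2.1 else h.2.1
  four_valent := fun v => by
    rw [Nat.card_eq_fintype_card]
    revert v
    decide +kernel
  edge := fun h => if h.2.2 then (h.1, h.2.1 + 1, false) else (h.1, h.2.1 - 1, true)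
  edge_edge := by decide +kernel
  edge_ne := by decide +kernel
  opp := fun h => (h.1, h.2.1, !h.2.2)
  opp_opp := by decide +kernel
  opp_ne := by decide +kernel
  vtx_opp := fun _ => rfl
  comp := fun h => h.1
  comp_eq_iff := by
    set r : Fin 2 × Fin 11 × Bool → Fin 2 × Fin 11 × Bool → Prop := fun x y =>
      y = (if x.2.2 then (x.1, x.2.1 + 1, false) else (x.1, x.2.1 - 1, true)) ∨
        y = (x.1, x.2.1, !x.2.2) with hr
    have key : ∀ (i : Fin 2) (n : ℕ) (hn : n < 11) (b : Bool),
        Relation.EqvGen r (i, 0, false) (i, ⟨n, hn⟩, b) := by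
      intro i n
      have flip : ∀ k : Fin 11, Relation.EqvGen r (i, k, false) (i, k, true) := fun k =>
        Relation.EqvGen.rel _ _ (Or.inr rfl)
      induction n with
      | zero =>
        intro _ b
        cases b
        · exact Relation.EqvGen.refl _
        · exact flip 0
      | succ n ih =>
        intro hn b
        have h1 := ih (by omega) true
        have h2 : Relation.EqvGen r (i, ⟨n, by omega⟩, true) (i, ⟨n + 1, hn⟩, false) := by
          refine Relation.EqvGen.rel _ _ (Or.inl ?_)
          have : (⟨n + 1, hn⟩ : Fin 11) = ⟨n, by omega⟩ + 1 := by
            apply Fin.ext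
            simp [Fin.val_add]
            omega
          simp [this]
        have h3 := h1.trans _ _ _ h2
        cases b
        · exact h3
        · exact h3.trans _ _ _ (flip _)
    rintro ⟨i, k, b⟩ ⟨j, l, d⟩
    constructor
    · rintro (rfl : i = j)
      exact ((key i k.1 k.2 b).symm).trans _ _ _ (key i l.1 l.2 d)
    · intro h
      have : ∀ x y, Relation.EqvGen r x y → x.1 = y.1 := by
        intro x y hxy
        induction hxy with
        | rel x y hxy =>
          rcases hxy with rfl | rfl
          · by_cases hb : x.2.2 = true <;> simp [hb]
          · rfl
        | refl => rfl
        | symm _ _ _ ih => exact ih.symm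
        | trans _ _ _ _ _ ih1 ih2 => exact ih1.trans ih2
      exact this _ _ h

/-- The eleven-crossing example, with its first component oriented. -/
def exampleLink : OrientedGraph (Fin 2) {0} where
  toFramedFourGraph := exampleGraph
  out := {h | h.1 = 0 ∧ h.2.2 = true}
  comp_mem := fun _ hh => hh.1
  edge_mem := by
    rintro ⟨i, k, b⟩ (rfl : i = 0)
    change (_ ∧ _) ↔ ¬ (_ ∧ _)
    cases b <;> simp [exampleGraph]
  opp_mem := by
    rintro ⟨i, k, b⟩ (rfl : i = 0)
    change (_ ∧ _) ↔ ¬ (_ ∧ _)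
    cases b <;> simp [exampleGraph]

/-!
The theorem is proved with an invariant modulo `2` of free links with two components, which counts
copies of `L` in smoothings of a diagram.

Let `L` be a reduced diagram of two curves, the first of which is oriented. In a diagram of two
curves, smooth each crossing of a curve with itself in one of the two ways that do not go straight,
and keep only those smoothings in which each of the curves remains a single closed curve. In such a
smoothing, choose a set `Y` of crossings of the two different curves, and go straight through all
other crossings. `Curves.bracket` is the number modulo `2` of the pairs of a smoothing and a set `Y`
for which the diagram that remains is `L` (`Curves.IsCopy`). A smoothing does not respect the
orientation of the first curve. The smoothed curve therefore gets its direction from a parity rule: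
it is the direction that agrees with the given orientation at an odd number of the mixed crossings.
When the number of these is odd, exactly one of the two directions does.

The bracket is invariant under the Reidemeister moves because of cancellations modulo `2`.
* At a loop, one of the smoothings splits off a circle, and the other one removes the loop
  (`Curves.bracket_loop`).
* Of the four smoothings of a pure bigon, one splits off a circle, two agree with each other, and
  the last one removes the bigon (`Curves.bracket_bigon_pure`).
* At a mixed bigon, the sets `Y` that contain just one of its crossings come in pairs, and none
  contains both, since `L` has no bigon (`Curves.bracket_bigon_mixed`). It is here and at the
  triangles that `L` has to be reduced.
* At a triangle with three pure crossings, the smoothings before and after the move correspond to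
  each other up to pairs that cancel (`Curves.bracket_triangle_pure`). Otherwise just one crossing
  is pure. Smoothed in one way, it leaves a bigon of the other two crossings, before and after the
  move, so that these do not matter; smoothed in the other way, it leaves two diagrams that are the
  same up to renaming the crossings (`Curves.bracket_triangle_mixed`).

All these local comparisons are instances of `Curves.IsCopy.transfer`, which replaces one tangle in
a diagram with another one; its hypotheses on the tangles are decidable.

If all crossings of `L` are mixed, then there is nothing to smooth, and `Y` has to contain all
crossings of a diagram with as many crossings as `L`. If their number is odd, then the parity rule
gives the original orientation. Hence the bracket of `L` itself is `1` (`OrientedGraph.count_self`),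
and that of the reversed diagram is `0` unless `L` is isomorphic to it
(`OrientedGraph.exists_isIso_of_count`). When both components are oriented, but unordered, one adds
the brackets for the two choices of the first curve; the second one vanishes because no isomorphism
interchanges the components.
-/

/-! ### Pairs of curves and their smoothings -/

/-- The half-edges of a pair of closed curves, without the information which passages of the curves
meet at a common crossing. The half-edges in `first` are those of the first curve, which is
oriented: `dir` is `1` on the half-edges that the orientation points away from their vertices. -/
structure Curves where
  H : Type
  finite_H : Finite H
  edge : H → H
  edge_edge : ∀ h, edge (edge h) = h
  edge_ne : ∀ h, edge h ≠ h
  opp : H → H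
  opp_opp : ∀ h, opp (opp h) = h
  opp_ne : ∀ h, opp h ≠ h
  first : Set H
  edge_first : ∀ h, edge h ∈ first ↔ h ∈ first
  opp_first : ∀ h, opp h ∈ first ↔ h ∈ first
  dir : H → ZMod 2
  dir_edge : ∀ h ∈ first, dir (edge h) = dir h + 1
  dir_opp : ∀ h ∈ first, dir (opp h) = dir h + 1

namespace Curves

noncomputable instance (C : Curves) : Fintype C.H := @Fintype.ofFinite _ C.finite_H

variable {V VL V' : Type}

/-- The half-edge `h` belongs to a crossing of the two different curves. -/
def Mixed (C : Curves) (vtx : C.H → V) (h : C.H) : Prop :=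
  ∃ k, vtx k = vtx h ∧ ¬(k ∈ C.first ↔ h ∈ C.first)

/-- `τ` describes how to pass through the vertices: straight at the mixed crossings and at the
half-edges in `X`, and in one of the two other ways at all other crossings. -/
structure IsState (C : Curves) (vtx : C.H → V) (X : Set C.H) (τ : C.H → C.H) : Prop where
  vtx_eq : ∀ h, vtx (τ h) = vtx h
  invol : ∀ h, τ (τ h) = h
  straight : ∀ h, h ∈ X ∨ C.Mixed vtx h → τ h = C.opp h
  turn : ∀ h, h ∉ X → ¬ C.Mixed vtx h → τ h ≠ h ∧ τ h ≠ C.opp h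

/-- Two half-edges are joined if one gets from one to the other along edges and, outside of `Y`,
through vertices as `τ` prescribes. -/
def Joined (C : Curves) (τ : C.H → C.H) (Y : Set C.H) : C.H → C.H → Prop :=
  Relation.EqvGen fun x y => y = C.edge x ∨ (x ∉ Y ∧ y = τ x)

open scoped Classical in
/-- The number modulo `2` of the mixed crossings outside of `X` at which the direction `O` of the
first curve agrees with the given one. -/
noncomputable def agreement (C : Curves) (vtx : C.H → V) (X : Set C.H) (O : C.H → ZMod 2) :
    ZMod 2 :=
  ∑ h, if h ∈ C.first ∧ C.Mixed vtx h ∧ h ∉ X then O h * C.dir h else 0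

/-- `φ` identifies `L`, with its direction, with the diagram that remains of `C` when the curves run
as `τ` prescribes, the first one in the direction `O`, and only the crossings in `Y` are kept. -/
structure IsEmbedding (L : Curves) (vL : L.H → VL) (C : Curves) (vtx : C.H → V) (τ : C.H → C.H)
    (Y : Set C.H) (O : C.H → ZMod 2) (φ : L.H → C.H) : Prop where
  inj : Function.Injective φ
  range_eq : Set.range φ = Y
  vtx_iff : ∀ h k, vtx (φ h) = vtx (φ k) ↔ vL h = vL k
  opp_eq : ∀ h, φ (L.opp h) = C.opp (φ h)
  first_iff : ∀ h, φ h ∈ C.first ↔ h ∈ L.first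
  joined : ∀ h, C.Joined τ Y (φ h) (φ (L.edge h))
  dir_eq : ∀ h ∈ L.first, O (φ h) = L.dir h

/-- The first curve, running as `τ` prescribes, is directed by `O`. -/
def Directs (C : Curves) (τ : C.H → C.H) (O : C.H → ZMod 2) : Prop :=
  ∀ h ∈ C.first, O (C.edge h) = O h + 1 ∧ O (τ h) = O h + 1

/-- Smoothed according to `τ`, each of the two curves stays connected, and the mixed crossings in
`Y` form a copy of `L`. Here the first curve gets the direction that agrees with the given one at an
odd number of mixed crossings. -/
structure IsCopy (L : Curves) (vL : L.H → VL) (C : Curves) (vtx : C.H → V) (X : Set C.H)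
    (τ : C.H → C.H) (Y : Set C.H) : Prop where
  sat : ∀ h k, vtx h = vtx k → h ∈ Y → k ∈ Y
  mixed : ∀ h ∈ Y, C.Mixed vtx h ∧ h ∉ X
  conn : ∀ h k, (h ∈ C.first ↔ k ∈ C.first) → C.Joined τ ∅ h k
  exists_embedding : ∃ O, C.Directs τ O ∧ C.agreement vtx X O = 1 ∧ ∃ φ,
    IsEmbedding L vL C vtx τ Y O φ

open scoped Classical in
/-- The number modulo `2` of copies of `L` in the smoothing `τ`. -/
noncomputable def copies (L : Curves) (vL : L.H → VL) (C : Curves) (vtx : C.H → V) (X : Set C.H)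
    (τ : C.H → C.H) : ZMod 2 :=
  ∑ Y : Set C.H, if IsCopy L vL C vtx X τ Y then 1 else 0

open scoped Classical in
/-- The number modulo `2` of copies of `L` in all smoothings of the diagram. -/
noncomputable def bracket (L : Curves) (vL : L.H → VL) (C : Curves) (vtx : C.H → V) (X : Set C.H) :
    ZMod 2 :=
  ∑ τ : C.H → C.H with C.IsState vtx X τ, copies L vL C vtx X τ

theorem IsState.first_iff {C : Curves} {vtx : C.H → V} {X : Set C.H} {τ : C.H → C.H}
    (hτ : C.IsState vtx X τ) (h : C.H) : τ h ∈ C.first ↔ h ∈ C.first := by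
  by_cases hs : h ∈ X ∨ C.Mixed vtx h
  · rw [hτ.straight h hs, C.opp_first]
  · by_contra hn
    exact hs (Or.inr ⟨τ h, hτ.vtx_eq h, hn⟩)

namespace Joined

variable {C : Curves} {τ : C.H → C.H} {Y : Set C.H} {x y z : C.H}

theorem edge (x : C.H) : C.Joined τ Y x (C.edge x) := .rel _ _ (Or.inl rfl)

theorem pass (hx : x ∉ Y) : C.Joined τ Y x (τ x) := .rel _ _ (Or.inr ⟨hx, rfl⟩)

theorem refl (x : C.H) : C.Joined τ Y x x := Relation.EqvGen.refl x

theorem symm (h : C.Joined τ Y x y) : C.Joined τ Y y x := Relation.EqvGen.symm _ _ h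

theorem trans (h : C.Joined τ Y x y) (h' : C.Joined τ Y y z) : C.Joined τ Y x z :=
  Relation.EqvGen.trans _ _ _ h h'

end Joined

/-! ### Erasing vertices -/

/-- Starting at `h` and going straight through the half-edges in `X`, `X` is first left at `k`. -/
inductive Exits (C : Curves) (X : Set C.H) : C.H → C.H → Prop
  | here (h : C.H) : h ∉ X → Exits C X h h
  | next (h k : C.H) : h ∈ X → Exits C X (C.edge (C.opp h)) k → Exits C X h k

/-- `f` identifies the diagram `C'` with the one obtained from `C` by erasing `X`. -/
structure Erasure (C' : Curves) (vtx' : C'.H → V') (C : Curves) (vtx : C.H → V) (X : Set C.H)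
    (f : C'.H → C.H) : Prop where
  inj : Function.Injective f
  mem_range : ∀ h, h ∈ Set.range f ↔ h ∉ X
  sat : ∀ h k, vtx h = vtx k → h ∈ X → k ∈ X
  vtx_opp : ∀ h, vtx (C.opp h) = vtx h
  vtx_iff : ∀ h k, vtx (f h) = vtx (f k) ↔ vtx' h = vtx' k
  opp_eq : ∀ h, f (C'.opp h) = C.opp (f h)
  exits : ∀ h, C.Exits X (C.edge (f h)) (f (C'.edge h))
  first_iff : ∀ h, f h ∈ C.first ↔ h ∈ C'.first
  dir_eq : ∀ h ∈ C'.first, C.dir (f h) = C'.dir h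
  conn : ∀ x ∈ X, ∀ y, (x ∈ C.first ↔ y ∈ C.first) → C.Joined C.opp ∅ x y

namespace Exits

variable {C : Curves} {X : Set C.H} {x k l : C.H}

theorem eq_of_not_mem (h : C.Exits X x k) (hx : x ∉ X) : x = k := by
  cases h with
  | here => rfl
  | next _ _ h' => exact absurd h' hx

theorem step (h : C.Exits X x k) (hx : x ∈ X) : C.Exits X (C.edge (C.opp x)) k := by
  cases h with
  | here _ h' => exact absurd hx h'
  | next _ _ _ h' => exact h'

theorem unique (h : C.Exits X x k) (h' : C.Exits X x l) : k = l := by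
  induction h with
  | here x hx => exact h'.eq_of_not_mem hx
  | next x k hx _ ih => exact ih (h'.step hx)

theorem first_iff (h : C.Exits X x k) : x ∈ C.first ↔ k ∈ C.first := by
  induction h with
  | here x hx => rfl
  | next x k hx _ ih => rw [← ih, C.edge_first, C.opp_first]

theorem joined {τ : C.H → C.H} {Y : Set C.H} (hτ : ∀ h ∈ X, τ h = C.opp h) (hY : ∀ h ∈ Y, h ∉ X)
    (h : C.Exits X x k) : C.Joined τ Y x k := by
  induction h with
  | here x hx => exact .refl _
  | next x k hx _ ih =>
    refine .trans (.pass fun hy => hY _ hy hx) (.trans ?_ ih)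
    rw [hτ _ hx]
    exact .edge _

theorem dir_eq {τ : C.H → C.H} {O : C.H → ZMod 2} (hτ : ∀ h ∈ X, τ h = C.opp h)
    (hO : C.Directs τ O) (h : C.Exits X x k) (hx : x ∈ C.first) : O k = O x := by
  induction h with
  | here x hx => rfl
  | next x k hX _ ih =>
    rw [ih (by rwa [C.edge_first, C.opp_first]), (hO _ ((C.opp_first _).2 hx)).1, ← hτ _ hX,
      (hO _ hx).2, add_assoc, CharTwo.add_self_eq_zero, add_zero]

end Exits

namespace Erasure

variable {C' C : Curves} {vtx' : C'.H → V'} {vtx : C.H → V} {X : Set C.H} {f : C'.H → C.H}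

theorem not_mem (hf : Erasure C' vtx' C vtx X f) (h : C'.H) : f h ∉ X := (hf.mem_range _).1 ⟨h, rfl⟩

theorem opp_mem (hf : Erasure C' vtx' C vtx X f) {h : C.H} (hh : h ∈ X) : C.opp h ∈ X :=
  hf.sat _ _ (hf.vtx_opp h).symm hh

theorem exits_edge (hf : Erasure C' vtx' C vtx X f) {x : C.H} {k : C'.H} (h : C.Exits X x (f k)) :
    C.Exits X (C.edge x) (f (C'.edge k)) := by
  generalize hk : f k = k' at h
  induction h with
  | here x hx => subst hk; exact hf.exits k
  | next x k' hx _ ih =>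
    have := ih hk
    rw [C.edge_edge] at this
    simpa [C.opp_opp] using this.step (hf.opp_mem hx)

theorem exits_opp (hf : Erasure C' vtx' C vtx X f) {x : C.H} {k : C'.H} (hx : x ∈ X)
    (h : C.Exits X x (f k)) : C.Exits X (C.opp x) (f (C'.edge k)) := by
  have := hf.exits_edge (h.step hx)
  rwa [C.edge_edge] at this

theorem mixed_iff (hf : Erasure C' vtx' C vtx X f) (h : C'.H) :
    C.Mixed vtx (f h) ↔ C'.Mixed vtx' h := by
  constructor
  · rintro ⟨k, hk, hn⟩
    obtain ⟨k, rfl⟩ := (hf.mem_range k).2 fun hX => hf.not_mem h (hf.sat _ _ hk hX)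
    exact ⟨k, (hf.vtx_iff _ _).1 hk, by rwa [hf.first_iff, hf.first_iff] at hn⟩
  · rintro ⟨k, hk, hn⟩
    exact ⟨f k, (hf.vtx_iff _ _).2 hk, by rwa [hf.first_iff, hf.first_iff]⟩

theorem exists_of_not_mem (hf : Erasure C' vtx' C vtx X f) {x : C.H} (hx : x ∉ X) :
    ∃ k, f k = x := (hf.mem_range x).2 hx

section

variable {τ' : C'.H → C'.H} {τ : C.H → C.H}

theorem joined (hf : Erasure C' vtx' C vtx X f) (hτX : ∀ h ∈ X, τ h = C.opp h)
    (hτ : ∀ h, τ (f h) = f (τ' h)) {Y : Set C'.H} {k l : C'.H} (h : C'.Joined τ' Y k l) :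
    C.Joined τ (f '' Y) (f k) (f l) := by
  induction h with
  | rel k l h =>
    rcases h with rfl | ⟨hk, rfl⟩
    · exact .trans (.edge _) ((hf.exits k).joined hτX (by rintro _ ⟨y, -, rfl⟩; exact hf.not_mem y))
    · rw [← hτ]
      exact .pass fun ⟨y, hy, hyk⟩ => hk (hf.inj hyk ▸ hy)
  | refl => exact .refl _
  | symm _ _ _ ih => exact ih.symm
  | trans _ _ _ _ _ ih1 ih2 => exact ih1.trans ih2

theorem joined_exits (hf : Erasure C' vtx' C vtx X f) (hτX : ∀ h ∈ X, τ h = C.opp h)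
    (hτ : ∀ h, τ (f h) = f (τ' h)) {Y : Set C'.H} {x y : C.H} (h : C.Joined τ (f '' Y) x y) :
    (∀ k, C.Exits X x (f k) → ∃ l, C.Exits X y (f l) ∧ C'.Joined τ' Y k l) ∧
      (∀ k, C.Exits X y (f k) → ∃ l, C.Exits X x (f l) ∧ C'.Joined τ' Y k l) := by
  induction h with
  | rel x y h =>
    rcases h with rfl | ⟨hx, rfl⟩
    · refine ⟨fun k hk => ⟨_, hf.exits_edge hk, .edge _⟩, fun k hk => ⟨_, ?_, .edge _⟩⟩
      have := hf.exits_edge hk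
      rwa [C.edge_edge] at this
    · by_cases hX : x ∈ X
      · rw [hτX x hX]
        refine ⟨fun k hk => ⟨_, hf.exits_opp hX hk, .edge _⟩, fun k hk => ⟨_, ?_, .edge _⟩⟩
        have := hf.exits_opp (hf.opp_mem hX) hk
        rwa [C.opp_opp] at this
      · obtain ⟨x, rfl⟩ := hf.exists_of_not_mem hX
        have hxY : x ∉ Y := fun h => hx ⟨x, h, rfl⟩
        rw [hτ]
        constructor
        · intro k hk
          have := hf.inj (hk.eq_of_not_mem hX)
          subst this
          exact ⟨_, .here _ (hf.not_mem _), .pass hxY⟩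
        · intro k hk
          have := hf.inj (hk.eq_of_not_mem (hf.not_mem _))
          subst this
          exact ⟨_, .here _ hX, (Joined.pass hxY).symm⟩
  | refl x => exact ⟨fun k hk => ⟨k, hk, .refl _⟩, fun k hk => ⟨k, hk, .refl _⟩⟩
  | symm _ _ _ ih => exact ⟨ih.2, ih.1⟩
  | trans _ _ _ _ _ ih1 ih2 =>
    constructor
    · intro k hk
      obtain ⟨l, hl, h1⟩ := ih1.1 k hk
      obtain ⟨m, hm, h2⟩ := ih2.1 l hl
      exact ⟨m, hm, h1.trans h2⟩
    · intro k hk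
      obtain ⟨l, hl, h1⟩ := ih2.2 k hk
      obtain ⟨m, hm, h2⟩ := ih1.2 l hl
      exact ⟨m, hm, h1.trans h2⟩

theorem joined_iff (hf : Erasure C' vtx' C vtx X f) (hτX : ∀ h ∈ X, τ h = C.opp h)
    (hτ : ∀ h, τ (f h) = f (τ' h)) {Y : Set C'.H} {k l : C'.H} :
    C.Joined τ (f '' Y) (f k) (f l) ↔ C'.Joined τ' Y k l := by
  refine ⟨fun h => ?_, hf.joined hτX hτ⟩
  obtain ⟨m, hm, hj⟩ := (hf.joined_exits hτX hτ h).1 k (.here _ (hf.not_mem _))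
  exact hf.inj (hm.eq_of_not_mem (hf.not_mem _)) ▸ hj

/-- A half-edge from which the erased diagram is not reached lies on a component all of whose
crossings are erased. -/
theorem joined_of_no_exit (hf : Erasure C' vtx' C vtx X f) (hτX : ∀ h ∈ X, τ h = C.opp h)
    {x y : C.H} (h : C.Joined C.opp ∅ x y) :
    ((∃ k, C.Exits X x (f k)) ↔ ∃ k, C.Exits X y (f k)) ∧
      ((¬∃ k, C.Exits X x (f k)) → C.Joined τ ∅ x y) := by
  induction h with
  | rel x y h =>
    rcases h with rfl | ⟨-, rfl⟩
    · refine ⟨⟨fun ⟨k, hk⟩ => ⟨_, hf.exits_edge hk⟩, fun ⟨k, hk⟩ => ⟨C'.edge k, ?_⟩⟩,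
        fun _ => .edge _⟩
      have := hf.exits_edge hk
      rwa [C.edge_edge] at this
    · by_cases hX : x ∈ X
      · refine ⟨⟨fun ⟨k, hk⟩ => ⟨_, hf.exits_opp hX hk⟩, fun ⟨k, hk⟩ => ⟨C'.edge k, ?_⟩⟩,
          fun _ => ?_⟩
        · have := hf.exits_opp (hf.opp_mem hX) hk
          rwa [C.opp_opp] at this
        · rw [← hτX x hX]
          exact .pass (by simp)
      · have hX' : C.opp x ∉ X := fun h => hX (by simpa [C.opp_opp] using hf.opp_mem h)
        obtain ⟨k, rfl⟩ := hf.exists_of_not_mem hX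
        obtain ⟨l, hl⟩ := hf.exists_of_not_mem hX'
        have h1 : ∃ m, C.Exits X (f k) (f m) := ⟨k, .here _ hX⟩
        have h2 : ∃ m, C.Exits X (C.opp (f k)) (f m) := ⟨l, by rw [hl]; exact .here _ hX'⟩
        exact ⟨iff_of_true h1 h2, fun h => absurd h1 h⟩
  | refl x => exact ⟨Iff.rfl, fun _ => .refl _⟩
  | symm _ _ _ ih => exact ⟨ih.1.symm, fun h => (ih.2 (ih.1.not.2 h)).symm⟩
  | trans _ _ _ _ _ ih1 ih2 =>
    exact ⟨ih1.1.trans ih2.1, fun h => (ih1.2 h).trans (ih2.2 (ih1.1.not.1 h))⟩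

theorem agreement_eq (hf : Erasure C' vtx' C vtx X f) (O : C.H → ZMod 2) :
    C.agreement vtx X O = C'.agreement vtx' ∅ (O ∘ f) := by
  classical
  unfold agreement
  symm
  refine Fintype.sum_of_injective f hf.inj _ _ (fun h hh => ?_) fun h => ?_
  · rw [hf.mem_range, not_not] at hh
    simp [hh]
  · by_cases hh : h ∈ C'.first
    · simp [hf.first_iff, hf.mixed_iff, hf.not_mem, hf.dir_eq h hh]
    · simp [hf.first_iff, hh]

/-- A direction of the erased diagram extends to the erased half-edges. -/
theorem exists_directs (hf : Erasure C' vtx' C vtx X f) (hτX : ∀ h ∈ X, τ h = C.opp h)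
    (hτ : ∀ h, τ (f h) = f (τ' h)) {O : C'.H → ZMod 2} (hO : C'.Directs τ' O) :
    ∃ O', C.Directs τ O' ∧ O' ∘ f = O := by
  classical
  -- Where one does not reach the erased diagram, the given direction serves.
  let O' : C.H → ZMod 2 := fun x => if h : ∃ k, C.Exits X x (f k) then O h.choose else C.dir x
  have h1 : ∀ x k, C.Exits X x (f k) → O' x = O k := by
    intro x k hk
    have h : ∃ k, C.Exits X x (f k) := ⟨k, hk⟩
    have : h.choose = k := hf.inj (h.choose_spec.unique hk)
    simp only [O', dif_pos h, this]
  have h2 : ∀ x, (¬∃ k, C.Exits X x (f k)) → O' x = C.dir x := fun x h => by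
    simp only [O', dif_neg h]
  refine ⟨O', fun x hx => ⟨?_, ?_⟩, funext fun k => h1 _ _ (.here _ (hf.not_mem k))⟩
  · by_cases h : ∃ k, C.Exits X x (f k)
    · obtain ⟨k, hk⟩ := h
      rw [h1 _ _ hk, h1 _ _ (hf.exits_edge hk), (hO k ?_).1]
      rwa [← hf.first_iff, ← hk.first_iff]
    · rw [h2 _ h, h2, C.dir_edge x hx]
      rintro ⟨k, hk⟩
      have := hf.exits_edge hk
      rw [C.edge_edge] at this
      exact h ⟨_, this⟩
  · by_cases hX : x ∈ X
    · rw [hτX x hX]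
      by_cases h : ∃ k, C.Exits X x (f k)
      · obtain ⟨k, hk⟩ := h
        rw [h1 _ _ hk, h1 _ _ (hf.exits_opp hX hk), (hO k ?_).1]
        rwa [← hf.first_iff, ← hk.first_iff]
      · rw [h2 _ h, h2, C.dir_opp x hx]
        rintro ⟨k, hk⟩
        have := hf.exits_opp (hf.opp_mem hX) hk
        rw [C.opp_opp] at this
        exact h ⟨_, this⟩
    · obtain ⟨k, rfl⟩ := hf.exists_of_not_mem hX
      rw [hτ, h1 _ _ (.here _ (hf.not_mem _)), h1 _ _ (.here _ (hf.not_mem _)),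
        (hO k ((hf.first_iff k).1 hx)).2]

theorem isCopy_iff (hf : Erasure C' vtx' C vtx X f) (hτX : ∀ h ∈ X, τ h = C.opp h)
    (hτ : ∀ h, τ (f h) = f (τ' h)) {L : Curves} {vL : L.H → VL} {Y : Set C'.H} :
    IsCopy L vL C vtx X τ (f '' Y) ↔ IsCopy L vL C' vtx' ∅ τ' Y := by
  have hmem : ∀ k, f k ∈ f '' Y ↔ k ∈ Y := fun k => hf.inj.mem_set_image
  constructor
  · intro h
    refine ⟨fun k l hkl hk => ?_, fun k hk => ?_, fun k l hkl => ?_, ?_⟩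
    · exact (hmem l).1 (h.sat _ _ ((hf.vtx_iff k l).2 hkl) ((hmem k).2 hk))
    · exact ⟨(hf.mixed_iff k).1 (h.mixed _ ((hmem k).2 hk)).1, by simp⟩
    · rw [← hf.joined_iff hτX hτ, Set.image_empty]
      exact h.conn _ _ (by rwa [hf.first_iff, hf.first_iff])
    · obtain ⟨O, hO, hag, φ, hφ⟩ := h.exists_embedding
      refine ⟨O ∘ f, fun k hk => ?_, by rw [← hf.agreement_eq, hag], ?_⟩
      · have hk' := (hf.first_iff k).2 hk
        refine ⟨?_, ?_⟩
        · have h1 := (hf.exits k).dir_eq hτX hO ((C.edge_first _).2 hk')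
          exact h1.trans (hO _ hk').1
        · simpa [hτ] using (hO _ hk').2
      · have : ∀ h, ∃ k, f k = φ h := fun h => by
          obtain ⟨k, -, hk⟩ := hφ.range_eq.subset ⟨h, rfl⟩
          exact ⟨k, hk⟩
        choose ψ hψ using this
        refine ⟨ψ, ⟨fun a b hab => hφ.inj ?_, ?_, fun a b => ?_, fun a => hf.inj ?_, fun a => ?_,
          fun a => ?_, fun a ha => ?_⟩⟩
        · rw [← hψ, ← hψ, hab]
        · ext k
          rw [← hmem, ← hφ.range_eq]
          constructor
          · rintro ⟨a, rfl⟩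
            exact ⟨a, (hψ a).symm⟩
          · rintro ⟨a, ha⟩
            exact ⟨a, hf.inj ((hψ a).trans ha)⟩
        · rw [← hφ.vtx_iff, ← hψ, ← hψ, hf.vtx_iff]
        · rw [hψ, hφ.opp_eq, hf.opp_eq, hψ]
        · rw [← hφ.first_iff, ← hψ, hf.first_iff]
        · rw [← hf.joined_iff hτX hτ, hψ, hψ]
          exact hφ.joined a
        · simpa [hψ] using hφ.dir_eq a ha
  · intro h
    refine ⟨?_, ?_, fun x y hxy => ?_, ?_⟩
    · rintro _ l hkl ⟨k, hk, rfl⟩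
      obtain ⟨l, rfl⟩ := hf.exists_of_not_mem fun hl => hf.not_mem k (hf.sat _ _ hkl.symm hl)
      exact (hmem l).2 (h.sat _ _ ((hf.vtx_iff k l).1 hkl) hk)
    · rintro _ ⟨k, hk, rfl⟩
      exact ⟨(hf.mixed_iff k).2 (h.mixed k hk).1, hf.not_mem k⟩
    · have key : ∀ x y, (x ∈ C.first ↔ y ∈ C.first) → (¬∃ k, C.Exits X x (f k)) →
          C.Joined τ ∅ x y := by
        intro x y hxy hx
        have hX : x ∈ X := by
          by_contra hX
          obtain ⟨k, rfl⟩ := hf.exists_of_not_mem hX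
          exact hx ⟨k, .here _ hX⟩
        exact (hf.joined_of_no_exit hτX (hf.conn x hX y hxy)).2 hx
      by_cases hx : ∃ k, C.Exits X x (f k)
      · by_cases hy : ∃ k, C.Exits X y (f k)
        · obtain ⟨k, hk⟩ := hx
          obtain ⟨l, hl⟩ := hy
          refine .trans (hk.joined hτX (by simp)) (.trans ?_ (hl.joined hτX (by simp)).symm)
          have := hf.joined hτX hτ (h.conn k l ?_)
          · rwa [Set.image_empty] at this
          · rw [← hf.first_iff, ← hf.first_iff, ← hk.first_iff, ← hl.first_iff, hxy]
        · exact (key y x hxy.symm hy).symm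
      · exact key x y hxy hx
    · obtain ⟨O, hO, hag, φ, hφ⟩ := h.exists_embedding
      obtain ⟨O', hO', rfl⟩ := hf.exists_directs hτX hτ hO
      refine ⟨O', hO', by rw [hf.agreement_eq, hag], f ∘ φ, ⟨hf.inj.comp hφ.inj, ?_, fun a b => ?_,
        fun a => ?_, fun a => ?_, fun a => ?_, fun a ha => ?_⟩⟩
      · rw [Set.range_comp, hφ.range_eq]
      · rw [← hφ.vtx_iff]
        exact hf.vtx_iff _ _
      · simp [hφ.opp_eq, hf.opp_eq]
      · rw [← hφ.first_iff]
        exact hf.first_iff _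
      · exact hf.joined hτX hτ (hφ.joined a)
      · exact hφ.dir_eq a ha

theorem copies_eq (hf : Erasure C' vtx' C vtx X f) (hτX : ∀ h ∈ X, τ h = C.opp h)
    (hτ : ∀ h, τ (f h) = f (τ' h)) {L : Curves} {vL : L.H → VL} :
    copies L vL C vtx X τ = copies L vL C' vtx' ∅ τ' := by
  classical
  symm
  refine Fintype.sum_of_injective (f '' ·) hf.inj.image_injective _ _ (fun Y hY => ?_) fun Y => ?_
  · rw [if_neg]
    intro h
    refine hY ⟨f ⁻¹' Y, Set.image_preimage_eq_of_subset fun y hy => ?_⟩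
    exact hf.exists_of_not_mem (h.mixed y hy).2
  · simp only [hf.isCopy_iff hτX hτ]

end

/-- Going straight through erased vertices is the same as not having them. -/
theorem bracket_eq (hf : Erasure C' vtx' C vtx X f) {L : Curves} {vL : L.H → VL} :
    bracket L vL C vtx X = bracket L vL C' vtx' ∅ := by
  classical
  symm
  have hext : ∀ (τ' : C'.H → C'.H) h, Function.extend f (f ∘ τ') C.opp (f h) = f (τ' h) :=
    fun τ' h => hf.inj.extend_apply _ _ _
  have hextX : ∀ (τ' : C'.H → C'.H), ∀ h ∈ X, Function.extend f (f ∘ τ') C.opp h = C.opp h :=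
    fun τ' h hh => Function.extend_apply' _ _ _ fun h' => (hf.mem_range h).1 h' hh
  unfold bracket
  refine Finset.sum_bij (fun τ' _ => Function.extend f (f ∘ τ') C.opp) (fun τ' hτ' => ?_)
    (fun τ₁ _ τ₂ _ h => funext fun x => hf.inj ?_) (fun τ hτ => ?_)
    fun τ' _ => (hf.copies_eq (hextX τ') (hext τ')).symm
  · simp only [Finset.mem_filter, Finset.mem_univ, true_and] at hτ' ⊢
    refine ⟨fun h => ?_, fun h => ?_, fun h hh => ?_, fun h hX hm => ?_⟩
    · by_cases hX : h ∈ X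
      · rw [hextX _ _ hX, hf.vtx_opp]
      · obtain ⟨h, rfl⟩ := hf.exists_of_not_mem hX
        rw [hext, hf.vtx_iff, hτ'.vtx_eq]
    · by_cases hX : h ∈ X
      · rw [hextX _ _ hX, hextX _ _ (hf.opp_mem hX), C.opp_opp]
      · obtain ⟨h, rfl⟩ := hf.exists_of_not_mem hX
        rw [hext, hext, hτ'.invol]
    · by_cases hX : h ∈ X
      · rw [hextX _ _ hX]
      · obtain ⟨h, rfl⟩ := hf.exists_of_not_mem hX
        rw [hext, hτ'.straight h (Or.inr ((hf.mixed_iff h).1 (hh.resolve_left hX))), hf.opp_eq]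
    · obtain ⟨h, rfl⟩ := hf.exists_of_not_mem hX
      obtain ⟨h1, h2⟩ := hτ'.turn h (by simp) ((hf.mixed_iff h).not.1 hm)
      rw [hext, ← hf.opp_eq]
      exact ⟨hf.inj.ne h1, hf.inj.ne h2⟩
  · rw [← hext τ₁, ← hext τ₂, h]
  · simp only [Finset.mem_filter, Finset.mem_univ, true_and] at hτ
    have : ∀ h, ∃ k, f k = τ (f h) := fun h => hf.exists_of_not_mem fun hX =>
      hf.not_mem h (hf.sat _ _ (hτ.vtx_eq _) hX)
    choose τ' hτ' using this
    refine ⟨τ', ?_, ?_⟩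
    · simp only [Finset.mem_filter, Finset.mem_univ, true_and]
      refine ⟨fun h => ?_, fun h => hf.inj ?_, fun h hh => hf.inj ?_, fun h _ hm => ?_⟩
      · rw [← hf.vtx_iff, hτ', hτ.vtx_eq]
      · rw [hτ', hτ', hτ.invol]
      · rw [hτ', hf.opp_eq, hτ.straight _ (Or.inr ((hf.mixed_iff h).2 (by simpa using hh)))]
      · obtain ⟨h1, h2⟩ := hτ.turn (f h) (hf.not_mem h) ((hf.mixed_iff h).not.2 hm)
        rw [← hτ'] at h1 h2
        rw [← hf.opp_eq] at h2
        exact ⟨fun h => h1 (by rw [h]), fun h => h2 (by rw [h])⟩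
    · funext h
      by_cases hX : h ∈ X
      · rw [hextX _ _ hX, hτ.straight h (Or.inl hX)]
      · obtain ⟨h, rfl⟩ := hf.exists_of_not_mem hX
        rw [hext, hτ']

end Erasure

end Curves

/-! ### Tangles -/

/-- The half-edges of a tangle with `k` crossings. The half-edge `(v, s, b)` lies at the crossing
`v` on its strand `s`; it belongs to an edge inside of the tangle if `b = false`, and leads out of
the tangle if `b = true`. -/
abbrev TangleHalf (k : ℕ) := Fin k × Bool × Bool

namespace TangleHalf

variable {k : ℕ}

/-- The opposite half-edge of a tangle. -/
def opp (x : TangleHalf k) : TangleHalf k := (x.1, x.2.1, !x.2.2)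

/-- The other half of an edge inside of the tangle. Here `ε` tells how these edges connect the
strands of the crossings. -/
def edge (ε : Fin k × Bool → Fin k × Bool) (x : TangleHalf k) : TangleHalf k :=
  ((ε (x.1, x.2.1)).1, (ε (x.1, x.2.1)).2, x.2.2)

/-- The way of passing through the crossings of a tangle in which the strand and the side are
changed at the crossing `v` according to `u v`. The straight way is `(false, true)`; the two
smoothings are `(true, false)` and `(true, true)`. -/
def through (u : Fin k → Bool × Bool) (x : TangleHalf k) : TangleHalf k :=
  (x.1, x.2.1 ^^ (u x.1).1, x.2.2 ^^ (u x.1).2)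

/-- Follow the tangle from `x`, with an edge first, for at most `n` steps, until the tangle is left
or a half-edge in `y` is met. -/
def walk (ε : Fin k × Bool → Fin k × Bool) (t : TangleHalf k → TangleHalf k)
    (y : TangleHalf k → Bool) : ℕ → TangleHalf k → TangleHalf k
  | 0, x => x
  | n + 1, x =>
    if x.2.2 then x else if y (edge ε x) then edge ε x else walk ε t y n (t (edge ε x))

variable (ε : Fin k × Bool → Fin k × Bool)

/-- The first half-edge outside of the tangle or in `y` when one follows the tangle from `x`, with
an edge first. (The tangles considered have at most three edges, so that four steps suffice.) -/
def exit (t : TangleHalf k → TangleHalf k) (y : TangleHalf k → Bool) (x : TangleHalf k) :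
    TangleHalf k :=
  walk ε t y 4 x

/-- A criterion for two half-edges to be joined within the tangle: a common end. -/
def Meet (t : TangleHalf k → TangleHalf k) (y : TangleHalf k → Bool) (x z : TangleHalf k) : Prop :=
  exit ε t y x = exit ε t y z ∨
    (y z = false ∧ exit ε t y x = exit ε t y (t z)) ∨
    (y x = false ∧ exit ε t y (t x) = exit ε t y z) ∨
    (y x = false ∧ y z = false ∧ exit ε t y (t x) = exit ε t y (t z)) ∨
    (y z = true ∧ exit ε t y x = z) ∨ (y x = true ∧ exit ε t y z = x) ∨
    (y x = false ∧ y z = true ∧ exit ε t y (t x) = z) ∨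
    (y x = true ∧ y z = false ∧ exit ε t y (t z) = x) ∨ x = z

instance (t : TangleHalf k → TangleHalf k) (y : TangleHalf k → Bool) (x z : TangleHalf k) :
    Decidable (Meet ε t y x z) := by
  unfold Meet
  infer_instance

/-- Send every half-edge to an end of its path, and this by `q` to the other tangle. -/
def push (t : TangleHalf k → TangleHalf k) (y : TangleHalf k → Bool)
    (q : TangleHalf k → TangleHalf k) (x : TangleHalf k) : TangleHalf k :=
  if y x then q x else if y (exit ε t y x) then q (exit ε t y x) else exit ε t y x

/-- `push` respects the links of the tangles. -/
def LinkCheck (t₁ t₂ : TangleHalf k → TangleHalf k) (y : TangleHalf k → Bool)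
    (q : TangleHalf k → TangleHalf k) : Prop :=
  ∀ x, (x.2.2 = true → Meet ε t₂ (fun z => y (q z)) x (push ε t₁ y q x)) ∧
    (x.2.2 = false → Meet ε t₂ (fun z => y (q z)) (push ε t₁ y q x) (push ε t₁ y q (edge ε x))) ∧
    (y x = false → Meet ε t₂ (fun z => y (q z)) (push ε t₁ y q x) (push ε t₁ y q (t₁ x)))

/-- The paths of the tangle connect its ends as `p` says, and there are no closed paths. -/
def Realizes (t p : TangleHalf k → TangleHalf k) : Prop :=
  ∀ x, (exit ε t (fun _ => false) x).2.2 = true ∧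
    exit ε t (fun _ => false) (t x) = p (exit ε t (fun _ => false) x) ∧
    (x.2.2 = false →
      exit ε t (fun _ => false) (edge ε x) = p (exit ε t (fun _ => false) x))

/-- The combinatorial conditions under which the crossings in `y` of the first tangle can be
replaced, by `q`, with crossings of the second one. -/
def Replaces (t₁ t₂ : TangleHalf k → TangleHalf k) (y : TangleHalf k → Bool)
    (q : TangleHalf k → TangleHalf k) (c₁ c₂ : TangleHalf k → Fin k) : Prop :=
  Realizes ε t₁ (fun x => exit ε t₁ (fun _ => false) (t₁ x)) ∧
  Realizes ε t₂ (fun x => exit ε t₁ (fun _ => false) (t₁ x)) ∧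
  LinkCheck ε t₁ t₂ (fun _ => false) id ∧ LinkCheck ε t₁ t₂ y q ∧
  (∀ x, q (q x) = x) ∧
  (∀ x, y x = true → q (opp x) = opp (q x) ∧
    exit ε t₂ (fun _ => false) (q x) = exit ε t₁ (fun _ => false) x) ∧
  (∀ x z, y x = true → y z = true → (c₂ (q x) = c₂ (q z) ↔ c₁ x = c₁ z)) ∧
  ∀ x z, c₂ x = c₂ z → y (q x) = true → y (q z) = true

instance (t p : TangleHalf k → TangleHalf k) : Decidable (Realizes ε t p) := by
  unfold Realizes
  infer_instance

instance (t₁ t₂ : TangleHalf k → TangleHalf k) (y : TangleHalf k → Bool)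
    (q : TangleHalf k → TangleHalf k) : Decidable (LinkCheck ε t₁ t₂ y q) := by
  unfold LinkCheck
  infer_instance

instance (t₁ t₂ : TangleHalf k → TangleHalf k) (y : TangleHalf k → Bool)
    (q : TangleHalf k → TangleHalf k) (c₁ c₂ : TangleHalf k → Fin k) :
    Decidable (Replaces ε t₁ t₂ y q c₁ c₂) := by
  unfold Replaces
  infer_instance

end TangleHalf

namespace Curves

open TangleHalf

variable {V VL V' : Type} {k : ℕ}

/-- The tangle with the edges `ε` is placed on the curves by `ι`. -/
structure Placed (C : Curves) (ε : Fin k × Bool → Fin k × Bool)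
    (ι : TangleHalf k → C.H) : Prop where
  inj : Function.Injective ι
  opp_eq : ∀ x, C.opp (ι x) = ι x.opp
  edge_eq : ∀ x : TangleHalf k, x.2.2 = false → C.edge (ι x) = ι (x.edge ε)

/-- The half-edges of the tangle at the crossing `v` are those with `c x = v`, and these are all
half-edges at the corresponding vertex. -/
structure CrossesBy (C : Curves) (vtx : C.H → V) (ι : TangleHalf k → C.H)
    (c : TangleHalf k → Fin k) : Prop where
  vtx_iff : ∀ x z, vtx (ι x) = vtx (ι z) ↔ c x = c z
  sat : ∀ h x, vtx h = vtx (ι x) → h ∈ Set.range ι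

/-- The map that is `q` on a tangle and the identity elsewhere. -/
noncomputable def lift {H : Type} (ι : TangleHalf k → H) (q : TangleHalf k → TangleHalf k) :
    H → H :=
  Function.extend ι (ι ∘ q) id

/-- The map that is `t` on a tangle and `τ` elsewhere. -/
noncomputable def replace {H : Type} (ι : TangleHalf k → H) (t : TangleHalf k → TangleHalf k)
    (τ : H → H) : H → H :=
  Function.extend ι (ι ∘ t) τ

section lift

variable {H : Type} {ι : TangleHalf k → H} {t q : TangleHalf k → TangleHalf k} {τ : H → H}

theorem lift_apply (hι : Function.Injective ι) (x) : lift ι q (ι x) = ι (q x) :=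
  hι.extend_apply _ _ _

theorem lift_of_not_mem {h : H} (hh : h ∉ Set.range ι) : lift ι q h = h :=
  Function.extend_apply' _ _ _ hh

theorem replace_apply (hι : Function.Injective ι) (x) : replace ι t τ (ι x) = ι (t x) :=
  hι.extend_apply _ _ _

theorem replace_of_not_mem {h : H} (hh : h ∉ Set.range ι) : replace ι t τ h = τ h :=
  Function.extend_apply' _ _ _ hh

theorem lift_id (hι : Function.Injective ι) : lift ι id = id := by
  funext h
  by_cases hh : h ∈ Set.range ι
  · obtain ⟨x, rfl⟩ := hh
    exact lift_apply hι x
  · exact lift_of_not_mem hh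

theorem lift_lift (hι : Function.Injective ι) (hq : ∀ x, q (q x) = x) (h : H) :
    lift ι q (lift ι q h) = h := by
  by_cases hh : h ∈ Set.range ι
  · obtain ⟨x, rfl⟩ := hh
    rw [lift_apply hι, lift_apply hι, hq]
  · rw [lift_of_not_mem hh, lift_of_not_mem hh]

end lift

section walk

variable {C : Curves} {ε : Fin k × Bool → Fin k × Bool} {ι : TangleHalf k → C.H}
  {t : TangleHalf k → TangleHalf k} {y : TangleHalf k → Bool} {τ : C.H → C.H} {Y : Set C.H}

theorem joined_walk (hι : C.Placed ε ι) (hτ : ∀ x, τ (ι x) = ι (t x))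
    (hY : ∀ x, ι x ∈ Y ↔ y x = true) (n : ℕ) (x : TangleHalf k) :
    C.Joined τ Y (ι x) (ι (walk ε t y n x)) := by
  induction n generalizing x with
  | zero => exact .refl _
  | succ n ih =>
    unfold walk
    split_ifs with h1 h2
    · exact .refl _
    · rw [← hι.edge_eq x (by simpa using h1)]
      exact .edge _
    · refine .trans (.edge _) (.trans ?_ (ih _))
      rw [hι.edge_eq x (by simpa using h1), ← hτ]
      exact .pass (by rwa [hY])

theorem joined_exit (hι : C.Placed ε ι) (hτ : ∀ x, τ (ι x) = ι (t x))
    (hY : ∀ x, ι x ∈ Y ↔ y x = true) (x : TangleHalf k) :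
    C.Joined τ Y (ι x) (ι (exit ε t y x)) :=
  joined_walk hι hτ hY 4 x

theorem joined_of_meet (hι : C.Placed ε ι) (hτ : ∀ x, τ (ι x) = ι (t x))
    (hY : ∀ x, ι x ∈ Y ↔ y x = true) {x z : TangleHalf k} (h : Meet ε t y x z) :
    C.Joined τ Y (ι x) (ι z) := by
  have h1 := joined_exit hι hτ hY
  have h2 : ∀ x, y x = false → C.Joined τ Y (ι x) (ι (exit ε t y (t x))) := by
    intro x hx
    refine .trans ?_ (h1 (t x))
    rw [← hτ]
    exact .pass (by simp [hY, hx])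
  rcases h with h | ⟨hz, h⟩ | ⟨hx, h⟩ | ⟨hx, hz, h⟩ | ⟨-, h⟩ | ⟨-, h⟩ | ⟨hx, -, h⟩ |
    ⟨-, hz, h⟩ | rfl
  · exact .trans (h1 x) (h ▸ (h1 z).symm)
  · exact .trans (h1 x) (h ▸ (h2 z hz).symm)
  · exact .trans (h2 x hx) (h ▸ (h1 z).symm)
  · exact .trans (h2 x hx) (h ▸ (h2 z hz).symm)
  · exact h ▸ h1 x
  · exact (h ▸ h1 z).symm
  · exact h ▸ h2 x hx
  · exact (h ▸ h2 z hz).symm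
  · exact .refl _

theorem walk_first_iff (hι : C.Placed ε ι) (hτ : ∀ x, τ (ι x) = ι (t x))
    (hτf : ∀ h, τ h ∈ C.first ↔ h ∈ C.first) (n : ℕ) (x : TangleHalf k) :
    ι (walk ε t y n x) ∈ C.first ↔ ι x ∈ C.first := by
  induction n generalizing x with
  | zero => rfl
  | succ n ih =>
    unfold walk
    split_ifs with h1 h2
    · rfl
    · rw [← hι.edge_eq x (by simpa using h1), C.edge_first]
    · rw [ih, ← hτ, hτf, ← hι.edge_eq x (by simpa using h1), C.edge_first]

/-- Following an edge and then passing a crossing preserves the direction. -/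
theorem directs_walk (hι : C.Placed ε ι) (hτ : ∀ x, τ (ι x) = ι (t x))
    (hτf : ∀ h, τ h ∈ C.first ↔ h ∈ C.first) {O : C.H → ZMod 2} (hO : C.Directs τ O)
    (n : ℕ) (x : TangleHalf k) (hx : ι x ∈ C.first) :
    O (ι (walk ε t (fun _ => false) n x)) = O (ι x) := by
  induction n generalizing x with
  | zero => rfl
  | succ n ih =>
    unfold walk
    simp only [Bool.false_eq_true, if_false]
    split_ifs with h1
    · rfl
    · have he := hι.edge_eq x (by simpa using h1)
      have hf : C.edge (ι x) ∈ C.first := (C.edge_first _).2 hx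
      have hO' := (hO _ hf).2
      have hf' := (hτf _).2 hf
      rw [he, hτ] at hO' hf'
      rw [ih _ hf', hO', ← he, (hO _ hx).1, add_assoc, CharTwo.add_self_eq_zero, add_zero]

end walk

section transfer

variable {C : Curves} {ε : Fin k × Bool → Fin k × Bool} {ι : TangleHalf k → C.H}

open scoped Classical in
/-- The contribution of a tangle to the agreement. -/
noncomputable def localAgreement (C : Curves) (vtx : C.H → V) (X : Set C.H) (ι : TangleHalf k → C.H)
    (O : C.H → ZMod 2) : ZMod 2 :=
  ∑ x, if ι x ∈ C.first ∧ C.Mixed vtx (ι x) ∧ ι x ∉ X then O (ι x) * C.dir (ι x) else 0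

/-- A diagram, smoothed according to `τ`, that follows the pattern `t` on a tangle. -/
structure Follows (C : Curves) (vtx : C.H → V) (X : Set C.H) (τ : C.H → C.H)
    (ι : TangleHalf k → C.H)
    (t : TangleHalf k → TangleHalf k) (c : TangleHalf k → Fin k) : Prop where
  crosses : C.CrossesBy vtx ι c
  through : ∀ x, τ (ι x) = ι (t x)
  invol : ∀ h, τ (τ h) = h
  first_iff : ∀ h, τ h ∈ C.first ↔ h ∈ C.first

/-- Two diagrams that agree outside of a tangle. -/
structure AgreeOff (C : Curves) (vtx₁ vtx₂ : C.H → V) (X₁ X₂ : Set C.H) (τ₁ τ₂ : C.H → C.H)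
    (ι : TangleHalf k → C.H) : Prop where
  vtx_eq : ∀ h ∉ Set.range ι, vtx₂ h = vtx₁ h
  mem_iff : ∀ h ∉ Set.range ι, h ∈ X₂ ↔ h ∈ X₁
  through_eq : ∀ h ∉ Set.range ι, τ₂ h = τ₁ h

variable {vtx₁ vtx₂ : C.H → V} {X₁ X₂ : Set C.H} {τ₁ τ₂ : C.H → C.H}
  {t₁ t₂ q : TangleHalf k → TangleHalf k} {c₁ c₂ : TangleHalf k → Fin k} {y : TangleHalf k → Bool}

theorem Follows.not_mem (h₁ : C.Follows vtx₁ X₁ τ₁ ι t₁ c₁) {h : C.H} (hh : h ∉ Set.range ι) :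
    τ₁ h ∉ Set.range ι := by
  rintro ⟨x, hx⟩
  apply hh
  rw [← h₁.invol h, ← hx, h₁.through]
  exact ⟨_, rfl⟩

/-- Pushing the half-edges of one tangle to the other one preserves being joined: this only has to
be checked for the links of the tangle. -/
theorem joined_push (hι : C.Placed ε ι) (h₁ : C.Follows vtx₁ X₁ τ₁ ι t₁ c₁)
    (h₂ : C.Follows vtx₂ X₂ τ₂ ι t₂ c₂) (ha : C.AgreeOff vtx₁ vtx₂ X₁ X₂ τ₁ τ₂ ι)
    (hl : LinkCheck ε t₁ t₂ y q) {Y : Set C.H}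
    (hY : ∀ x, ι x ∈ Y ↔ y x = true) {h h' : C.H} (hj : C.Joined τ₁ Y h h') :
    C.Joined τ₂ (lift ι q ⁻¹' Y) (lift ι (push ε t₁ y q) h) (lift ι (push ε t₁ y q) h') := by
  have hY' : ∀ x, ι x ∈ lift ι q ⁻¹' Y ↔ y (q x) = true := fun x => by
    rw [Set.mem_preimage, lift_apply hι.inj, hY]
  have key : ∀ x z, Meet ε t₂ (fun z => y (q z)) x z →
      C.Joined τ₂ (lift ι q ⁻¹' Y) (ι x) (ι z) := fun x z => joined_of_meet hι h₂.through hY'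
  -- Outer half-edges and those off the tangle are joined to their images.
  have fix : ∀ h, (∀ x, x.2.2 = false → h ≠ ι x) →
      C.Joined τ₂ (lift ι q ⁻¹' Y) h (lift ι (push ε t₁ y q) h) := by
    intro h hh
    by_cases hr : h ∈ Set.range ι
    · obtain ⟨x, rfl⟩ := hr
      rw [lift_apply hι.inj]
      exact key _ _ ((hl x).1 (by by_contra hx; exact hh x (by simpa using hx) rfl))
    · rw [lift_of_not_mem hr]
      exact .refl _
  induction hj with
  | rel h h' hj =>
    rcases hj with rfl | ⟨hh, rfl⟩
    · by_cases hr : ∃ x : TangleHalf k, x.2.2 = false ∧ h = ι x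
      · obtain ⟨x, hx, rfl⟩ := hr
        rw [hι.edge_eq x hx, lift_apply hι.inj, lift_apply hι.inj]
        exact key _ _ ((hl x).2.1 hx)
      · refine .trans (fix h fun x hx hh => hr ⟨x, hx, hh⟩).symm (.trans (.edge _) (fix _ ?_))
        rintro x hx hh
        refine hr ⟨x.edge ε, hx, ?_⟩
        rw [← hι.edge_eq x hx, ← hh, C.edge_edge]
    · by_cases hr : h ∈ Set.range ι
      · obtain ⟨x, rfl⟩ := hr
        rw [h₁.through, lift_apply hι.inj, lift_apply hι.inj]
        exact key _ _ ((hl x).2.2 (by simpa [hY] using hh))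
      · rw [lift_of_not_mem hr, lift_of_not_mem (h₁.not_mem hr), ← ha.through_eq h hr]
        exact .pass (by rwa [Set.mem_preimage, lift_of_not_mem hr])
  | refl => exact .refl _
  | symm _ _ _ ih => exact ih.symm
  | trans _ _ _ _ _ ih1 ih2 => exact ih1.trans ih2

theorem AgreeOff.mixed_iff (ha : C.AgreeOff vtx₁ vtx₂ X₁ X₂ τ₁ τ₂ ι)
    (h₁ : C.CrossesBy vtx₁ ι c₁) (h₂ : C.CrossesBy vtx₂ ι c₂) {h : C.H} (hh : h ∉ Set.range ι) :
    C.Mixed vtx₂ h ↔ C.Mixed vtx₁ h := by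
  constructor
  · rintro ⟨k, hk, hn⟩
    have : k ∉ Set.range ι := by
      rintro ⟨x, rfl⟩
      exact hh (h₂.sat _ _ hk.symm)
    exact ⟨k, by rwa [← ha.vtx_eq k this, ← ha.vtx_eq h hh], hn⟩
  · rintro ⟨k, hk, hn⟩
    have : k ∉ Set.range ι := by
      rintro ⟨x, rfl⟩
      exact hh (h₁.sat _ _ hk.symm)
    exact ⟨k, by rwa [ha.vtx_eq k this, ha.vtx_eq h hh], hn⟩

theorem sum_eq_of_local {H : Type} [Fintype H] {ι : TangleHalf k → H} (hι : Function.Injective ι)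
    {F G : H → ZMod 2} (hoff : ∀ h ∉ Set.range ι, F h = G h) (hloc : ∑ x, F (ι x) = ∑ x, G (ι x)) :
    ∑ h, F h = ∑ h, G h := by
  have : ∑ h, (F h - G h) = ∑ x, (F (ι x) - G (ι x)) :=
    (Fintype.sum_of_injective ι hι _ _ (fun h hh => by rw [hoff h hh, sub_self]) fun x => rfl).symm
  rw [Finset.sum_sub_distrib, Finset.sum_sub_distrib, hloc, sub_self] at this
  exact sub_eq_zero.1 this

/-- If one tangle replaces another one, and this does not change the agreement, then copies of `L`
remain copies. -/
theorem IsCopy.transfer (hι : C.Placed ε ι) (h₁ : C.Follows vtx₁ X₁ τ₁ ι t₁ c₁)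
    (h₂ : C.Follows vtx₂ X₂ τ₂ ι t₂ c₂) (ha : C.AgreeOff vtx₁ vtx₂ X₁ X₂ τ₁ τ₂ ι)
    (hr : Replaces ε t₁ t₂ y q c₁ c₂) {Y : Set C.H} (hY : ∀ x, ι x ∈ Y ↔ y x = true)
    (hf : ∀ x, y x = true → (ι (q x) ∈ C.first ↔ ι x ∈ C.first))
    (hm : ∀ x, y (q x) = true → C.Mixed vtx₂ (ι x) ∧ ι x ∉ X₂)
    (hag : ∀ O₁ O₂, C.Directs τ₁ O₁ → C.Directs τ₂ O₂ →
      (∀ x : TangleHalf k, x.2.2 = true → O₂ (ι x) = O₁ (ι x)) →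
        C.localAgreement vtx₁ X₁ ι O₁ = C.localAgreement vtx₂ X₂ ι O₂)
    {L : Curves} {vL : L.H → VL} (hc : IsCopy L vL C vtx₁ X₁ τ₁ Y) :
    IsCopy L vL C vtx₂ X₂ τ₂ (lift ι q ⁻¹' Y) := by
  classical
  obtain ⟨hr1, hr2, hl0, hl, hq, hqy, hqc, hsat⟩ := hr
  have hj := fun {h h'} => joined_push (h := h) (h' := h') hι h₁ h₂ ha hl hY
  have hY' : ∀ x, ι x ∈ lift ι q ⁻¹' Y ↔ y (q x) = true := fun x => by
    rw [Set.mem_preimage, lift_apply hι.inj, hY]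
  have hoff : ∀ h ∉ Set.range ι, (h ∈ lift ι q ⁻¹' Y ↔ h ∈ Y) := fun h hh => by
    rw [Set.mem_preimage, lift_of_not_mem hh]
  have hqmem : ∀ h, lift ι q h ∈ lift ι q ⁻¹' Y ↔ h ∈ Y := fun h => by
    rw [Set.mem_preimage, lift_lift hι.inj hq]
  refine ⟨?_, ?_, ?_, ?_⟩
  · intro h h' hh hmem
    by_cases hh1 : h ∈ Set.range ι
    · obtain ⟨x, rfl⟩ := hh1
      obtain ⟨z, rfl⟩ := h₂.crosses.sat _ _ hh.symm
      exact (hY' z).2 (hsat x z ((h₂.crosses.vtx_iff _ _).1 hh) ((hY' x).1 hmem))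
    · have hh2 : h' ∉ Set.range ι := by
        rintro ⟨z, rfl⟩
        exact hh1 (h₂.crosses.sat _ _ hh)
      rw [hoff _ hh1] at hmem
      rw [hoff _ hh2]
      exact hc.sat h h' (by rwa [← ha.vtx_eq h hh1, ← ha.vtx_eq h' hh2]) hmem
  · intro h hh
    by_cases hh1 : h ∈ Set.range ι
    · obtain ⟨x, rfl⟩ := hh1
      exact hm x ((hY' x).1 hh)
    · rw [hoff _ hh1] at hh
      rw [ha.mixed_iff h₁.crosses h₂.crosses hh1, ha.mem_iff h hh1]
      exact hc.mixed h hh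
  · intro h h' hh
    have hj0 := fun {h h'} => joined_push (h := h) (h' := h') hι h₁ h₂ ha hl0 (Y := ∅)
      (by simp)
    simp only [Set.preimage_empty] at hj0
    -- Every half-edge is joined, in the second diagram, to one that is fixed by `push`.
    let m : C.H → C.H := lift ι (exit ε t₂ fun _ => false)
    have hm1 : ∀ h, C.Joined τ₂ ∅ h (m h) := by
      intro h
      by_cases hh : h ∈ Set.range ι
      · obtain ⟨x, rfl⟩ := hh
        simp only [m, lift_apply hι.inj]
        exact joined_exit hι h₂.through (by simp) x
      · simp only [m, lift_of_not_mem hh]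
        exact .refl _
    have hm2 : ∀ h, C.Joined τ₂ ∅ (m h)
        (lift ι (push ε t₁ (fun _ => false) id) (m h)) := by
      intro h
      by_cases hh : h ∈ Set.range ι
      · obtain ⟨x, rfl⟩ := hh
        simp only [m, lift_apply hι.inj]
        exact joined_of_meet hι h₂.through (by simp) ((hl0 _).1 (hr2 x).1)
      · simp only [m, lift_of_not_mem hh]
        exact .refl _
    have hm3 : ∀ h, m h ∈ C.first ↔ h ∈ C.first := by
      intro h
      by_cases hh : h ∈ Set.range ι
      · obtain ⟨x, rfl⟩ := hh
        simp only [m, lift_apply hι.inj]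
        exact walk_first_iff hι h₂.through h₂.first_iff _ x
      · simp only [m, lift_of_not_mem hh]
    refine .trans (.trans (hm1 h) (hm2 h)) (.trans (hj0 (hc.conn (m h) (m h') ?_))
      ((hm1 h').trans (hm2 h')).symm)
    rw [hm3, hm3, hh]
  · obtain ⟨O, hO, hO1, φ, hφ⟩ := hc.exists_embedding
    let O' : C.H → ZMod 2 := fun h =>
      if hh : h ∈ Set.range ι then O (ι (exit ε t₂ (fun _ => false) hh.choose)) else O h
    have hO'ι : ∀ x, O' (ι x) = O (ι (exit ε t₂ (fun _ => false) x)) := by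
      intro x
      have hh : ι x ∈ Set.range ι := ⟨x, rfl⟩
      have : hh.choose = x := hι.inj hh.choose_spec
      simp only [O', dif_pos hh, this]
    have hO'off : ∀ h ∉ Set.range ι, O' h = O h := fun h hh => by simp only [O', dif_neg hh]
    have hO'out : ∀ x : TangleHalf k, x.2.2 = true → O' (ι x) = O (ι x) := by
      intro x hx
      rw [hO'ι]
      simp [exit, walk, hx]
    have hfix : ∀ h, (∀ x, x.2.2 = false → h ≠ ι x) → O' h = O h := by
      intro h hh
      by_cases hr : h ∈ Set.range ι
      · obtain ⟨x, rfl⟩ := hr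
        exact hO'out x (by by_contra hx; exact hh x (by simpa using hx) rfl)
      · exact hO'off h hr
    -- The paths of both tangles connect the same ends, and along a path of the first one the
    -- direction changes sign. So the direction at the ends extends to the second tangle.
    have hflip : ∀ x : TangleHalf k, ι x ∈ C.first →
        O (ι (exit ε t₁ (fun _ => false) (t₁ x))) = O (ι x) + 1 := by
      intro x hx
      have : ι (t₁ x) ∈ C.first := by rwa [← h₁.through, h₁.first_iff]
      rw [exit, directs_walk hι h₁.through h₁.first_iff hO 4 _ this, ← h₁.through, (hO _ hx).2]
    have hdir : C.Directs τ₂ O' := by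
      intro h hh
      constructor
      · by_cases hr : ∃ x : TangleHalf k, x.2.2 = false ∧ h = ι x
        · obtain ⟨x, hx, rfl⟩ := hr
          rw [hι.edge_eq x hx, hO'ι, hO'ι, (hr2 x).2.2 hx]
          refine hflip _ ?_
          exact (walk_first_iff hι h₂.through h₂.first_iff _ x).2 hh
        · rw [hfix h fun x hx hh => hr ⟨x, hx, hh⟩, hfix, (hO h hh).1]
          rintro x hx hh
          refine hr ⟨x.edge ε, hx, ?_⟩
          rw [← hι.edge_eq x hx, ← hh, C.edge_edge]
      · by_cases hr : h ∈ Set.range ι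
        · obtain ⟨x, rfl⟩ := hr
          rw [h₂.through, hO'ι, hO'ι, (hr2 x).2.1]
          exact hflip _ ((walk_first_iff hι h₂.through h₂.first_iff _ x).2 hh)
        · rw [hO'off h hr, hO'off _ (h₂.not_mem hr), ha.through_eq h hr, (hO h hh).2]
    refine ⟨O', hdir, ?_, lift ι q ∘ φ, ?_⟩
    · rw [← hO1]
      symm
      refine sum_eq_of_local hι.inj (fun h hh => ?_) (hag O O' hO hdir hO'out)
      rw [hO'off h hh, ha.mixed_iff h₁.crosses h₂.crosses hh, ha.mem_iff h hh]
    · have hφY : ∀ a, φ a ∈ Y := fun a => hφ.range_eq ▸ ⟨a, rfl⟩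
      have hlift_inj : Function.Injective (lift ι q) :=
        Function.LeftInverse.injective (g := lift ι q) (lift_lift hι.inj hq)
      have hpush : ∀ a, lift ι (push ε t₁ y q) (φ a) = lift ι q (φ a) := by
        intro a
        by_cases hr : φ a ∈ Set.range ι
        · obtain ⟨x, hx⟩ := hr
          have hy := (hY x).1 (hx ▸ hφY a)
          rw [← hx, lift_apply hι.inj, lift_apply hι.inj, push, if_pos hy]
        · rw [lift_of_not_mem hr, lift_of_not_mem hr]
      refine ⟨hlift_inj.comp hφ.inj, ?_, fun a b => ?_, fun a => ?_, fun a => ?_, fun a => ?_,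
        fun a ha => ?_⟩
      · rw [Set.range_comp, hφ.range_eq]
        ext h
        constructor
        · rintro ⟨h, hh, rfl⟩
          exact (hqmem h).2 hh
        · intro hh
          exact ⟨lift ι q h, hh, lift_lift hι.inj hq h⟩
      · rw [← hφ.vtx_iff]
        simp only [Function.comp]
        by_cases hr : φ a ∈ Set.range ι
        · obtain ⟨x, hx⟩ := hr
          by_cases hr' : φ b ∈ Set.range ι
          · obtain ⟨z, hz⟩ := hr'
            rw [← hx, ← hz, lift_apply hι.inj, lift_apply hι.inj, h₁.crosses.vtx_iff,
              h₂.crosses.vtx_iff]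
            exact hqc x z ((hY x).1 (hx ▸ hφY a)) ((hY z).1 (hz ▸ hφY b))
          · rw [← hx, lift_apply hι.inj, lift_of_not_mem hr']
            exact iff_of_false (fun h => hr' (h₂.crosses.sat _ _ h.symm))
              fun h => hr' (h₁.crosses.sat _ _ h.symm)
        · by_cases hr' : φ b ∈ Set.range ι
          · obtain ⟨z, hz⟩ := hr'
            rw [← hz, lift_apply hι.inj, lift_of_not_mem hr]
            exact iff_of_false (fun h => hr (h₂.crosses.sat _ _ h))
              fun h => hr (h₁.crosses.sat _ _ h)
          · rw [lift_of_not_mem hr, lift_of_not_mem hr', ha.vtx_eq _ hr, ha.vtx_eq _ hr']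
      · simp only [Function.comp]
        rw [hφ.opp_eq]
        by_cases hr : φ a ∈ Set.range ι
        · obtain ⟨x, hx⟩ := hr
          rw [← hx, hι.opp_eq, lift_apply hι.inj, lift_apply hι.inj, hι.opp_eq,
            (hqy x ((hY x).1 (hx ▸ hφY a))).1]
        · rw [lift_of_not_mem hr, lift_of_not_mem]
          rintro ⟨x, hx⟩
          exact hr ⟨x.opp, by rw [← hι.opp_eq, hx, C.opp_opp]⟩
      · rw [← hφ.first_iff]
        simp only [Function.comp]
        by_cases hr : φ a ∈ Set.range ι
        · obtain ⟨x, hx⟩ := hr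
          rw [← hx, lift_apply hι.inj]
          exact hf x ((hY x).1 (hx ▸ hφY a))
        · rw [lift_of_not_mem hr]
      · have := hj (hφ.joined a)
        rwa [hpush, hpush] at this
      · rw [← hφ.dir_eq a ha]
        simp only [Function.comp]
        by_cases hr : φ a ∈ Set.range ι
        · obtain ⟨x, hx⟩ := hr
          have hfx : ι x ∈ C.first := by rwa [hx, hφ.first_iff]
          rw [← hx, lift_apply hι.inj, hO'ι, (hqy x ((hY x).1 (hx ▸ hφY a))).2]
          exact directs_walk hι h₁.through h₁.first_iff hO 4 x hfx
        · rw [lift_of_not_mem hr, hO'off _ hr]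

end transfer

end Curves

/-! ### Summation over the smoothings of a tangle -/

namespace TangleHalf

variable {k : ℕ}

/-- The ways of passing through the crossings of a tangle if those in `m` are passed straight, and
the others are smoothed. -/
def choices (m : Fin k → Bool) : Finset (Fin k → Bool × Bool) :=
  {u | ∀ v, if m v then u v = (false, true) else (u v).1 = true}

theorem through_through (u : Fin k → Bool × Bool) (x : TangleHalf k) :
    through u (through u x) = x := by
  simp [through]

theorem opp_opp (x : TangleHalf k) : opp (opp x) = x := by
  simp [opp]

/-- At a single crossing, a way of passing is straight or one of the two smoothings. -/
theorem exists_choice : ∀ g : Bool × Bool → Bool × Bool, (∀ z, g (g z) = z) →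
    ((∀ z, g z = (z.1, !z.2)) ∨ ∀ z, g z ≠ z ∧ g z ≠ (z.1, !z.2)) →
    ∀ z, g z = (z.1 ^^ (g (false, false)).1, z.2 ^^ (g (false, false)).2) := by
  decide +kernel

end TangleHalf

namespace Curves

open TangleHalf

variable {V VL V' : Type} {k : ℕ} {C : Curves} {ε : Fin k × Bool → Fin k × Bool}
  {ι : TangleHalf k → C.H} {vtx vtx₁ vtx₂ : C.H → V} {X X₁ X₂ : Set C.H} {τ τ₁ τ₂ : C.H → C.H}
  {t t₁ t₂ q : TangleHalf k → TangleHalf k} {c c₁ c₂ : TangleHalf k → Fin k}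
  {L : Curves} {vL : L.H → VL}

theorem replace_inj_off {τ τ' : C.H → C.H} (hτ : ∀ x, τ (ι x) = τ' (ι x))
    (h : replace ι t₁ τ = replace ι t₂ τ') : τ = τ' := by
  funext h'
  by_cases hr : h' ∈ Set.range ι
  · obtain ⟨x, rfl⟩ := hr
    exact hτ x
  · rw [← replace_of_not_mem (t := t₁) (τ := τ) hr, h, replace_of_not_mem hr]

theorem isState_replace (hinj : Function.Injective ι) (hopp : ∀ x, C.opp (ι x) = ι x.opp)
    (hc : C.CrossesBy vtx ι (·.1)) {m : Fin k → Bool} (hm : ∀ x, C.Mixed vtx (ι x) ↔ m x.1 = true)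
    (hτ : C.IsState vtx (Set.range ι) τ) {u : Fin k → Bool × Bool} (hu : u ∈ choices m) :
    C.IsState vtx ∅ (replace ι (through u) τ) := by
  simp only [choices, Finset.mem_filter, Finset.mem_univ, true_and] at hu
  have hoff : ∀ h ∉ Set.range ι, τ h ∉ Set.range ι := by
    rintro h hh ⟨x, hx⟩
    refine hh ?_
    rw [← hτ.invol h, ← hx, hτ.straight _ (Or.inl ⟨x, rfl⟩), hopp]
    exact ⟨_, rfl⟩
  refine ⟨fun h => ?_, fun h => ?_, fun h hs => ?_, fun h _ hs => ?_⟩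
  · by_cases hr : h ∈ Set.range ι
    · obtain ⟨x, rfl⟩ := hr
      rw [replace_apply hinj, hc.vtx_iff]
      rfl
    · rw [replace_of_not_mem hr, hτ.vtx_eq]
  · by_cases hr : h ∈ Set.range ι
    · obtain ⟨x, rfl⟩ := hr
      rw [replace_apply hinj, replace_apply hinj, through_through]
    · rw [replace_of_not_mem hr, replace_of_not_mem (hoff h hr), hτ.invol]
  · have hs : C.Mixed vtx h := by simpa using hs
    by_cases hr : h ∈ Set.range ι
    · obtain ⟨x, rfl⟩ := hr
      have := hu x.1
      rw [if_pos ((hm x).1 hs)] at this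
      rw [replace_apply hinj, hopp]
      simp [through, this, TangleHalf.opp]
    · rw [replace_of_not_mem hr, hτ.straight h (Or.inr hs)]
  · by_cases hr : h ∈ Set.range ι
    · obtain ⟨x, rfl⟩ := hr
      have := hu x.1
      rw [if_neg (fun h' => hs ((hm x).2 h'))] at this
      rw [replace_apply hinj, hopp]
      have hne : (through u x).2.1 ≠ x.2.1 := by simp [through, this]
      exact ⟨fun h => hne (by rw [hinj h]), fun h => hne (by rw [hinj h]; rfl)⟩
    · rw [replace_of_not_mem hr]
      exact hτ.turn h hr hs

theorem exists_isState_replace (hinj : Function.Injective ι) (hopp : ∀ x, C.opp (ι x) = ι x.opp)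
    (hc : C.CrossesBy vtx ι (·.1)) (hvo : ∀ h, vtx (C.opp h) = vtx h)
    {m : Fin k → Bool} (hm : ∀ x, C.Mixed vtx (ι x) ↔ m x.1 = true)
    (hτ : C.IsState vtx ∅ τ) :
    ∃ τ₀, C.IsState vtx (Set.range ι) τ₀ ∧ ∃ u ∈ choices m, replace ι (through u) τ₀ = τ := by
  have h1 : ∀ x, ∃ z : TangleHalf k, ι z = τ (ι x) := fun x => hc.sat _ x (hτ.vtx_eq _)
  choose t ht using h1
  have htv : ∀ x, (t x).1 = x.1 := fun x => by
    rw [← hc.vtx_iff, ht, hτ.vtx_eq]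
  have htt : ∀ x, t (t x) = x := fun x => hinj (by rw [ht, ht, hτ.invol])
  let g : Fin k → Bool × Bool → Bool × Bool := fun v z => (t (v, z)).2
  have hg : ∀ v z, t (v, z) = (v, g v z) := fun v z => Prod.ext (htv _) rfl
  have hoff : ∀ h ∉ Set.range ι, τ h ∉ Set.range ι := by
    rintro h hh ⟨x, hx⟩
    refine hh ?_
    rw [← hτ.invol h, ← hx, ← ht]
    exact ⟨_, rfl⟩
  have hoff' : ∀ h ∉ Set.range ι, C.opp h ∉ Set.range ι := by
    rintro h hh ⟨x, hx⟩
    refine hh ⟨x.opp, ?_⟩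
    rw [← hopp, hx, C.opp_opp]
  have hgg : ∀ v z, g v z = (z.1 ^^ (g v (false, false)).1, z.2 ^^ (g v (false, false)).2) := by
    intro v
    refine exists_choice (g v) (fun z => ?_) ?_
    · have := htt (v, z)
      rw [hg, hg] at this
      exact congrArg Prod.snd this
    · by_cases hv : m v = true
      · left
        intro z
        have h := hτ.straight (ι (v, z)) (Or.inr ((hm _).2 hv))
        rw [hopp, ← ht] at h
        exact congrArg Prod.snd (hinj h)
      · right
        intro z
        have h := hτ.turn (ι (v, z)) (by simp) ((hm _).not.2 hv)
        rw [hopp, ← ht, hg] at h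
        exact ⟨fun h' => h.1 (by rw [h']), fun h' => h.2 (by rw [h']; rfl)⟩
  refine ⟨replace ι TangleHalf.opp τ, ⟨fun h => ?_, fun h => ?_, fun h hs => ?_, fun h hX hs => ?_⟩,
    fun v => g v (false, false), ?_, ?_⟩
  · by_cases hr : h ∈ Set.range ι
    · obtain ⟨x, rfl⟩ := hr
      rw [replace_apply hinj, ← hopp, hvo]
    · rw [replace_of_not_mem hr, hτ.vtx_eq]
  · by_cases hr : h ∈ Set.range ι
    · obtain ⟨x, rfl⟩ := hr
      rw [replace_apply hinj, replace_apply hinj, TangleHalf.opp_opp]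
    · rw [replace_of_not_mem hr, replace_of_not_mem (hoff h hr), hτ.invol]
  · by_cases hr : h ∈ Set.range ι
    · obtain ⟨x, rfl⟩ := hr
      rw [replace_apply hinj, hopp]
    · rw [replace_of_not_mem hr, hτ.straight h (Or.inr (hs.resolve_left hr))]
  · rw [replace_of_not_mem hX]
    exact hτ.turn h (by simp) hs
  · simp only [choices, Finset.mem_filter, Finset.mem_univ, true_and]
    intro v
    split_ifs with hv
    · have h := hτ.straight (ι (v, false, false)) (Or.inr ((hm _).2 hv))
      rw [hopp, ← ht] at h
      exact congrArg Prod.snd (hinj h)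
    · have h := hτ.turn (ι (v, false, false)) (by simp) ((hm _).not.2 hv)
      rw [hopp, ← ht, hg] at h
      generalize g v (false, false) = z at h
      obtain ⟨_ | _, _ | _⟩ := z
      · exact absurd rfl h.1
      · exact absurd rfl h.2
      · rfl
      · rfl
  · funext h
    by_cases hr : h ∈ Set.range ι
    · obtain ⟨⟨v, z⟩, rfl⟩ := hr
      rw [replace_apply hinj, ← ht, hg, hgg]
      rfl
    · rw [replace_of_not_mem hr, replace_of_not_mem hr]

open scoped Classical in
/-- A sum over all smoothings can be arranged according to their behaviour on a tangle. -/
theorem sum_states (hinj : Function.Injective ι) (hopp : ∀ x, C.opp (ι x) = ι x.opp)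
    (hc : C.CrossesBy vtx ι (·.1)) (hvo : ∀ h, vtx (C.opp h) = vtx h)
    {m : Fin k → Bool} (hm : ∀ x, C.Mixed vtx (ι x) ↔ m x.1 = true) (F : (C.H → C.H) → ZMod 2) :
    ∑ τ with C.IsState vtx ∅ τ, F τ =
      ∑ τ with C.IsState vtx (Set.range ι) τ, ∑ u ∈ choices m, F (replace ι (through u) τ) := by
  rw [← Finset.sum_product']
  symm
  refine Finset.sum_bij (fun p _ => replace ι (through p.2) p.1) (fun p hp => ?_)
    (fun p hp p' hp' h => ?_) (fun τ hτ => ?_) fun _ _ => rfl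
  · simp only [Finset.mem_product, Finset.mem_filter, Finset.mem_univ, true_and] at hp ⊢
    exact isState_replace hinj hopp hc hm hp.1 hp.2
  · simp only [Finset.mem_product, Finset.mem_filter, Finset.mem_univ, true_and] at hp hp'
    refine Prod.ext (replace_inj_off (fun x => ?_) h) (funext fun v => ?_)
    · rw [hp.1.straight _ (Or.inl ⟨x, rfl⟩), hp'.1.straight _ (Or.inl ⟨x, rfl⟩)]
    · have := congrFun h (ι (v, false, false))
      rw [replace_apply hinj, replace_apply hinj] at this
      simpa [through] using congrArg Prod.snd (hinj this)
  · simp only [Finset.mem_filter, Finset.mem_univ, true_and] at hτ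
    obtain ⟨τ₀, hτ₀, u, hu, h⟩ := exists_isState_replace hinj hopp hc hvo hm hτ
    exact ⟨(τ₀, u), by simp [hτ₀, hu], h⟩

/-! ### Comparing the copies in two smoothings -/

theorem IsState.follows (hτ : C.IsState vtx X τ) (hc : C.CrossesBy vtx ι c)
    (ht : ∀ x, τ (ι x) = ι (t x)) : C.Follows vtx X τ ι t c :=
  ⟨hc, ht, hτ.invol, hτ.first_iff⟩

theorem AgreeOff.symm (h : C.AgreeOff vtx₁ vtx₂ X₁ X₂ τ₁ τ₂ ι) :
    C.AgreeOff vtx₂ vtx₁ X₂ X₁ τ₂ τ₁ ι :=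
  ⟨fun x hx => (h.vtx_eq x hx).symm, fun x hx => (h.mem_iff x hx).symm,
    fun x hx => (h.through_eq x hx).symm⟩

/-- The agreement does not change when one tangle is replaced with another one. -/
def SameAgreement (C : Curves) (vtx₁ vtx₂ : C.H → V) (X₁ X₂ : Set C.H) (τ₁ τ₂ : C.H → C.H)
    (ι : TangleHalf k → C.H) : Prop :=
  ∀ O₁ O₂, C.Directs τ₁ O₁ → C.Directs τ₂ O₂ →
    (∀ x : TangleHalf k, x.2.2 = true → O₂ (ι x) = O₁ (ι x)) →
      C.localAgreement vtx₁ X₁ ι O₁ = C.localAgreement vtx₂ X₂ ι O₂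

theorem SameAgreement.symm (h : C.SameAgreement vtx₁ vtx₂ X₁ X₂ τ₁ τ₂ ι) :
    C.SameAgreement vtx₂ vtx₁ X₂ X₁ τ₂ τ₁ ι :=
  fun O₁ O₂ h₁ h₂ hO => (h O₂ O₁ h₂ h₁ fun x hx => (hO x hx).symm).symm

theorem localAgreement_eq_zero (h : ∀ x, C.Mixed vtx (ι x) → ι x ∈ X) (O : C.H → ZMod 2) :
    C.localAgreement vtx X ι O = 0 :=
  Finset.sum_eq_zero fun x _ => if_neg fun hx => hx.2.2 (h x hx.2.1)

end Curves

namespace TangleHalf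

variable {k : ℕ} (ε : Fin k × Bool → Fin k × Bool)

/-- Two patterns that connect the ends of a tangle in the same way, without closed paths. -/
def Similar (t₁ t₂ : TangleHalf k → TangleHalf k) : Prop :=
  Replaces ε t₁ t₂ (fun _ => false) id (·.1) (·.1) ∧
    Replaces ε t₂ t₁ (fun _ => false) id (·.1) (·.1)

instance (t₁ t₂ : TangleHalf k → TangleHalf k) : Decidable (Similar ε t₁ t₂) := by
  unfold Similar
  infer_instance

theorem Replaces.of_empty {ε : Fin k × Bool → Fin k × Bool} {t₁ t₂ : TangleHalf k → TangleHalf k}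
    {c₁ c₂ : TangleHalf k → Fin k} (h : Replaces ε t₁ t₂ (fun _ => false) id c₁ c₂)
    (d₁ d₂ : TangleHalf k → Fin k) : Replaces ε t₁ t₂ (fun _ => false) id d₁ d₂ := by
  obtain ⟨h1, h2, h3, h4, h5, h6, -, -⟩ := h
  exact ⟨h1, h2, h3, h4, h5, h6, by simp, by simp⟩

end TangleHalf

namespace Curves

open TangleHalf

variable {V VL V' : Type} {k : ℕ} {C : Curves} {ε : Fin k × Bool → Fin k × Bool}
  {ι : TangleHalf k → C.H} {vtx vtx₁ vtx₂ : C.H → V} {X X₁ X₂ : Set C.H} {τ τ₁ τ₂ : C.H → C.H}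
  {t t₁ t₂ q : TangleHalf k → TangleHalf k} {c c₁ c₂ : TangleHalf k → Fin k}
  {L : Curves} {vL : L.H → VL}

theorem isCopy_iff_of_similar (hι : C.Placed ε ι) (h₁ : C.Follows vtx₁ X₁ τ₁ ι t₁ c₁)
    (h₂ : C.Follows vtx₂ X₂ τ₂ ι t₂ c₂) (ha : C.AgreeOff vtx₁ vtx₂ X₁ X₂ τ₁ τ₂ ι)
    (hs : Similar ε t₁ t₂) (hag : C.SameAgreement vtx₁ vtx₂ X₁ X₂ τ₁ τ₂ ι) {Y : Set C.H}
    (hY : ∀ x, ι x ∉ Y) : IsCopy L vL C vtx₁ X₁ τ₁ Y ↔ IsCopy L vL C vtx₂ X₂ τ₂ Y := by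
  constructor
  · intro h
    have := h.transfer hι h₁ h₂ ha (hs.1.of_empty c₁ c₂) (by simpa using hY) (by simp) (by simp) hag
    rwa [lift_id hι.inj, Set.preimage_id] at this
  · intro h
    have := h.transfer hι h₂ h₁ ha.symm (hs.2.of_empty c₂ c₁) (by simpa using hY) (by simp)
      (by simp)
      hag.symm
    rwa [lift_id hι.inj, Set.preimage_id] at this

theorem copies_eq_of_similar (hι : C.Placed ε ι) (h₁ : C.Follows vtx₁ X₁ τ₁ ι t₁ c₁)
    (h₂ : C.Follows vtx₂ X₂ τ₂ ι t₂ c₂) (ha : C.AgreeOff vtx₁ vtx₂ X₁ X₂ τ₁ τ₂ ι)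
    (hs : Similar ε t₁ t₂) (hm₁ : ∀ x, C.Mixed vtx₁ (ι x) → ι x ∈ X₁)
    (hm₂ : ∀ x, C.Mixed vtx₂ (ι x) → ι x ∈ X₂) :
    copies L vL C vtx₁ X₁ τ₁ = copies L vL C vtx₂ X₂ τ₂ := by
  classical
  have hag : C.SameAgreement vtx₁ vtx₂ X₁ X₂ τ₁ τ₂ ι := fun O₁ O₂ _ _ _ => by
    rw [localAgreement_eq_zero hm₁, localAgreement_eq_zero hm₂]
  refine Finset.sum_congr rfl fun Y _ => ?_
  by_cases hY : ∀ x, ι x ∉ Y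
  · simp only [isCopy_iff_of_similar hι h₁ h₂ ha hs hag hY]
  · push Not at hY
    obtain ⟨x, hx⟩ := hY
    rw [if_neg, if_neg]
    · exact fun h => (h.mixed _ hx).2 (hm₂ x (h.mixed _ hx).1)
    · exact fun h => (h.mixed _ hx).2 (hm₁ x (h.mixed _ hx).1)

/-- A set of half-edges inside of a tangle that is closed under its links is closed under being
joined. -/
theorem Joined.exists_inner {Y : Set C.H} (hι : C.Placed ε ι) (hτ : ∀ x, τ (ι x) = ι (t x))
    (hτi : ∀ h, τ (τ h) = h) (hY : ∀ h ∉ Y, τ h ∉ Y) (S : TangleHalf k → Bool)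
    (hS : ∀ x, S x = true → x.2.2 = false ∧ S (x.edge ε) = true ∧ (ι x ∉ Y → S (t x) = true))
    {x : TangleHalf k} {h : C.H} (hx : S x = true) (hj : C.Joined τ Y (ι x) h) :
    ∃ z, S z = true ∧ ι z = h := by
  let P : C.H → Prop := fun h => ∃ z, S z = true ∧ ι z = h
  have he : ∀ h, P h → P (C.edge h) := by
    rintro _ ⟨z, hz, rfl⟩
    exact ⟨_, (hS z hz).2.1, (hι.edge_eq z (hS z hz).1).symm⟩
  have ht : ∀ h ∉ Y, P h → P (τ h) := by
    rintro _ hY ⟨z, hz, rfl⟩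
    exact ⟨_, (hS z hz).2.2 hY, (hτ z).symm⟩
  have key : ∀ {h h'}, C.Joined τ Y h h' → (P h ↔ P h') := by
    intro h h' hj
    induction hj with
    | rel h h' hj =>
      rcases hj with rfl | ⟨hh, rfl⟩
      · exact ⟨he h, fun hp => by simpa [C.edge_edge] using he _ hp⟩
      · exact ⟨ht h hh, fun hp => by simpa [hτi] using ht _ (hY h hh) hp⟩
    | refl => rfl
    | symm _ _ _ ih => exact ih.symm
    | trans _ _ _ _ _ ih1 ih2 => exact ih1.trans ih2
  exact (key hj).1 ⟨x, hx, rfl⟩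

/-- A smoothing that splits off a circle contains no copies. -/
theorem copies_eq_zero_of_circle (hι : C.Placed ε ι) (hf : C.Follows vtx X τ ι t c)
    (ht : ∀ x : TangleHalf k, x.2.2 = false → (t x).2.2 = false) (v : Fin k) :
    copies L vL C vtx X τ = 0 := by
  classical
  refine Finset.sum_eq_zero fun Y _ => if_neg fun h => ?_
  have hj := h.conn (ι (v, false, false)) (ι (v, false, true)) (by
    rw [← C.opp_first, hι.opp_eq]; rfl)
  obtain ⟨x, hx, hx'⟩ := hj.exists_inner hι hf.through hf.invol (by simp) (fun x => !x.2.2)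
    (fun x hx => ⟨by simpa using hx, by simpa [TangleHalf.edge] using hx,
      fun _ => by simpa using ht x (by simpa using hx)⟩) rfl
  rw [hι.inj hx'] at hx
  simp at hx

/-- No decreasing second Reidemeister move applies. -/
def Reduced (L : Curves) (vL : L.H → VL) : Prop :=
  ∀ a b, a ≠ b → vL a = vL b → vL (L.edge a) = vL (L.edge b) → vL a ≠ vL (L.edge a) →
    L.opp a ≠ b → L.opp (L.edge a) = L.edge b

/-- A bigon between two crossings of a copy would be a bigon of the reduced diagram `L`. -/
theorem IsCopy.no_bigon (hL : Reduced L vL) {Y : Set C.H} (h : IsCopy L vL C vtx X τ Y)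
    {x₁ x₂ z₁ z₂ : C.H} (hx₁ : x₁ ∈ Y) (hx₂ : x₂ ∈ Y) (hx : vtx x₁ = vtx x₂) (hz : vtx z₁ = vtx z₂)
    (hxz : vtx x₁ ≠ vtx z₁) (hne : x₁ ≠ x₂) (hox : C.opp x₁ ≠ x₂) (hoz : C.opp z₁ ≠ z₂)
    (h₁ : ∀ h ∈ Y, C.Joined τ Y x₁ h → h = x₁ ∨ h = z₁)
    (h₂ : ∀ h ∈ Y, C.Joined τ Y x₂ h → h = x₂ ∨ h = z₂) : False := by
  obtain ⟨O, -, -, φ, hφ⟩ := h.exists_embedding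
  have hY : ∀ a, φ a ∈ Y := fun a => hφ.range_eq ▸ ⟨a, rfl⟩
  obtain ⟨a, rfl⟩ := hφ.range_eq.symm.subset hx₁
  obtain ⟨b, rfl⟩ := hφ.range_eq.symm.subset hx₂
  have ha : φ (L.edge a) = z₁ :=
    (h₁ _ (hY _) (hφ.joined a)).resolve_left fun h => L.edge_ne a (hφ.inj h)
  have hb : φ (L.edge b) = z₂ :=
    (h₂ _ (hY _) (hφ.joined b)).resolve_left fun h => L.edge_ne b (hφ.inj h)
  refine hoz ?_
  rw [← ha, ← hb, ← hφ.opp_eq, hL a b (fun h => hne (by rw [h])) ((hφ.vtx_iff _ _).1 hx)]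
  · rwa [← hφ.vtx_iff, ha, hb]
  · rwa [ne_eq, ← hφ.vtx_iff, ha]
  · exact fun h => hox (by rw [← h, hφ.opp_eq])

open scoped Classical in
/-- The copies without crossings in a tangle. -/
noncomputable def copiesOff (L : Curves) (vL : L.H → VL) (C : Curves) (vtx : C.H → V) (X : Set C.H)
    (τ : C.H → C.H) (ι : TangleHalf k → C.H) : ZMod 2 :=
  ∑ Y : Set C.H, if IsCopy L vL C vtx X τ Y ∧ ∀ x, ι x ∉ Y then 1 else 0

/-- If the copies that meet a tangle come in pairs, then they do not matter modulo `2`. -/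
theorem copies_eq_copiesOff (hinj : Function.Injective ι) (hq : ∀ x, q (q x) = x)
    (h : ∀ Y, IsCopy L vL C vtx X τ Y → (∃ x, ι x ∈ Y) →
      IsCopy L vL C vtx X τ (lift ι q ⁻¹' Y) ∧ lift ι q ⁻¹' Y ≠ Y) :
    copies L vL C vtx X τ = copiesOff L vL C vtx X τ ι := by
  classical
  let F : Set C.H → ZMod 2 := fun Y => if IsCopy L vL C vtx X τ Y ∧ ∃ x, ι x ∈ Y then 1 else 0
  have hgg : ∀ Y : Set C.H, lift ι q ⁻¹' (lift ι q ⁻¹' Y) = Y := fun Y => by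
    rw [← Set.preimage_comp]
    have : lift ι q ∘ lift ι q = id := funext (lift_lift hinj hq)
    rw [this, Set.preimage_id]
  have hF : ∀ Y, F Y ≠ 0 → F (lift ι q ⁻¹' Y) = 1 := by
    intro Y hY
    simp only [F, ne_eq, ite_eq_right_iff, one_ne_zero, imp_false, not_not] at hY
    obtain ⟨hY, x, hx⟩ := hY
    refine if_pos ⟨(h Y hY ⟨x, hx⟩).1, q x, ?_⟩
    rwa [Set.mem_preimage, lift_apply hinj, hq]
  have h0 : ∑ Y, F Y = 0 := by
    refine Finset.sum_involution (fun Y _ => lift ι q ⁻¹' Y) (fun Y _ => ?_) (fun Y _ hY => ?_)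
      (fun _ _ => Finset.mem_univ _) fun Y _ => hgg Y
    · by_cases hY : F Y = 0
      · by_cases hY' : F (lift ι q ⁻¹' Y) = 0
        · rw [hY, hY', add_zero]
        · have := hF _ hY'
          rw [hgg, hY] at this
          exact absurd this zero_ne_one
      · rw [hF Y hY]
        have : F Y = 1 := by
          simp only [F] at hY ⊢
          split_ifs at hY ⊢
          · rfl
          · exact absurd rfl hY
        rw [this]
        rfl
    · simp only [F, ne_eq, ite_eq_right_iff, one_ne_zero, imp_false, not_not] at hY
      exact (h Y hY.1 hY.2).2
  have : copies L vL C vtx X τ = copiesOff L vL C vtx X τ ι + ∑ Y, F Y := by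
    unfold copies copiesOff
    rw [← Finset.sum_add_distrib]
    refine Finset.sum_congr rfl fun Y _ => ?_
    by_cases hY : IsCopy L vL C vtx X τ Y <;> by_cases hx : ∃ x, ι x ∈ Y <;>
      simp only [F, hY, hx, ← not_exists, and_true, and_false, not_true,
        not_false_iff, if_true, if_false, add_zero, zero_add]
  rw [this, h0, add_zero]

theorem IsCopy.pattern {Y : Set C.H} (h : IsCopy L vL C vtx X τ Y) (hc : C.CrossesBy vtx ι c)
    (hY : ∀ x z, ι x ∈ Y → ι z ∈ Y → c x = c z) {x₀ : TangleHalf k} (hx₀ : ι x₀ ∈ Y)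
    (x : TangleHalf k) : ι x ∈ Y ↔ decide (c x = c x₀) = true := by
  rw [decide_eq_true_iff]
  exact ⟨fun hx => hY x x₀ hx hx₀, fun hx => h.sat _ _ ((hc.vtx_iff _ _).2 hx.symm) hx₀⟩

/-- If at most one crossing of a tangle can belong to a copy, and `q` exchanges such crossings, then
the copies that meet the tangle come in pairs. -/
theorem copies_eq_copiesOff_of_replaces (hι : C.Placed ε ι) (hf : C.Follows vtx ∅ τ ι t c)
    {m : TangleHalf k → Bool} (hm : ∀ x, C.Mixed vtx (ι x) ↔ m x = true)
    (hr : ∀ x, m x = true → Replaces ε t t (fun z => decide (c z = c x)) q c c ∧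
      c (q x) ≠ c x ∧ m (q x) = true)
    (hqf : ∀ x, m x = true → (ι (q x) ∈ C.first ↔ ι x ∈ C.first))
    (hag : C.SameAgreement vtx vtx ∅ ∅ τ τ ι)
    (hY : ∀ Y, IsCopy L vL C vtx ∅ τ Y → ∀ x z, ι x ∈ Y → ι z ∈ Y → c x = c z)
    (hq : ∀ x, q (q x) = x) :
    copies L vL C vtx ∅ τ = copiesOff L vL C vtx ∅ τ ι := by
  refine copies_eq_copiesOff hι.inj hq fun Y h ⟨x₀, hx₀⟩ => ?_
  have hx₀m := (hm x₀).1 (h.mixed _ hx₀).1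
  have hpat := h.pattern hf.crosses (hY Y h) hx₀
  obtain ⟨hr1, hr2, -⟩ := hr x₀ hx₀m
  refine ⟨h.transfer hι hf hf ⟨fun _ _ => rfl, fun _ _ => Iff.rfl, fun _ _ => rfl⟩ hr1 hpat
    (fun x hx => hqf x ?_) (fun x hx => ⟨?_, by simp⟩) hag, fun hne => ?_⟩
  · exact (hm x).1 (h.mixed _ ((hpat x).2 hx)).1
  · have := (hr _ ((hm _).1 (h.mixed _ ((hpat (q x)).2 hx)).1)).2.2
    rwa [hq, ← hm] at this
  · have : ι x₀ ∈ lift ι q ⁻¹' Y := hne.symm ▸ hx₀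
    rw [Set.mem_preimage, lift_apply hι.inj, hpat] at this
    exact hr2 (by simpa using this)

end Curves

/-! ### The first and the second Reidemeister move -/

namespace TangleHalf

variable {k : ℕ}

/-- The edge of a loop. -/
def loopEdge (x : Fin 1 × Bool) : Fin 1 × Bool := (x.1, !x.2)

/-- The edges of a bigon. -/
def bigonEdge (x : Fin 2 × Bool) : Fin 2 × Bool := (x.1 + 1, x.2)

/-- The edges of a triangle: the two strands of the crossing `0` run to the strand `false` of the
crossings `1` and `2`, and the strands `true` of these are joined. -/
def triangleEdge (x : Fin 3 × Bool) : Fin 3 × Bool :=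
  if x.1 = 0 then (if x.2 then 2 else 1, false)
  else if x.2 then (if x.1 = 1 then 2 else 1, true) else (0, decide (x.1 = 2))

/-- The half-edge in the same position at the other crossing of the strand. -/
def slide (ε : Fin k × Bool → Fin k × Bool) (x : TangleHalf k) : TangleHalf k :=
  ((ε (x.1, x.2.1)).1, (ε (x.1, x.2.1)).2, !x.2.2)

/-- `through u` after all crossings have been slid along the edges. -/
def slidThrough (ε : Fin k × Bool → Fin k × Bool) (u : Fin k → Bool × Bool) (x : TangleHalf k) :
    TangleHalf k :=
  slide ε (through u (slide ε x))

/-- All crossings are smoothed, as told by `b`. -/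
def smooth (b : Fin k → Bool) (v : Fin k) : Bool × Bool := (true, b v)

theorem choices_loop : choices (fun _ : Fin 1 => false) = {smooth ![false], smooth ![true]} := by
  decide +kernel

theorem choices_bigon : choices (fun _ : Fin 2 => false) =
    {smooth ![false, false], smooth ![false, true], smooth ![true, false], smooth ![true, true]} :=
      by
  decide +kernel

theorem choices_bigon_mixed :
    choices (fun _ : Fin 2 => true) = {fun _ => (false, true)} := by
  decide +kernel

theorem through_straight (x : TangleHalf k) : through (fun _ => (false, true)) x = opp x := by
  simp [through, opp]

end TangleHalf

namespace Curves

open TangleHalf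

variable {V VL V' : Type} {k : ℕ} {C : Curves} {ε : Fin k × Bool → Fin k × Bool}
  {vtx : C.H → V} {X : Set C.H} {τ : C.H → C.H} {L : Curves} {vL : L.H → VL}

/-- Replacing a smoothed pure tangle with the erased one. -/
theorem copies_replace_eq {ι : TangleHalf k → C.H} (hι : C.Placed ε ι)
    (hc : C.CrossesBy vtx ι (·.1))
    (hm : ∀ x, ¬C.Mixed vtx (ι x)) (hτ : C.IsState vtx (Set.range ι) τ) {u : Fin k → Bool × Bool}
    (hu : u ∈ choices fun _ : Fin k => false) (hs : Similar ε (through u) TangleHalf.opp) :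
    copies L vL C vtx ∅ (replace ι (through u) τ) = copies L vL C vtx (Set.range ι) τ := by
  have h₁ := isState_replace hι.inj hι.opp_eq hc (m := fun _ => false) (by simpa using hm) hτ hu
  refine copies_eq_of_similar hι (h₁.follows hc (replace_apply hι.inj))
    (hτ.follows hc fun x => ?_) ⟨fun _ _ => rfl, fun h hh => by simpa using hh, fun h hh => ?_⟩
    hs (fun x h => absurd h (hm x)) (fun x h => absurd h (hm x))
  · rw [hτ.straight _ (Or.inl ⟨x, rfl⟩), hι.opp_eq]
  · rw [replace_of_not_mem hh]

/-- A loop: one smoothing splits off a circle, the other one removes the loop. -/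
theorem bracket_loop {ι : TangleHalf 1 → C.H} (hι : C.Placed loopEdge ι)
    (hc : C.CrossesBy vtx ι (·.1)) (hvo : ∀ h, vtx (C.opp h) = vtx h)
    (hm : ∀ x, ¬C.Mixed vtx (ι x)) :
    bracket L vL C vtx ∅ = bracket L vL C vtx (Set.range ι) := by
  classical
  unfold bracket
  rw [sum_states hι.inj hι.opp_eq hc hvo (m := fun _ => false) (by simpa using hm)]
  refine Finset.sum_congr rfl fun τ hτ => ?_
  simp only [Finset.mem_filter, Finset.mem_univ, true_and] at hτ
  have hst : ∀ u ∈ choices fun _ : Fin 1 => false, C.IsState vtx ∅ (replace ι (through u) τ) :=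
    fun u hu => isState_replace hι.inj hι.opp_eq hc (by simpa using hm) hτ hu
  rw [choices_loop, Finset.sum_insert (by decide +kernel), Finset.sum_singleton,
    copies_eq_zero_of_circle hι ((hst _ (by decide +kernel)).follows hc (replace_apply hι.inj))
      (by decide +kernel) 0, zero_add]
  exact copies_replace_eq hι hc hm hτ (by decide +kernel) (by decide +kernel)

/-- A pure bigon: one smoothing splits off a circle, two cancel, and the last removes the bigon. -/
theorem bracket_bigon_pure {ι : TangleHalf 2 → C.H} (hι : C.Placed bigonEdge ι)
    (hc : C.CrossesBy vtx ι (·.1)) (hvo : ∀ h, vtx (C.opp h) = vtx h)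
    (hm : ∀ x, ¬C.Mixed vtx (ι x)) :
    bracket L vL C vtx ∅ = bracket L vL C vtx (Set.range ι) := by
  classical
  unfold bracket
  rw [sum_states hι.inj hι.opp_eq hc hvo (m := fun _ => false) (by simpa using hm)]
  refine Finset.sum_congr rfl fun τ hτ => ?_
  simp only [Finset.mem_filter, Finset.mem_univ, true_and] at hτ
  have hst : ∀ u ∈ choices fun _ : Fin 2 => false, C.IsState vtx ∅ (replace ι (through u) τ) :=
    fun u hu => isState_replace hι.inj hι.opp_eq hc (by simpa using hm) hτ hu
  -- The two states that turn the bigon into a single arc cancel.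
  have heq : copies L vL C vtx ∅ (replace ι (through (smooth ![false, true])) τ) =
      copies L vL C vtx ∅ (replace ι (through (smooth ![true, false])) τ) :=
    copies_eq_of_similar hι
      ((hst _ (by decide +kernel)).follows hc (replace_apply hι.inj))
      ((hst _ (by decide +kernel)).follows hc (replace_apply hι.inj))
      ⟨fun _ _ => rfl, fun _ _ => Iff.rfl, fun h hh => by
        rw [replace_of_not_mem hh, replace_of_not_mem hh]⟩ (by decide +kernel)
      (fun x h => absurd h (hm x)) (fun x h => absurd h (hm x))
  rw [choices_bigon, Finset.sum_insert (by decide +kernel), Finset.sum_insert (by decide +kernel),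
    Finset.sum_insert (by decide +kernel), Finset.sum_singleton,
    copies_eq_zero_of_circle hι ((hst _ (by decide +kernel)).follows hc (replace_apply hι.inj))
      (by decide +kernel) 0, zero_add, heq, ← add_assoc, CharTwo.add_self_eq_zero, zero_add]
  exact copies_replace_eq hι hc hm hτ (by decide +kernel) (by decide +kernel)

theorem copiesOff_eq_copies {ι : TangleHalf k → C.H} (h : ∀ x, C.Mixed vtx (ι x) → ι x ∈ X) :
    copiesOff L vL C vtx X τ ι = copies L vL C vtx X τ := by
  classical
  refine Finset.sum_congr rfl fun Y _ => ?_
  have : IsCopy L vL C vtx X τ Y ∧ (∀ x, ι x ∉ Y) ↔ IsCopy L vL C vtx X τ Y :=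
    ⟨fun h => h.1, fun hY => ⟨hY, fun x hx => (hY.mixed _ hx).2 (h x (hY.mixed _ hx).1)⟩⟩
  simp only [this]

/-- The two crossings of a mixed bigon lie on the same edge of the first curve, so that the
direction agrees with the given one at both of them or at none. -/
theorem localAgreement_bigon {ι : TangleHalf 2 → C.H} (hι : C.Placed bigonEdge ι)
    (hm : ∀ x, C.Mixed vtx (ι x))
    (hτ : ∀ x, τ (ι x) = ι x.opp) {O : C.H → ZMod 2} (hO : C.Directs τ O) :
    C.localAgreement vtx ∅ ι O = 0 := by
  classical
  have hinv : ∀ x : TangleHalf 2, slide bigonEdge (slide bigonEdge x) = x := by decide +kernel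
  have hne : ∀ x : TangleHalf 2, slide bigonEdge x ≠ x := by decide +kernel
  -- `slide` goes along an edge and through a crossing, in one of the two orders.
  have hs : ∀ x : TangleHalf 2, (ι (slide bigonEdge x) ∈ C.first ↔ ι x ∈ C.first) ∧
      (ι x ∈ C.first → O (ι (slide bigonEdge x)) = O (ι x) ∧
        C.dir (ι (slide bigonEdge x)) = C.dir (ι x)) := by
    have key : ∀ x : TangleHalf 2, x.2.2 = false →
        (ι (slide bigonEdge x) ∈ C.first ↔ ι x ∈ C.first) ∧
        (ι x ∈ C.first → O (ι (slide bigonEdge x)) = O (ι x) ∧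
          C.dir (ι (slide bigonEdge x)) = C.dir (ι x)) := by
      intro x hx
      have h1 : ι (slide bigonEdge x) = C.opp (C.edge (ι x)) := by
        rw [hι.edge_eq x hx, hι.opp_eq]
        rfl
      have h2 : ι (slide bigonEdge x) = τ (C.edge (ι x)) := by
        rw [hι.edge_eq x hx, hτ]
        rfl
      refine ⟨by rw [h1, C.opp_first, C.edge_first], fun hf => ?_⟩
      have hf' := (C.edge_first _).2 hf
      constructor
      · rw [h2, (hO _ hf').2, (hO _ hf).1, add_assoc, CharTwo.add_self_eq_zero, add_zero]
      · rw [h1, C.dir_opp _ hf', C.dir_edge _ hf, add_assoc, CharTwo.add_self_eq_zero, add_zero]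
    intro x
    by_cases hx : x.2.2 = false
    · exact key x hx
    · have := key (slide bigonEdge x) (by simpa [slide] using hx)
      rw [hinv] at this
      exact ⟨this.1.symm, fun hf => ⟨(this.2 (this.1.1 hf)).1.symm, (this.2 (this.1.1 hf)).2.symm⟩⟩
  refine Finset.sum_involution (fun x _ => slide bigonEdge x) (fun x _ => ?_) (fun x _ _ => hne x)
    (fun _ _ => Finset.mem_univ _) fun x _ => hinv x
  by_cases hf : ι x ∈ C.first
  · simp only [hf, (hs x).1, hm, (hs x).2 hf, Set.mem_empty_iff_false, not_false_iff, and_self,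
      if_true, CharTwo.add_self_eq_zero]
  · simp only [hf, (hs x).1, false_and, if_false, add_zero]

/-- A mixed bigon: copies that contain one of its crossings cancel, and none contains both. -/
theorem bracket_bigon_mixed (hL : Reduced L vL) {ι : TangleHalf 2 → C.H} (hι : C.Placed bigonEdge ι)
    (hc : C.CrossesBy vtx ι (·.1)) (hvo : ∀ h, vtx (C.opp h) = vtx h)
    (hm : ∀ x, C.Mixed vtx (ι x)) :
    bracket L vL C vtx ∅ = bracket L vL C vtx (Set.range ι) := by
  classical
  unfold bracket
  rw [sum_states hι.inj hι.opp_eq hc hvo (m := fun _ => true) (by simpa using hm)]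
  refine Finset.sum_congr rfl fun τ hτ => ?_
  simp only [Finset.mem_filter, Finset.mem_univ, true_and] at hτ
  have hst : ∀ u ∈ choices fun _ : Fin 2 => true, C.IsState vtx ∅ (replace ι (through u) τ) :=
    fun u hu => isState_replace hι.inj hι.opp_eq hc (by simpa using hm) hτ hu
  have hτι : ∀ x, τ (ι x) = ι x.opp := fun x => by
    rw [hτ.straight _ (Or.inl ⟨x, rfl⟩), hι.opp_eq]
  have hrep : replace ι (through fun _ => (false, true)) τ = τ := by
    funext h
    by_cases hr : h ∈ Set.range ι
    · obtain ⟨x, rfl⟩ := hr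
      rw [replace_apply hι.inj, through_straight, hτι]
    · rw [replace_of_not_mem hr]
  rw [choices_bigon_mixed, Finset.sum_singleton, hrep]
  have hτ0 := hst _ (by rw [choices_bigon_mixed]; exact Finset.mem_singleton_self _)
  rw [hrep] at hτ0
  have hf0 := hτ0.follows hc hτι
  have hag : ∀ O, C.Directs τ O → C.localAgreement vtx ∅ ι O = 0 := fun O hO =>
    localAgreement_bigon hι hm hτι hO
  rw [copies_eq_copiesOff_of_replaces hι hf0 (m := fun _ => true) (q := slide bigonEdge)
    (by simpa using hm) (by decide +kernel) ?_ (fun O₁ O₂ h₁ h₂ _ => by rw [hag O₁ h₁, hag O₂ h₂])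
      ?_
    (by decide +kernel), ← copiesOff_eq_copies (ι := ι) (X := Set.range ι) fun x _ => ⟨x, rfl⟩]
  · refine Finset.sum_congr rfl fun Y _ => ?_
    by_cases hY : ∀ x, ι x ∉ Y
    · simp only [isCopy_iff_of_similar hι hf0 (hτ.follows hc hτι)
        ⟨fun _ _ => rfl, fun h hh => by simpa using hh, fun _ _ => rfl⟩ (by decide +kernel)
        (fun O₁ O₂ h₁ _ _ => by
          rw [hag O₁ h₁, localAgreement_eq_zero (X := Set.range ι) fun x _ => ⟨x, rfl⟩]) hY]
    · simp only [hY, and_false]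
  · rintro ⟨v, s, b⟩ -
    have h1 : ∀ v s, (ι (v, s, false) ∈ C.first ↔ ι (v, s, true) ∈ C.first) := fun v s => by
      rw [← C.opp_first, hι.opp_eq]
      rfl
    have h2 : ∀ v s, (ι (v + 1, s, false) ∈ C.first ↔ ι (v, s, false) ∈ C.first) := fun v s => by
      rw [← C.edge_first (ι (v, s, false)), hι.edge_eq _ rfl]
      rfl
    cases b
    · exact (h1 _ _).symm.trans (h2 v s)
    · exact (h2 v s).trans (h1 _ _)
  · intro Y hY x z hx hz
    by_contra hxz
    have hmem : ∀ x, ι x ∈ Y := by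
      have hv : ∀ v : Fin 2, v = x.1 ∨ v = z.1 := by
        intro v
        revert hxz
        generalize x.1 = a
        generalize z.1 = b
        revert v a b
        decide
      intro w
      rcases hv w.1 with h | h
      · exact hY.sat _ _ ((hc.vtx_iff _ _).2 h.symm) hx
      · exact hY.sat _ _ ((hc.vtx_iff _ _).2 h.symm) hz
    have hj : ∀ s, ∀ h ∈ Y, C.Joined τ Y (ι (0, s, false)) h →
        h = ι (0, s, false) ∨ h = ι (1, s, false) := by
      intro s h _ hj
      obtain ⟨w, hw, rfl⟩ := hj.exists_inner hι hτι hτ0.invol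
        (fun h hh hh' => hh (hY.sat _ _ (hτ0.vtx_eq h) hh'))
        (fun w => !w.2.2 && (w.2.1 == s)) (fun w hw => by
          simp only [Bool.and_eq_true, Bool.not_eq_true', beq_iff_eq] at hw
          exact ⟨hw.1, by simp [TangleHalf.edge, bigonEdge, hw], fun h => absurd (hmem w) h⟩)
        (by simp)
      obtain ⟨v, s', b⟩ := w
      simp only [Bool.and_eq_true, Bool.not_eq_true', beq_iff_eq] at hw
      obtain ⟨rfl, rfl⟩ := hw
      fin_cases v
      · exact Or.inl rfl
      · exact Or.inr rfl
    refine hY.no_bigon hL (hmem (0, false, false)) (hmem (0, true, false)) ((hc.vtx_iff _ _).2 rfl)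
      (z₁ := ι (1, false, false)) (z₂ := ι (1, true, false)) ((hc.vtx_iff _ _).2 rfl) ?_ ?_ ?_ ?_
      (hj false) (hj true)
    · rw [ne_eq, hc.vtx_iff]
      decide
    · exact hι.inj.ne (by decide)
    · rw [hι.opp_eq]
      exact hι.inj.ne (by decide)
    · rw [hι.opp_eq]
      exact hι.inj.ne (by decide)

end Curves

/-! ### The third Reidemeister move -/

namespace TangleHalf

theorem choices_triangle : choices (fun _ : Fin 3 => false) =
    {smooth ![false, false, false], smooth ![true, false, false], smooth ![false, true, false],
      smooth ![false, false, true], smooth ![false, true, true], smooth ![true, false, true],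
      smooth ![true, true, false], smooth ![true, true, true]} := by
  decide +kernel

/-- The crossing `0` of a triangle is smoothed, as told by `b`, and the other two are passed
straight. -/
def smoothZero (b : Bool) : Fin 3 → Bool × Bool := ![(true, b), (false, true), (false, true)]

theorem choices_triangle_mixed :
    choices (fun v : Fin 3 => decide (v ≠ 0)) = {smoothZero false, smoothZero true} := by
  decide +kernel

/-- Exchanges the crossings `1` and `2` of a triangle. -/
def exchange (x : TangleHalf 3) : TangleHalf 3 :=
  if x.1 = 0 then x else (if x.1 = 1 then 2 else 1, x.2.1, !x.2.2)

/-- Exchanges, after the move, the two crossings that were the crossings `1` and `2` before. -/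
def slidExchange (x : TangleHalf 3) : TangleHalf 3 :=
  slide triangleEdge (exchange (slide triangleEdge x))

/-- When the crossing `0` is smoothed so that its two strands are exchanged, the crossings `1` and
`2` before the move play the role of those after the move. -/
def transplant (x : TangleHalf 3) : TangleHalf 3 :=
  if x.1 = 0 then (if x.2.1 then 1 else 2, false, !x.2.2)
  else if x.2.1 then x else (0, decide (x.1 = 1), !x.2.2)

/-- The half-edge lies on the third side of the triangle, opposite to the crossing `0`. -/
def onThird (x : TangleHalf 3) : Bool := x.2.1 && decide (x.1 ≠ 0)

theorem slide_slide (x : TangleHalf 3) : slide triangleEdge (slide triangleEdge x) = x := by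
  revert x
  decide +kernel

end TangleHalf

namespace Curves

open TangleHalf

variable {V VL : Type} {C : Curves} {vtx : C.H → V} {τ : C.H → C.H} {L : Curves} {vL : L.H → VL}
  {ι : TangleHalf 3 → C.H}

/-- The crossings after a third Reidemeister move. The curves and their passages through vertices
stay the same, but on each side of the triangle the crossings are exchanged. -/
noncomputable def slidVtx (vtx : C.H → V) (ι : TangleHalf 3 → C.H) (h : C.H) : V :=
  vtx (lift ι (slide triangleEdge) h)

theorem slidVtx_apply (hinj : Function.Injective ι) (x : TangleHalf 3) :
    slidVtx vtx ι (ι x) = vtx (ι (slide triangleEdge x)) := by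
  rw [slidVtx, lift_apply hinj]

theorem slidVtx_of_not_mem {h : C.H} (hh : h ∉ Set.range ι) : slidVtx vtx ι h = vtx h := by
  rw [slidVtx, lift_of_not_mem hh]

theorem first_slide (hι : C.Placed triangleEdge ι) (x : TangleHalf 3) :
    ι (slide triangleEdge x) ∈ C.first ↔ ι x ∈ C.first := by
  have h1 : ∀ x, ι (TangleHalf.opp x) ∈ C.first ↔ ι x ∈ C.first := fun x => by
    rw [← hι.opp_eq, C.opp_first]
  have h2 : ∀ x : TangleHalf 3, x.2.2 = false → (ι (x.edge triangleEdge) ∈ C.first ↔ ι x ∈ C.first)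
    :=
    fun x hx => by rw [← hι.edge_eq x hx, C.edge_first]
  by_cases hx : x.2.2 = false
  · exact (h1 (x.edge triangleEdge)).trans (h2 x hx)
  · have h3 := h2 x.opp (by simpa [TangleHalf.opp] using hx)
    exact h3.trans (h1 x)

theorem crosses_slidVtx (hinj : Function.Injective ι) (hc : C.CrossesBy vtx ι (·.1)) :
    C.CrossesBy (slidVtx vtx ι) ι fun x => (slide triangleEdge x).1 := by
  refine ⟨fun x z => ?_, fun h x hh => ?_⟩
  · rw [slidVtx_apply hinj, slidVtx_apply hinj, hc.vtx_iff]
  · by_contra hr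
    rw [slidVtx_apply hinj, slidVtx_of_not_mem hr] at hh
    exact hr (hc.sat _ _ hh)

theorem crosses_slidVtx_slide (hinj : Function.Injective ι) (hc : C.CrossesBy vtx ι (·.1)) :
    C.CrossesBy (slidVtx vtx ι) (ι ∘ slide triangleEdge) (·.1) := by
  refine ⟨fun x z => ?_, fun h x hh => ?_⟩
  · simp only [Function.comp, slidVtx_apply hinj, slide_slide, hc.vtx_iff]
  · obtain ⟨z, rfl⟩ := (crosses_slidVtx hinj hc).sat _ _ hh
    exact ⟨slide triangleEdge z, by simp [slide_slide]⟩

theorem slidVtx_opp (hι : C.Placed triangleEdge ι) (hvo : ∀ h, vtx (C.opp h) = vtx h) (h : C.H) :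
    slidVtx vtx ι (C.opp h) = slidVtx vtx ι h := by
  by_cases hr : h ∈ Set.range ι
  · obtain ⟨x, rfl⟩ := hr
    rw [hι.opp_eq, slidVtx_apply hι.inj, slidVtx_apply hι.inj, ← hvo (ι (slide _ x)), hι.opp_eq]
    rfl
  · rw [slidVtx_of_not_mem hr, slidVtx_of_not_mem, hvo]
    rintro ⟨x, hx⟩
    exact hr ⟨x.opp, by rw [← hι.opp_eq, hx, C.opp_opp]⟩

theorem lift_slide_first (hι : C.Placed triangleEdge ι) (h : C.H) :
    lift ι (slide triangleEdge) h ∈ C.first ↔ h ∈ C.first := by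
  by_cases hr : h ∈ Set.range ι
  · obtain ⟨x, rfl⟩ := hr
    rw [lift_apply hι.inj, first_slide hι]
  · rw [lift_of_not_mem hr]

theorem mixed_slidVtx (hι : C.Placed triangleEdge ι) (h : C.H) :
    C.Mixed (slidVtx vtx ι) h ↔ C.Mixed vtx (lift ι (slide triangleEdge) h) := by
  have hf := lift_slide_first hι
  have hll := lift_lift hι.inj slide_slide
  constructor
  · rintro ⟨k, hk, hn⟩
    exact ⟨lift ι (slide triangleEdge) k, hk, by rwa [hf, hf]⟩
  · rintro ⟨k, hk, hn⟩
    refine ⟨lift ι (slide triangleEdge) k, ?_, by rwa [hf, ← hf h]⟩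
    rwa [slidVtx, hll]

theorem mixed_slidVtx_apply (hι : C.Placed triangleEdge ι) (x : TangleHalf 3) :
    C.Mixed (slidVtx vtx ι) (ι x) ↔ C.Mixed vtx (ι (slide triangleEdge x)) := by
  rw [mixed_slidVtx hι, lift_apply hι.inj]

theorem isState_slidVtx_iff (hι : C.Placed triangleEdge ι)
    (hvo : ∀ h, vtx (C.opp h) = vtx h) :
    C.IsState (slidVtx vtx ι) (Set.range ι) τ ↔ C.IsState vtx (Set.range ι) τ := by
  have hoff : (∀ h, τ (τ h) = h) → (∀ h ∈ Set.range ι, τ h = C.opp h) →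
      ∀ h ∉ Set.range ι, τ h ∉ Set.range ι := by
    rintro h1 h2 h hh ⟨x, hx⟩
    refine hh ?_
    rw [← h1 h, ← hx, h2 _ ⟨x, rfl⟩, hι.opp_eq]
    exact ⟨_, rfl⟩
  have hmix : ∀ h ∉ Set.range ι, (C.Mixed (slidVtx vtx ι) h ↔ C.Mixed vtx h) := fun h hh => by
    rw [mixed_slidVtx hι, lift_of_not_mem hh]
  have hst : ∀ h, (h ∈ Set.range ι ∨ C.Mixed (slidVtx vtx ι) h) ↔
      (h ∈ Set.range ι ∨ C.Mixed vtx h) := fun h => by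
    by_cases hh : h ∈ Set.range ι
    · simp only [hh, true_or]
    · rw [hmix h hh]
  constructor
  · intro h
    have hX : ∀ h ∈ Set.range ι, τ h = C.opp h := fun _ hh => h.straight _ (Or.inl hh)
    refine ⟨fun x => ?_, h.invol, fun x hx => h.straight x ((hst x).2 hx), fun x hx hm =>
      h.turn x hx ((hmix x hx).not.2 hm)⟩
    by_cases hr : x ∈ Set.range ι
    · rw [hX x hr, hvo]
    · rw [← slidVtx_of_not_mem (vtx := vtx) hr, ← slidVtx_of_not_mem (vtx := vtx)
        (hoff h.invol hX x hr), h.vtx_eq]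
  · intro h
    have hX : ∀ h ∈ Set.range ι, τ h = C.opp h := fun _ hh => h.straight _ (Or.inl hh)
    refine ⟨fun x => ?_, h.invol, fun x hx => h.straight x ((hst x).1 hx), fun x hx hm =>
      h.turn x hx ((hmix x hx).not.1 hm)⟩
    by_cases hr : x ∈ Set.range ι
    · rw [hX x hr, slidVtx_opp hι hvo]
    · rw [slidVtx_of_not_mem hr, slidVtx_of_not_mem (hoff h.invol hX x hr), h.vtx_eq]

theorem slide_injective : Function.Injective (slide triangleEdge) :=
  Function.LeftInverse.injective (g := slide triangleEdge) slide_slide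

theorem replace_slide (hinj : Function.Injective ι) (u : Fin 3 → Bool × Bool) :
    replace (ι ∘ slide triangleEdge) (through u) τ = replace ι (slidThrough triangleEdge u) τ := by
  funext h
  by_cases hr : h ∈ Set.range ι
  · obtain ⟨x, rfl⟩ := hr
    rw [replace_apply hinj]
    have : ι x = (ι ∘ slide triangleEdge) (slide triangleEdge x) := by simp [slide_slide]
    rw [this, replace_apply (hinj.comp slide_injective)]
    rfl
  · rw [replace_of_not_mem hr, replace_of_not_mem]
    rintro ⟨x, rfl⟩
    exact hr ⟨_, rfl⟩

theorem range_slide : Set.range (ι ∘ slide triangleEdge) = Set.range ι :=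
  Function.Surjective.range_comp (fun x => ⟨_, slide_slide x⟩) ι

theorem isState_replace_slid (hι : C.Placed triangleEdge ι) (hc : C.CrossesBy vtx ι (·.1))
    (hvo : ∀ h, vtx (C.opp h) = vtx h) {m : Fin 3 → Bool}
    (hm : ∀ x, C.Mixed vtx (ι x) ↔ m x.1 = true)
    (hτ : C.IsState vtx (Set.range ι) τ) {u : Fin 3 → Bool × Bool} (hu : u ∈ choices m) :
    C.IsState (slidVtx vtx ι) ∅ (replace ι (slidThrough triangleEdge u) τ) := by
  rw [← replace_slide hι.inj]
  refine isState_replace (hι.inj.comp slide_injective) (fun x => hι.opp_eq _)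
    (crosses_slidVtx_slide hι.inj hc) (fun x => ?_) ?_ hu
  · rw [Function.comp, mixed_slidVtx_apply hι, slide_slide, hm]
  · rwa [range_slide, isState_slidVtx_iff hι hvo]

open scoped Classical in
theorem sum_states_slid (hι : C.Placed triangleEdge ι) (hc : C.CrossesBy vtx ι (·.1))
    (hvo : ∀ h, vtx (C.opp h) = vtx h) {m : Fin 3 → Bool}
    (hm : ∀ x, C.Mixed vtx (ι x) ↔ m x.1 = true) (F : (C.H → C.H) → ZMod 2) :
    ∑ τ with C.IsState (slidVtx vtx ι) ∅ τ, F τ =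
      ∑ τ with C.IsState vtx (Set.range ι) τ,
        ∑ u ∈ choices m, F (replace ι (slidThrough triangleEdge u) τ) := by
  rw [sum_states (hι.inj.comp slide_injective) (fun x => hι.opp_eq _)
    (crosses_slidVtx_slide hι.inj hc) (slidVtx_opp hι hvo) (m := m)]
  · simp only [range_slide, isState_slidVtx_iff hι hvo, replace_slide hι.inj]
  · intro x
    rw [Function.comp, mixed_slidVtx_apply hι, slide_slide, hm]

/-- The triangle whose three sides belong to the same curve. Of the eight smoothings of a triangle
one splits off a circle, and three others connect the ends in the same way. -/
theorem bracket_triangle_pure (hι : C.Placed triangleEdge ι) (hc : C.CrossesBy vtx ι (·.1))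
    (hvo : ∀ h, vtx (C.opp h) = vtx h) (hm : ∀ x, ¬C.Mixed vtx (ι x)) :
    bracket L vL C vtx ∅ = bracket L vL C (slidVtx vtx ι) ∅ := by
  classical
  have hm' : ∀ x, C.Mixed vtx (ι x) ↔ (fun _ : Fin 3 => false) x.1 = true := by simpa using hm
  have hms : ∀ x, ¬C.Mixed (slidVtx vtx ι) (ι x) := fun x => by
    rw [mixed_slidVtx_apply hι]
    exact hm _
  have hc' := crosses_slidVtx hι.inj hc
  unfold bracket
  rw [sum_states hι.inj hι.opp_eq hc hvo (m := fun _ => false) hm',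
    sum_states_slid hι hc hvo (m := fun _ => false) hm']
  refine Finset.sum_congr rfl fun τ hτ => ?_
  simp only [Finset.mem_filter, Finset.mem_univ, true_and] at hτ
  have hmem : ∀ b : Fin 3 → Bool, smooth b ∈ choices fun _ : Fin 3 => false := fun b => by
    simp [choices, smooth]
  have hf := fun b => (isState_replace hι.inj hι.opp_eq hc hm' hτ (hmem b)).follows hc
    (replace_apply hι.inj)
  have hf' := fun b => (isState_replace_slid hι hc hvo hm' hτ (hmem b)).follows hc'
    (replace_apply hι.inj)
  set n : (Fin 3 → Bool) → ZMod 2 := fun b =>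
    copies L vL C vtx ∅ (replace ι (through (smooth b)) τ) with hn
  set n' : (Fin 3 → Bool) → ZMod 2 := fun b =>
    copies L vL C (slidVtx vtx ι) ∅ (replace ι (slidThrough triangleEdge (smooth b)) τ) with hn'
  have hoff : ∀ {t t' : TangleHalf 3 → TangleHalf 3}, ∀ h ∉ Set.range ι,
      replace ι t τ h = replace ι t' τ h := fun h hh => by
    rw [replace_of_not_mem hh, replace_of_not_mem hh]
  have h1 : ∀ b b', Similar triangleEdge (through (smooth b)) (through (smooth b')) → n b = n b' :=
    fun b b' hs => copies_eq_of_similar hι (hf b) (hf b')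
      ⟨fun _ _ => rfl, fun _ _ => Iff.rfl, hoff⟩ hs (fun x h => absurd h (hm x))
      fun x h => absurd h (hm x)
  have h2 : ∀ b b', Similar triangleEdge (slidThrough triangleEdge (smooth b))
      (slidThrough triangleEdge (smooth b')) → n' b = n' b' :=
    fun b b' hs => copies_eq_of_similar hι (hf' b) (hf' b')
      ⟨fun _ _ => rfl, fun _ _ => Iff.rfl, hoff⟩ hs (fun x h => absurd h (hms x))
      fun x h => absurd h (hms x)
  have h3 : ∀ b b', Similar triangleEdge (through (smooth b))
      (slidThrough triangleEdge (smooth b')) → n b = n' b' :=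
    fun b b' hs => copies_eq_of_similar hι (hf b) (hf' b')
      ⟨fun _ hh => slidVtx_of_not_mem hh, fun _ _ => Iff.rfl, hoff⟩ hs (fun x h => absurd h (hm x))
      fun x h => absurd h (hms x)
  have h0 : n ![false, false, false] = 0 :=
    copies_eq_zero_of_circle hι (hf _) (by decide +kernel) 0
  have h0' : n' ![false, false, false] = 0 :=
    copies_eq_zero_of_circle hι (hf' _) (by decide +kernel) 0
  have hsum : ∀ G : (Fin 3 → Bool × Bool) → ZMod 2, ∑ u ∈ choices fun _ : Fin 3 => false, G u =
      G (smooth ![false, false, false]) + (G (smooth ![true, false, false]) +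
      (G (smooth ![false, true, false]) + (G (smooth ![false, false, true]) +
      (G (smooth ![false, true, true]) + (G (smooth ![true, false, true]) +
      (G (smooth ![true, true, false]) + G (smooth ![true, true, true]))))))) := fun G => by
    rw [choices_triangle, Finset.sum_insert (by decide +kernel),
      Finset.sum_insert (by decide +kernel), Finset.sum_insert (by decide +kernel),
      Finset.sum_insert (by decide +kernel), Finset.sum_insert (by decide +kernel),
      Finset.sum_insert (by decide +kernel), Finset.sum_insert (by decide +kernel),
      Finset.sum_singleton]
  rw [hsum, hsum]
  change n _ + (n _ + (n _ + (n _ + (n _ + (n _ + (n _ + n _)))))) =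
    n' _ + (n' _ + (n' _ + (n' _ + (n' _ + (n' _ + (n' _ + n' _))))))
  rw [h0, h0', h1 ![false, true, false] ![true, false, false] (by decide +kernel),
    h1 ![false, false, true] ![true, false, false] (by decide +kernel),
    h2 ![false, true, false] ![true, false, false] (by decide +kernel),
    h2 ![false, false, true] ![true, false, false] (by decide +kernel),
    h3 ![true, false, false] ![true, true, true] (by decide +kernel),
    h3 ![true, true, true] ![true, false, false] (by decide +kernel),
    h3 ![false, true, true] ![false, true, true] (by decide +kernel),
    h3 ![true, false, true] ![true, false, true] (by decide +kernel),
    h3 ![true, true, false] ![true, true, false] (by decide +kernel)]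
  have two : (2 : ZMod 2) = 0 := rfl
  linear_combination (n' ![true, true, true] - n' ![true, false, false]) * two

open scoped Classical in
/-- The contribution of the crossings that are passed straight, in terms of the ends. -/
theorem localAgreement_eq (hι : C.Placed triangleEdge ι) {m : TangleHalf 3 → Bool}
    {vtx : C.H → V} (hm : ∀ x, C.Mixed vtx (ι x) ↔ m x = true) (hmo : ∀ x, m x.opp = m x)
    (hτ : ∀ x, m x = true → τ (ι x) = ι x.opp) {O : C.H → ZMod 2} (hO : C.Directs τ O) :
    C.localAgreement vtx ∅ ι O = ∑ x, if x.2.2 = true ∧ ι x ∈ C.first ∧ m x = true then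
      O (ι x) + C.dir (ι x) + 1 else 0 := by
  unfold localAgreement
  rw [Fintype.sum_prod_type, Fintype.sum_prod_type]
  refine Finset.sum_congr rfl fun v _ => ?_
  rw [Fintype.sum_prod_type, Fintype.sum_prod_type]
  refine Finset.sum_congr rfl fun s _ => ?_
  rw [Fintype.sum_bool, Fintype.sum_bool]
  have h1 : ι (v, s, true) = C.opp (ι (v, s, false)) := (hι.opp_eq (v, s, false)).symm
  have h2 : m (v, s, true) = m (v, s, false) := hmo (v, s, false)
  have h3 : ι (v, s, true) ∈ C.first ↔ ι (v, s, false) ∈ C.first := by rw [h1, C.opp_first]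
  by_cases hf : ι (v, s, false) ∈ C.first
  · by_cases hmx : m (v, s, false) = true
    · have h4 : O (ι (v, s, true)) = O (ι (v, s, false)) + 1 := by
        rw [← (hO _ hf).2, hτ _ hmx]
        rfl
      have h5 : C.dir (ι (v, s, true)) = C.dir (ι (v, s, false)) + 1 := by
        rw [h1, C.dir_opp _ hf]
      simp only [hm, h2, h3, hf, hmx, h4, h5, Set.mem_empty_iff_false, not_false_iff, and_self,
        if_true, Bool.false_eq_true, false_and, if_false]
      have two : (2 : ZMod 2) = 0 := rfl
      linear_combination (O (ι (v, s, false)) * C.dir (ι (v, s, false)) - 1) * two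
    · simp [hm, h2, hmx]
  · simp [h3, hf]

/-- The half-edges of a triangle with exactly one pure crossing: the two strands at the crossing `0`
belong to one curve, the third side to the other. -/
def MixedTriangle (C : Curves) (ι : TangleHalf 3 → C.H) (p : Bool) : Prop :=
  ∀ x, ι x ∈ C.first ↔ onThird x = p

theorem smoothZero_through : ∀ b, ∀ x : TangleHalf 3, decide (x.1 ≠ 0) = true →
    through (smoothZero b) x = x.opp := by
  decide +kernel

theorem smoothZero_slidThrough : ∀ b, ∀ x : TangleHalf 3,
    decide ((slide triangleEdge x).1 ≠ 0) = true →
      slidThrough triangleEdge (smoothZero b) x = x.opp := by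
  decide +kernel

/-- The direction of the smoothed curve agrees with the given one equally often, modulo `2`, before
and after the move of a mixed triangle. -/
theorem sameAgreement_slid (hι : C.Placed triangleEdge ι)
    (hm : ∀ x, C.Mixed vtx (ι x) ↔ decide (x.1 ≠ 0) = true) {p : Bool} (hp : C.MixedTriangle ι p)
    (b : Bool) {τ₁ τ₂ : C.H → C.H} (hτ₁ : ∀ x, τ₁ (ι x) = ι (through (smoothZero b) x))
    (hτ₂ : ∀ x, τ₂ (ι x) = ι (slidThrough triangleEdge (smoothZero b) x)) :
    C.SameAgreement vtx (slidVtx vtx ι) ∅ ∅ τ₁ τ₂ ι := by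
  classical
  intro O₁ O₂ h₁ h₂ hO
  rw [localAgreement_eq hι hm (by decide +kernel)
      (fun x hx => by rw [hτ₁, smoothZero_through b x hx]) h₁,
    localAgreement_eq hι (m := fun x => decide ((slide triangleEdge x).1 ≠ 0))
      (fun x => by rw [mixed_slidVtx_apply hι, hm])
      (by decide +kernel) (fun x hx => by rw [hτ₂, smoothZero_slidThrough b x hx]) h₂]
  have hsum : ∀ G : TangleHalf 3 → ZMod 2, (∀ x : TangleHalf 3, x.2.2 = false → G x = 0) →
      ∑ x, G x = G (0, false, true) + G (0, true, true) + G (1, false, true) + G (1, true, true) +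
        G (2, false, true) + G (2, true, true) := fun G hG => by
    simp only [Fintype.sum_prod_type, Fin.sum_univ_three, Fintype.sum_bool, hG (_, _, false) rfl]
    ring
  rw [hsum _ (fun x hx => by simp [hx]), hsum _ (fun x hx => by simp [hx])]
  have hO1 := hO (0, false, true) rfl
  have hO2 := hO (0, true, true) rfl
  have hO3 := hO (1, true, true) rfl
  have hO4 := hO (2, true, true) rfl
  cases p
  · have hf : ∀ x, onThird x = false → ι x ∈ C.first := fun x => (hp x).2
    have hpass : ∀ x, onThird x = false → O₁ (ι (through (smoothZero b) x)) = O₁ (ι x) + 1 :=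
      fun x hx => by rw [← hτ₁, (h₁ _ (hf x hx)).2]
    have hedge : ∀ x : TangleHalf 3, x.2.2 = false → onThird x = false →
        O₁ (ι (x.edge triangleEdge)) = O₁ (ι x) + 1 ∧
          C.dir (ι (x.edge triangleEdge)) = C.dir (ι x) + 1 := fun x hx hx' => by
      rw [← hι.edge_eq x hx]
      exact ⟨(h₁ _ (hf x hx')).1, C.dir_edge _ (hf x hx')⟩
    have hdir : ∀ x : TangleHalf 3, onThird x = false → C.dir (ι x.opp) = C.dir (ι x) + 1 :=
      fun x hx => by rw [← hι.opp_eq, C.dir_opp _ (hf x hx)]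
    have e1 : O₁ (ι (1, false, false)) = _ ∧ C.dir (ι (1, false, false)) = _ :=
      hedge (0, false, false) rfl rfl
    have e2 : O₁ (ι (2, false, false)) = _ ∧ C.dir (ι (2, false, false)) = _ :=
      hedge (0, true, false) rfl rfl
    have t1 : O₁ (ι (1, false, true)) = _ := hpass (1, false, false) rfl
    have t2 : O₁ (ι (2, false, true)) = _ := hpass (2, false, false) rfl
    have d1 : C.dir (ι (1, false, true)) = _ := hdir (1, false, false) rfl
    have d2 : C.dir (ι (2, false, true)) = _ := hdir (2, false, false) rfl
    have d3 : C.dir (ι (0, false, true)) = _ := hdir (0, false, false) rfl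
    have d4 : C.dir (ι (0, true, true)) = _ := hdir (0, true, false) rfl
    have two : (2 : ZMod 2) = 0 := rfl
    have t3 := hpass (0, false, false) rfl
    have t4 := hpass (0, false, true) rfl
    have f20 : ((2 : Fin 3) = 0) = False := by decide
    have f21 : ((2 : Fin 3) = 1) = False := by decide
    have f10 : ((1 : Fin 3) = 0) = False := by decide
    simp only [hp _, onThird, slide, triangleEdge, f20, f21, f10, ne_eq, not_true, not_false_iff,
      if_true,
      if_false, decide_true, decide_false, Bool.and_false, Bool.and_true, Bool.false_eq_true,
      Bool.true_eq_false, and_true, and_false, add_zero, zero_add]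
    cases b
    · change O₁ (ι (0, true, false)) = _ at t3
      change O₁ (ι (0, true, true)) = _ at t4
      rw [hO1, hO2, t1, t2, d1, d2, d3, d4, e1.1, e1.2, e2.1, e2.2, t3, t4]
      linear_combination (O₁ (ι (0, false, false)) - O₁ (ι (0, false, true)) + 3) * two
    · change O₁ (ι (0, true, true)) = _ at t3
      change O₁ (ι (0, true, false)) = _ at t4
      rw [hO1, hO2, t1, t2, d1, d2, d3, d4, e1.1, e1.2, e2.1, e2.2, t3, t4]
      linear_combination 3 * two
  · simp [hp _, onThird, slide, triangleEdge, hO3, hO4]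

end Curves

namespace Curves

open TangleHalf

variable {V VL : Type} {C : Curves} {vtx : C.H → V} {τ : C.H → C.H} {L : Curves} {vL : L.H → VL}
  {ι : TangleHalf 3 → C.H} {t : TangleHalf 3 → TangleHalf 3} {c : TangleHalf 3 → Fin 3}

/-- Two sets of half-edges inside of a triangle along which its crossings `1` and `2` are connected
by a bigon, after the crossing `0` has been smoothed. -/
def BigonPaths (t : TangleHalf 3 → TangleHalf 3) (c : TangleHalf 3 → Fin 3)
    (x₁ x₂ z₁ z₂ : TangleHalf 3) (S₁ S₂ : Finset (TangleHalf 3)) : Prop :=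
  c x₁ = 1 ∧ c x₂ = 1 ∧ c z₁ = 2 ∧ c z₂ = 2 ∧ x₁ ≠ x₂ ∧ x₁.opp ≠ x₂ ∧ z₁.opp ≠ z₂ ∧
  (x₁ ∈ S₁ ∧ ∀ x ∈ S₁, x.2.2 = false ∧ x.edge triangleEdge ∈ S₁ ∧ (c x = 0 → t x ∈ S₁) ∧
    (c x ≠ 0 → x = x₁ ∨ x = z₁)) ∧
  x₂ ∈ S₂ ∧ ∀ x ∈ S₂, x.2.2 = false ∧ x.edge triangleEdge ∈ S₂ ∧ (c x = 0 → t x ∈ S₂) ∧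
    (c x ≠ 0 → x = x₂ ∨ x = z₂)

/-- If the crossings `1` and `2` are connected by a bigon, then a copy has at most one of them. -/
theorem IsCopy.no_bigon_triangle (hL : Reduced L vL) (hι : C.Placed triangleEdge ι)
    (hst : C.IsState vtx ∅ τ) (hf : C.Follows vtx ∅ τ ι t c)
    (hm : ∀ x, C.Mixed vtx (ι x) ↔ decide (c x ≠ 0) = true)
    {x₁ x₂ z₁ z₂ : TangleHalf 3} {S₁ S₂ : Finset (TangleHalf 3)}
    (hb : BigonPaths t c x₁ x₂ z₁ z₂ S₁ S₂) (Y : Set C.H) (hY : IsCopy L vL C vtx ∅ τ Y)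
    (x z : TangleHalf 3) (hx : ι x ∈ Y) (hz : ι z ∈ Y) : c x = c z := by
  obtain ⟨hx₁, hx₂, hz₁, hz₂, hne, hox, hoz, ⟨hS₁, h₁⟩, hS₂, h₂⟩ := hb
  by_contra hxz
  have hc0 : ∀ {x}, ι x ∈ Y → c x ≠ 0 := fun hx => by
    simpa using (hm _).1 (hY.mixed _ hx).1
  have hmem : ∀ w, c w ≠ 0 → ι w ∈ Y := by
    intro w hw
    have h3 : c w = c x ∨ c w = c z := by
      have hx0 := hc0 hx
      have hz0 := hc0 hz
      revert hxz hx0 hz0 hw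
      generalize c x = i
      generalize c z = j
      generalize c w = l
      revert i j l
      decide
    rcases h3 with h | h
    · exact hY.sat _ _ ((hf.crosses.vtx_iff _ _).2 h.symm) hx
    · exact hY.sat _ _ ((hf.crosses.vtx_iff _ _).2 h.symm) hz
  have key : ∀ {S : Finset (TangleHalf 3)} {a b : TangleHalf 3}, a ∈ S →
      (∀ x ∈ S, x.2.2 = false ∧ x.edge triangleEdge ∈ S ∧ (c x = 0 → t x ∈ S) ∧
        (c x ≠ 0 → x = a ∨ x = b)) →
      ∀ h ∈ Y, C.Joined τ Y (ι a) h → h = ι a ∨ h = ι b := by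
    intro S a b ha hS h hh hj
    obtain ⟨w, hw, rfl⟩ := hj.exists_inner hι hf.through hf.invol
      (fun h hh hh' => hh (hY.sat _ _ (hst.vtx_eq h) hh')) (fun w => decide (w ∈ S)) (fun w hw => by
        simp only [decide_eq_true_eq] at hw ⊢
        refine ⟨(hS w hw).1, (hS w hw).2.1, fun hwY => (hS w hw).2.2.1 ?_⟩
        by_contra hw0
        exact hwY (hmem w hw0))
      (by simpa using ha)
    simp only [decide_eq_true_eq] at hw
    rcases (hS w hw).2.2.2 (hc0 hh) with rfl | rfl
    · exact Or.inl rfl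
    · exact Or.inr rfl
  have hv := hf.crosses.vtx_iff
  refine hY.no_bigon hL (x₁ := ι x₁) (x₂ := ι x₂) (z₁ := ι z₁) (z₂ := ι z₂)
    (hmem _ (by rw [hx₁]; decide)) (hmem _ (by rw [hx₂]; decide)) ((hv _ _).2 (hx₁.trans hx₂.symm))
    ((hv _ _).2 (hz₁.trans hz₂.symm)) ?_ (hι.inj.ne hne) ?_ ?_ (key hS₁ h₁) (key hS₂ h₂)
  · rw [ne_eq, hv, hx₁, hz₁]
    decide
  · rw [hι.opp_eq]
    exact hι.inj.ne hox
  · rw [hι.opp_eq]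
    exact hι.inj.ne hoz

/-- A copy contains a crossing of the triangle with all its half-edges, and not the pure crossing
`0`. -/
theorem IsCopy.triangle_pattern {X Y : Set C.H} (hY : IsCopy L vL C vtx X τ Y)
    (hc : C.CrossesBy vtx ι c) (hm : ∀ x, C.Mixed vtx (ι x) ↔ decide (c x ≠ 0) = true)
    (r : Fin 3 → TangleHalf 3) (hr : ∀ v, c (r v) = v) :
    ∃ a b, ∀ x, ι x ∈ Y ↔ (![false, a, b] : Fin 3 → Bool) (c x) = true := by
  classical
  refine ⟨decide (ι (r 1) ∈ Y), decide (ι (r 2) ∈ Y), fun x => ?_⟩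
  have h1 : ∀ v, c x = v → (ι x ∈ Y ↔ ι (r v) ∈ Y) := by
    intro v hv
    have h := (hc.vtx_iff x (r v)).2 (by rw [hv, hr])
    exact ⟨hY.sat _ _ h, hY.sat _ _ h.symm⟩
  have h0 : ∀ x, c x = 0 → ι x ∉ Y := fun x hx hxY => by
    have := (hm x).1 (hY.mixed _ hxY).1
    simp [hx] at this
  generalize hv : c x = v
  fin_cases v
  · simpa using h0 x hv
  · simpa using h1 1 hv
  · simpa using h1 2 hv

theorem bigonPaths_before : BigonPaths (through (smoothZero false)) (·.1) (1, false, false)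
    (1, true, false) (2, false, false) (2, true, false)
    {(1, false, false), (0, false, false), (0, true, false), (2, false, false)}
    {(1, true, false), (2, true, false)} := by
  refine ⟨?_, ?_, ?_, ?_, ?_, ?_, ?_, ⟨?_, ?_⟩, ?_, ?_⟩ <;> decide +kernel

theorem bigonPaths_after : BigonPaths (slidThrough triangleEdge (smoothZero false))
    (fun x => (slide triangleEdge x).1) (0, false, false) (2, true, false) (0, true, false)
    (1, true, false) {(1, false, false), (0, false, false), (0, true, false), (2, false, false)}
    {(1, true, false), (2, true, false)} := by
  refine ⟨?_, ?_, ?_, ?_, ?_, ?_, ?_, ⟨?_, ?_⟩, ?_, ?_⟩ <;> decide +kernel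

theorem replaces_transplant (a b : Bool) :
    Replaces triangleEdge (through (smoothZero true)) (slidThrough triangleEdge (smoothZero true))
      (fun x => (![false, a, b] : Fin 3 → Bool) x.1) transplant (·.1)
      (fun x => (slide triangleEdge x).1) := by
  revert a b
  decide +kernel

theorem replaces_transplant_symm (a b : Bool) :
    Replaces triangleEdge (slidThrough triangleEdge (smoothZero true)) (through (smoothZero true))
      (fun x => (![false, a, b] : Fin 3 → Bool) (slide triangleEdge x).1) transplant
      (fun x => (slide triangleEdge x).1) (·.1) := by
  revert a b
  decide +kernel

theorem transplant_pattern (a b : Bool) (x : TangleHalf 3) :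
    ((![false, a, b] : Fin 3 → Bool) x.1 = true → onThird (transplant x) = onThird x) ∧
    ((![false, a, b] : Fin 3 → Bool) (transplant x).1 = true →
      decide ((slide triangleEdge x).1 ≠ 0) = true) ∧
    ((![false, a, b] : Fin 3 → Bool) (slide triangleEdge x).1 = true →
      onThird (transplant x) = onThird x) ∧
    ((![false, a, b] : Fin 3 → Bool) (slide triangleEdge (transplant x)).1 = true →
      decide (x.1 ≠ 0) = true) := by
  revert a b x
  decide +kernel

/-- The triangle two of whose sides belong to one curve, and the third one to the other. If the pure
crossing is smoothed in one way, then the other two form bigons before and after the move; if it is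
smoothed in the other way, then the move only interchanges the other two crossings. -/
theorem bracket_triangle_mixed (hL : Reduced L vL) (hι : C.Placed triangleEdge ι)
    (hc : C.CrossesBy vtx ι (·.1)) (hvo : ∀ h, vtx (C.opp h) = vtx h)
    (hm : ∀ x, C.Mixed vtx (ι x) ↔ decide (x.1 ≠ 0) = true) {p : Bool}
    (hp : C.MixedTriangle ι p) :
    bracket L vL C vtx ∅ = bracket L vL C (slidVtx vtx ι) ∅ := by
  classical
  have hc' := crosses_slidVtx hι.inj hc
  have hms : ∀ x, C.Mixed (slidVtx vtx ι) (ι x) ↔ decide ((slide triangleEdge x).1 ≠ 0) = true :=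
    fun x => by rw [mixed_slidVtx_apply hι, hm]
  unfold bracket
  rw [sum_states hι.inj hι.opp_eq hc hvo (m := fun v => decide (v ≠ 0)) hm,
    sum_states_slid hι hc hvo (m := fun v => decide (v ≠ 0)) hm]
  refine Finset.sum_congr rfl fun τ hτ => ?_
  simp only [Finset.mem_filter, Finset.mem_univ, true_and] at hτ
  have hmem : ∀ b, smoothZero b ∈ choices fun v : Fin 3 => decide (v ≠ 0) := by decide +kernel
  have hst := fun b => isState_replace hι.inj hι.opp_eq hc (m := fun v => decide (v ≠ 0))
    hm hτ (hmem b)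
  have hst' := fun b => isState_replace_slid hι hc hvo (m := fun v => decide (v ≠ 0)) hm hτ (hmem b)
  have hf := fun b => (hst b).follows hc (replace_apply hι.inj)
  have hf' := fun b => (hst' b).follows hc' (replace_apply hι.inj)
  have hsame := fun b => sameAgreement_slid hι hm hp b (τ₁ := replace ι (through (smoothZero b)) τ)
    (τ₂ := replace ι (slidThrough triangleEdge (smoothZero b)) τ)
    (replace_apply hι.inj) (replace_apply hι.inj)
  have hoff : ∀ b, C.AgreeOff vtx (slidVtx vtx ι) ∅ ∅ (replace ι (through (smoothZero b)) τ)
      (replace ι (slidThrough triangleEdge (smoothZero b)) τ) ι := fun b =>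
    ⟨fun _ hh => slidVtx_of_not_mem hh, fun _ _ => Iff.rfl, fun h hh => by
      rw [replace_of_not_mem hh, replace_of_not_mem hh]⟩
  have hthird : ∀ {x z : TangleHalf 3}, onThird x = onThird z → (ι x ∈ C.first ↔ ι z ∈ C.first) :=
    fun h => by rw [hp, hp, h]
  -- The copies that contain a crossing of the bigon come in pairs, before and after the move.
  have hU : copies L vL C vtx ∅ (replace ι (through (smoothZero false)) τ) =
      copiesOff L vL C vtx ∅ (replace ι (through (smoothZero false)) τ) ι := by
    refine copies_eq_copiesOff_of_replaces hι (hf false) hm (q := exchange) (by decide +kernel)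
      (fun x _ => hthird (by revert x; decide +kernel)) (fun O₁ O₂ h₁ h₂ hO => ?_)
      (IsCopy.no_bigon_triangle hL hι (hst false) (hf false) hm bigonPaths_before)
      (by decide +kernel)
    have := fun {O} => localAgreement_eq hι hm (O := O)
      (τ := replace ι (through (smoothZero false)) τ)
      (by decide +kernel) (fun x hx => by rw [(hf false).through, smoothZero_through _ x hx])
    rw [this h₁, this h₂]
    refine Finset.sum_congr rfl fun x _ => ?_
    split_ifs with hx
    · rw [hO x hx.1]
    · rfl
  have hU' : copies L vL C (slidVtx vtx ι) ∅
        (replace ι (slidThrough triangleEdge (smoothZero false)) τ) =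
      copiesOff L vL C (slidVtx vtx ι) ∅
        (replace ι (slidThrough triangleEdge (smoothZero false)) τ) ι := by
    refine copies_eq_copiesOff_of_replaces hι (hf' false) hms (q := slidExchange)
      (by decide +kernel)
      (fun x _ => hthird (by revert x; decide +kernel)) (fun O₁ O₂ h₁ h₂ hO => ?_)
      (IsCopy.no_bigon_triangle hL hι (hst' false) (hf' false) hms bigonPaths_after)
      (by decide +kernel)
    have := fun {O} => localAgreement_eq hι hms (O := O) (m := fun x =>
      decide ((slide triangleEdge x).1 ≠ 0))
      (τ := replace ι (slidThrough triangleEdge (smoothZero false)) τ)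
      (by decide +kernel) (fun x hx => by rw [(hf' false).through, smoothZero_slidThrough _ x hx])
    rw [this h₁, this h₂]
    refine Finset.sum_congr rfl fun x _ => ?_
    split_ifs with hx
    · rw [hO x hx.1]
    · rfl
  have hUU : copiesOff L vL C vtx ∅ (replace ι (through (smoothZero false)) τ) ι =
      copiesOff L vL C (slidVtx vtx ι) ∅
        (replace ι (slidThrough triangleEdge (smoothZero false)) τ) ι := by
    refine Finset.sum_congr rfl fun Y _ => ?_
    by_cases hY : ∀ x, ι x ∉ Y
    · simp only [isCopy_iff_of_similar hι (hf false) (hf' false) (hoff false) (by decide +kernel)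
        (hsame false) hY]
    · simp only [hY, and_false]
  have hV : copies L vL C vtx ∅ (replace ι (through (smoothZero true)) τ) =
      copies L vL C (slidVtx vtx ι) ∅
        (replace ι (slidThrough triangleEdge (smoothZero true)) τ) := by
    have hq : ∀ x, transplant (transplant x) = x := by decide +kernel
    have hinv : Function.Involutive fun Y : Set C.H => lift ι transplant ⁻¹' Y := fun Y => by
      have : lift ι transplant ∘ lift ι transplant = id := funext (lift_lift hι.inj hq)
      show lift ι transplant ⁻¹' (lift ι transplant ⁻¹' Y) = Y
      rw [← Set.preimage_comp, this, Set.preimage_id]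
    refine Fintype.sum_bijective _ hinv.bijective _ _ fun Y => ?_
    have h1 : IsCopy L vL C vtx ∅ (replace ι (through (smoothZero true)) τ) Y →
        IsCopy L vL C (slidVtx vtx ι) ∅
          (replace ι (slidThrough triangleEdge (smoothZero true)) τ) (lift ι transplant ⁻¹' Y) := by
      intro h
      obtain ⟨a, b, hpat⟩ := h.triangle_pattern hc hm (fun v => (v, false, false)) fun _ => rfl
      refine h.transfer hι (hf true) (hf' true) (hoff true)
        (replaces_transplant a b) hpat
        (fun x hx => hthird ((transplant_pattern a b x).1 hx))
        (fun x hx => ⟨(hms x).2 ((transplant_pattern a b x).2.1 hx), by simp⟩) (hsame true)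
    have h2 : ∀ Y, IsCopy L vL C (slidVtx vtx ι) ∅
          (replace ι (slidThrough triangleEdge (smoothZero true)) τ) Y →
        IsCopy L vL C vtx ∅ (replace ι (through (smoothZero true)) τ) (lift ι transplant ⁻¹' Y) :=
          by
      intro Y h
      obtain ⟨a, b, hpat⟩ := h.triangle_pattern hc' hms
        (fun v => slide triangleEdge (v, false, false)) (by decide +kernel)
      refine h.transfer hι (hf' true) (hf true) (hoff true).symm
        (replaces_transplant_symm a b) hpat
        (fun x hx => hthird ((transplant_pattern a b x).2.2.1 hx))
        (fun x hx => ⟨(hm x).2 ((transplant_pattern a b x).2.2.2 hx), by simp⟩) (hsame true).symm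
    have h3 : IsCopy L vL C vtx ∅ (replace ι (through (smoothZero true)) τ) Y ↔
        IsCopy L vL C (slidVtx vtx ι) ∅
          (replace ι (slidThrough triangleEdge (smoothZero true)) τ) (lift ι transplant ⁻¹' Y) :=
      ⟨h1, fun h => by simpa only [hinv Y] using h2 _ h⟩
    simp only [h3]
  rw [choices_triangle_mixed, Finset.sum_insert (by decide +kernel), Finset.sum_singleton,
    Finset.sum_insert (by decide +kernel), Finset.sum_singleton, hU, hU', hUU, hV]

end Curves

/-! ### The symmetries of a triangle -/

namespace TangleHalf

/-- The symmetry of a triangle that interchanges the crossings `0` and `1`. -/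
def flip (x : TangleHalf 3) : TangleHalf 3 :=
  (![1, 0, 2] x.1, x.2.1 ^^ decide (x.1 = 2), x.2.2)

/-- A symmetry of a triangle that rotates its crossings. -/
def rotate (x : TangleHalf 3) : TangleHalf 3 :=
  (![2, 0, 1] x.1, x.2.1 ^^ decide (x.1 ≠ 0), x.2.2)

/-- `ρ` is a symmetry of the triangle. -/
def IsSymmetry (ρ : TangleHalf 3 → TangleHalf 3) : Prop :=
  (∀ x, ∃ z, ρ z = x) ∧ (∀ x z, ρ x = ρ z → x = z) ∧ (∀ x, ρ (opp x) = opp (ρ x)) ∧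
    (∀ x, (ρ x).2.2 = x.2.2) ∧ (∀ x, ρ (x.edge triangleEdge) = (ρ x).edge triangleEdge) ∧
    ∀ x z, (ρ x).1 = (ρ z).1 ↔ x.1 = z.1

theorem isSymmetry_flip : IsSymmetry flip := by
  unfold IsSymmetry
  decide +kernel

theorem isSymmetry_rotate : IsSymmetry rotate := by
  unfold IsSymmetry
  decide +kernel

/-- The side of a triangle on which a half-edge lies. -/
def side (x : TangleHalf 3) : Fin 3 :=
  if onThird x then 2 else if decide (x = (0, true, x.2.2)) || decide (x.1 = 2) then 1 else 0

theorem onThird_eq (x : TangleHalf 3) : onThird x = decide (side x = 2) := by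
  revert x
  decide +kernel

theorem exists_side_ne (x : TangleHalf 3) (hx : x.1 ≠ 0) :
    ∃ z : TangleHalf 3, z.1 = x.1 ∧ (side z = 2 ↔ side x ≠ 2) := by
  revert x
  decide +kernel

theorem side_ne_two (x : TangleHalf 3) (hx : x.1 = 0) : side x ≠ 2 := by
  revert x
  decide +kernel

end TangleHalf

namespace Curves

open TangleHalf

variable {V VL : Type} {C : Curves} {vtx : C.H → V} {L : Curves} {vL : L.H → VL}
  {ι : TangleHalf 3 → C.H} {ρ : TangleHalf 3 → TangleHalf 3}

theorem Placed.comp (hι : C.Placed triangleEdge ι) (hρ : IsSymmetry ρ) :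
    C.Placed triangleEdge (ι ∘ ρ) := by
  obtain ⟨-, hinj, hopp, hb, hedge, -⟩ := hρ
  refine ⟨hι.inj.comp hinj, fun x => ?_, fun x hx => ?_⟩
  · rw [Function.comp, hι.opp_eq, ← hopp]
    rfl
  · rw [Function.comp, hι.edge_eq _ (by rw [hb, hx]), ← hedge]
    rfl

theorem CrossesBy.comp (hc : C.CrossesBy vtx ι (·.1)) (hρ : IsSymmetry ρ) :
    C.CrossesBy vtx (ι ∘ ρ) (·.1) := by
  obtain ⟨hsurj, -, -, -, -, hv⟩ := hρ
  refine ⟨fun x z => (hc.vtx_iff _ _).trans (hv x z), fun h x hh => ?_⟩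
  obtain ⟨z, rfl⟩ := hc.sat _ _ hh
  obtain ⟨z, rfl⟩ := hsurj z
  exact ⟨z, rfl⟩

theorem slidVtx_comp (hinj : Function.Injective ι) (hρ : IsSymmetry ρ) :
    slidVtx vtx (ι ∘ ρ) = slidVtx vtx ι := by
  obtain ⟨hsurj, hρinj, hopp, -, hedge, -⟩ := hρ
  have hs : ∀ x, ρ (slide triangleEdge x) = slide triangleEdge (ρ x) := fun x =>
    (hopp (x.edge triangleEdge)).trans (congrArg _ (hedge x))
  funext h
  by_cases hr : h ∈ Set.range ι
  · obtain ⟨x, rfl⟩ := hr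
    obtain ⟨x, rfl⟩ := hsurj x
    have := slidVtx_apply (vtx := vtx) (hinj.comp hρinj) x
    simp only [Function.comp] at this
    rw [this, hs, slidVtx_apply hinj]
  · rw [slidVtx_of_not_mem hr, slidVtx_of_not_mem]
    rintro ⟨x, rfl⟩
    exact hr ⟨_, rfl⟩

/-- Half-edges on the same side of the triangle belong to the same curve. -/
theorem Placed.first_iff_side (hι : C.Placed triangleEdge ι) (x : TangleHalf 3) :
    ι x ∈ C.first ↔
      ι ((![(0, false, false), (0, true, false), (1, true, false)] : Fin 3 → TangleHalf 3) (side x))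
        ∈
        C.first := by
  have h1 : ∀ x, ι (TangleHalf.opp x) ∈ C.first ↔ ι x ∈ C.first := fun x => by
    rw [← hι.opp_eq, C.opp_first]
  have h2 : ∀ x : TangleHalf 3, x.2.2 = false → (ι (x.edge triangleEdge) ∈ C.first ↔ ι x ∈ C.first)
    :=
    fun x hx => by rw [← hι.edge_eq x hx, C.edge_first]
  have h3 : ∀ x : TangleHalf 3, x =
      ![(0, false, false), (0, true, false), (1, true, false)] (side x) ∨
      x.opp = ![(0, false, false), (0, true, false), (1, true, false)] (side x) ∨
      (x.2.2 = false ∧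
        x.edge triangleEdge = ![(0, false, false), (0, true, false), (1, true, false)] (side x)) ∨
      (x.opp.2.2 = false ∧ x.opp.edge triangleEdge =
        ![(0, false, false), (0, true, false), (1, true, false)] (side x)) := by
    decide +kernel
  rcases h3 x with h | h | ⟨hb, h⟩ | ⟨hb, h⟩
  · rw [← h]
  · rw [← h, h1]
  · rw [← h, h2 x hb]
  · rw [← h, h2 _ hb, h1]

/-- The third Reidemeister move at a triangle whose crossing `0` is pure. -/
theorem bracket_triangle_of_first (hL : Reduced L vL) (hι : C.Placed triangleEdge ι)
    (hc : C.CrossesBy vtx ι (·.1)) (hvo : ∀ h, vtx (C.opp h) = vtx h)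
    (h01 : ι (0, false, false) ∈ C.first ↔ ι (0, true, false) ∈ C.first) :
    bracket L vL C vtx ∅ = bracket L vL C (slidVtx vtx ι) ∅ := by
  have hs : ∀ x, ι x ∈ C.first ↔ (if side x = 2 then ι (1, true, false) ∈ C.first
      else ι (0, false, false) ∈ C.first) := fun x => by
    rw [hι.first_iff_side]
    generalize side x = i
    fin_cases i
    · simp
    · simpa using h01.symm
    · simp
  have hmix : ∀ x, C.Mixed vtx (ι x) ↔ ∃ z : TangleHalf 3, z.1 = x.1 ∧
      ¬(ι z ∈ C.first ↔ ι x ∈ C.first) :=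
    fun x => by
      constructor
      · rintro ⟨h, hh, hn⟩
        obtain ⟨z, rfl⟩ := hc.sat _ _ hh
        exact ⟨z, (hc.vtx_iff _ _).1 hh, hn⟩
      · rintro ⟨z, hz, hn⟩
        exact ⟨ι z, (hc.vtx_iff _ _).2 hz, hn⟩
  by_cases h02 : ι (0, false, false) ∈ C.first ↔ ι (1, true, false) ∈ C.first
  · refine bracket_triangle_pure hι hc hvo fun x => ?_
    rw [hmix]
    rintro ⟨z, -, hn⟩
    rw [hs, hs x, ← h02, ite_self, ite_self] at hn
    exact hn Iff.rfl
  · classical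
    refine bracket_triangle_mixed hL hι hc hvo (fun x => ?_)
      (p := decide (ι (1, true, false) ∈ C.first)) fun x => ?_
    · rw [hmix, decide_eq_true_eq]
      constructor
      · rintro ⟨z, hz, hn⟩ hx
        rw [hs, hs x, if_neg (side_ne_two x hx), if_neg (side_ne_two z (hz.trans hx))] at hn
        exact hn Iff.rfl
      · intro hx
        obtain ⟨z, hz, hzx⟩ := exists_side_ne x hx
        refine ⟨z, hz, ?_⟩
        rw [hs, hs x]
        by_cases h2 : side x = 2
        · rwa [if_pos h2, if_neg (by simpa [h2] using hzx)]
        · rw [if_neg h2, if_pos (hzx.2 h2)]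
          exact fun h => h02 h.symm
    · rw [hs, onThird_eq]
      by_cases h2 : side x = 2
      · simp [h2]
      · simp only [h2, if_false, decide_false, Bool.false_eq, decide_eq_false_iff_not]
        tauto

/-- Invariance under the third Reidemeister move. -/
theorem bracket_triangle (hL : Reduced L vL) (hι : C.Placed triangleEdge ι)
    (hc : C.CrossesBy vtx ι (·.1)) (hvo : ∀ h, vtx (C.opp h) = vtx h) :
    bracket L vL C vtx ∅ = bracket L vL C (slidVtx vtx ι) ∅ := by
  have h0 := hι.first_iff_side (1, false, false)
  have h1 := hι.first_iff_side (2, false, false)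
  have h2 := hι.first_iff_side (2, true, false)
  rw [show side (1, false, false) = 0 by decide +kernel] at h0
  rw [show side (2, false, false) = 1 by decide +kernel] at h1
  rw [show side (2, true, false) = 2 by decide +kernel] at h2
  -- Two of the three sides belong to the same curve; a symmetry moves their crossing to `0`.
  by_cases h01 : ι (0, false, false) ∈ C.first ↔ ι (0, true, false) ∈ C.first
  · exact bracket_triangle_of_first hL hι hc hvo h01
  · by_cases h02 : ι (0, false, false) ∈ C.first ↔ ι (1, true, false) ∈ C.first
    · rw [← slidVtx_comp hι.inj isSymmetry_flip]
      refine bracket_triangle_of_first hL (hι.comp isSymmetry_flip) (hc.comp isSymmetry_flip) hvo ?_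
      exact h0.trans h02
    · rw [← slidVtx_comp hι.inj isSymmetry_rotate]
      refine bracket_triangle_of_first hL (hι.comp isSymmetry_rotate) (hc.comp isSymmetry_rotate)
        hvo ?_
      refine h1.trans (Iff.trans ?_ h2.symm)
      show ι (0, true, false) ∈ C.first ↔ ι (1, true, false) ∈ C.first
      tauto

theorem Placed.slide_eq (hι : C.Placed triangleEdge ι) (x : TangleHalf 3) :
    ι (slide triangleEdge x) = C.edge (C.opp (ι x)) ∨
      ι (slide triangleEdge x) = C.opp (C.edge (ι x)) := by
  obtain ⟨v, s, b⟩ := x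
  cases b
  · right
    rw [hι.edge_eq _ rfl, hι.opp_eq]
    rfl
  · left
    rw [hι.opp_eq]
    exact (hι.edge_eq (v, s, false) rfl).symm

theorem lift_slide_opp (hι : C.Placed triangleEdge ι) (h : C.H) :
    lift ι (slide triangleEdge) (C.opp h) = C.opp (lift ι (slide triangleEdge) h) := by
  by_cases hr : h ∈ Set.range ι
  · obtain ⟨x, rfl⟩ := hr
    rw [hι.opp_eq, lift_apply hι.inj, lift_apply hι.inj, hι.opp_eq]
    rfl
  · rw [lift_of_not_mem hr, lift_of_not_mem]
    rintro ⟨x, hx⟩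
    exact hr ⟨x.opp, by rw [← hι.opp_eq, hx, C.opp_opp]⟩

theorem lift_slide_dir (hι : C.Placed triangleEdge ι) (h : C.H) (hh : h ∈ C.first) :
    C.dir (lift ι (slide triangleEdge) h) = C.dir h := by
  by_cases hr : h ∈ Set.range ι
  · obtain ⟨x, rfl⟩ := hr
    rw [lift_apply hι.inj]
    rcases hι.slide_eq x with h | h
    · rw [h, C.dir_edge _ ((C.opp_first _).2 hh), C.dir_opp _ hh, add_assoc,
        CharTwo.add_self_eq_zero, add_zero]
    · rw [h, C.dir_opp _ ((C.edge_first _).2 hh), C.dir_edge _ hh, add_assoc,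
        CharTwo.add_self_eq_zero, add_zero]
  · rw [lift_of_not_mem hr]

/-- The result of a third Reidemeister move, where the edges are attached anew, is isomorphic to the
curves with the crossings exchanged. -/
theorem slid_erasure {C' : Curves} {V' : Type} {vtx' : C'.H → V'} {f : C'.H → C.H}
    (hι : C.Placed triangleEdge ι) (hf : Function.Bijective f)
    (hvtx : ∀ h k, vtx (f h) = vtx (f k) ↔ vtx' h = vtx' k)
    (hopp : ∀ h, f (C'.opp h) = C.opp (f h))
    (hedge : ∀ h, f (C'.edge h) =
      lift ι (slide triangleEdge) (C.edge (lift ι (slide triangleEdge) (f h))))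
    (hfirst : ∀ h, f h ∈ C.first ↔ h ∈ C'.first) (hdir : ∀ h ∈ C'.first, C.dir (f h) = C'.dir h)
    (hvo : ∀ h, vtx (C.opp h) = vtx h) :
    Erasure C' vtx' C (slidVtx vtx ι) ∅ (lift ι (slide triangleEdge) ∘ f) := by
  have hss := lift_lift hι.inj slide_slide
  have hbij : Function.Bijective (lift ι (slide triangleEdge)) :=
    Function.Involutive.bijective hss
  refine ⟨hbij.1.comp hf.1, fun h => ?_, by simp, slidVtx_opp hι hvo, fun h k => ?_, fun h => ?_,
    fun h => ?_, fun h => ?_, fun h hh => ?_, by simp⟩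
  · simpa using (hbij.2.comp hf.2) h
  · simp only [slidVtx, Function.comp, hss, hvtx]
  · simp only [Function.comp, hopp, lift_slide_opp hι]
  · simp only [Function.comp, hedge, hss]
    exact .here _ (by simp)
  · exact (lift_slide_first hι _).trans (hfirst h)
  · exact (lift_slide_dir hι _ ((hfirst h).2 hh)).trans (hdir h hh)

end Curves

/-! ### The invariant of free links with two components -/

namespace FramedFourGraph

open Curves

/-- The half-edges of a tangle in a framed graph, where `p` places those of the edges inside. -/
def place {D : Type} (G : FramedFourGraph D) {k : ℕ} (p : Fin k × Bool → G.H) (x : TangleHalf k) :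
    G.H :=
  if x.2.2 then G.opp (p (x.1, x.2.1)) else p (x.1, x.2.1)

variable {D : Type} {G : FramedFourGraph D} {k : ℕ} {p : Fin k × Bool → G.H} {w : Fin k → G.V}

theorem opp_place (x : TangleHalf k) : G.opp (G.place p x) = G.place p x.opp := by
  obtain ⟨v, s, b⟩ := x
  cases b <;> simp [place, TangleHalf.opp, G.opp_opp]

theorem vtx_place (hv : ∀ y, G.vtx (p y) = w y.1) (x : TangleHalf k) :
    G.vtx (G.place p x) = w x.1 := by
  obtain ⟨v, s, b⟩ := x
  cases b <;> simp [place, G.vtx_opp, hv]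

theorem comp_place (x : TangleHalf k) : G.comp (G.place p x) = G.comp (p (x.1, x.2.1)) := by
  obtain ⟨v, s, b⟩ := x
  cases b <;> simp [place, G.comp_opp]

theorem place_injective (hw : Function.Injective w) (hv : ∀ y, G.vtx (p y) = w y.1)
    (hne : ∀ v, p (v, false) ≠ p (v, true)) (hopp : ∀ v, G.opp (p (v, false)) ≠ p (v, true)) :
    Function.Injective (G.place p) := by
  have hopp' : ∀ v, p (v, false) ≠ G.opp (p (v, true)) := fun v h =>
    hopp v (by rw [h, G.opp_opp])
  have hoo : ∀ v, G.opp (p (v, false)) ≠ G.opp (p (v, true)) := fun v h =>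
    hne v (by rw [← G.opp_opp (p (v, false)), h, G.opp_opp])
  rintro ⟨v, s, b⟩ ⟨v', s', b'⟩ h
  have hvv : v = v' := hw (by simpa only [vtx_place hv] using congrArg G.vtx h)
  subst hvv
  cases s <;> cases s' <;> cases b <;> cases b' <;> simp [place] at h ⊢
  all_goals
    first
    | exact G.opp_ne _ h
    | exact G.opp_ne _ h.symm
    | exact hne _ h
    | exact hne _ h.symm
    | exact hopp _ h
    | exact hopp _ h.symm
    | exact hopp' _ h
    | exact hopp' _ h.symm
    | exact hoo _ h
    | exact hoo _ h.symm

/-- A tangle contains all half-edges at its vertices, because these have valency four. -/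
theorem mem_range_place (hinj : Function.Injective (G.place p)) (hv : ∀ y, G.vtx (p y) = w y.1)
    (h : G.H) : h ∈ Set.range (G.place p) ↔ ∃ v, G.vtx h = w v := by
  constructor
  · rintro ⟨x, rfl⟩
    exact ⟨x.1, vtx_place hv x⟩
  · rintro ⟨v, hh⟩
    have := G.finite_H
    let f : Bool × Bool → {h // G.vtx h = w v} := fun y =>
      ⟨G.place p (v, y.1, y.2), vtx_place hv _⟩
    have hf : Function.Injective f := fun y z hyz => by
      have := hinj (congrArg Subtype.val hyz)
      simpa [Prod.ext_iff] using this
    have hb := hf.bijective_of_nat_card_le (by rw [G.four_valent]; simp)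
    obtain ⟨y, hy⟩ := hb.2 ⟨h, hh⟩
    exact ⟨_, congrArg Subtype.val hy⟩

end FramedFourGraph

namespace OrientedGraph

open Curves FramedFourGraph

variable {S : Set (Fin 2)} {VL : Type}

open scoped Classical in
/-- The orientation as a function: `1` on the half-edges that leave their vertices. -/
noncomputable def sign (G : OrientedGraph (Fin 2) S) (h : G.H) : ZMod 2 :=
  if h ∈ G.out then 1 else 0

theorem sign_congr {G G' : OrientedGraph (Fin 2) S} {h : G.H} {h' : G'.H}
    (hh : h ∈ G.out ↔ h' ∈ G'.out) : G.sign h = G'.sign h' := by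
  by_cases h' : h ∈ G.out
  · simp [sign, h', hh.1 h']
  · simp [sign, h', hh.not.1 h']

theorem sign_of_not_iff {G : OrientedGraph (Fin 2) S} {h k : G.H} (hh : k ∈ G.out ↔ h ∉ G.out) :
    G.sign k = G.sign h + 1 := by
  by_cases h' : h ∈ G.out <;> simp [sign, hh, h', CharTwo.add_self_eq_zero]

/-- The curves of an oriented graph, of which the `i`-th component is the first. -/
noncomputable abbrev curves (G : OrientedGraph (Fin 2) S) (i : Fin 2) (hi : i ∈ S) : Curves where
  H := G.H
  finite_H := G.finite_H
  edge := G.edge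
  edge_edge := G.edge_edge
  edge_ne := G.edge_ne
  opp := G.opp
  opp_opp := G.opp_opp
  opp_ne := G.opp_ne
  first := {h | G.comp h = i}
  edge_first := fun h => by simp only [Set.mem_ofPred_eq, G.comp_edge]
  opp_first := fun h => by simp only [Set.mem_ofPred_eq, G.comp_opp]
  dir := G.sign
  dir_edge := fun h hh => sign_of_not_iff (G.edge_mem h (by rwa [show G.comp h = i from hh]))
  dir_opp := fun h hh => sign_of_not_iff (G.opp_mem h (by rwa [show G.comp h = i from hh]))

/-- The number modulo `2` of copies of `L` in the smoothings of a graph, where the first curve of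
`L` is to lie on the `i`-th component. -/
noncomputable def count (L : Curves) (vL : L.H → VL) (G : OrientedGraph (Fin 2) S) (i : Fin 2)
    (hi : i ∈ S) : ZMod 2 :=
  bracket L vL (G.curves i hi) G.vtx ∅

variable {G G' : OrientedGraph (Fin 2) S} {L : Curves} {vL : L.H → VL} {i j : Fin 2}

theorem joined_curves (hi : i ∈ S) {x y : G.H} (h : G.comp x = i ↔ G.comp y = i) :
    (G.curves i hi).Joined G.opp ∅ x y := by
  have hxy : G.comp x = G.comp y := by
    revert h
    generalize G.comp x = a
    generalize G.comp y = b
    clear hi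
    revert i a b
    decide
  have hj := (G.comp_eq_iff x y).1 hxy
  clear h hxy
  induction hj with
  | rel a b hab => exact .rel _ _ (hab.imp id fun h => ⟨by simp, h⟩)
  | refl => exact .refl _
  | symm _ _ _ ih => exact ih.symm
  | trans _ _ _ _ _ ih1 ih2 => exact ih1.trans ih2

theorem exits_of_passesTo (hi : i ∈ S) {X : Set G.V} {x y : G.H} (h : G.PassesTo X x y) :
    (G.curves i hi).Exits {h | G.vtx h ∈ X} x y := by
  induction h with
  | here h hX => exact .here (C := G.curves i hi) h hX
  | next h k hX _ ih => exact .next (C := G.curves i hi) h k hX ih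

theorem curves_erasure (hi : i ∈ S) (hj : j ∈ S) {X : Set G.V} {φ : G'.H → G.H}
    (hinj : Function.Injective φ) (hrange : Set.range φ = {h | G.vtx h ∉ X})
    (hvtx : ∀ h k, G.vtx (φ h) = G.vtx (φ k) ↔ G'.vtx h = G'.vtx k)
    (hopp : ∀ h, φ (G'.opp h) = G.opp (φ h))
    (hpass : ∀ h, G.PassesTo X (G.edge (φ h)) (φ (G'.edge h)))
    (hcomp : ∀ h, G.comp (φ h) = i ↔ G'.comp h = j) (hout : ∀ h, φ h ∈ G.out ↔ h ∈ G'.out) :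
    Erasure (G'.curves j hj) G'.vtx (G.curves i hi) G.vtx {h | G.vtx h ∈ X} φ where
  inj := hinj
  mem_range := fun h => by
    show h ∈ Set.range φ ↔ _
    rw [hrange]
    rfl
  sat := fun h k hk hh => by
    show G.vtx k ∈ X
    rw [← hk]
    exact hh
  vtx_opp := G.vtx_opp
  vtx_iff := hvtx
  opp_eq := hopp
  exits := fun h => exits_of_passesTo hi (hpass h)
  first_iff := hcomp
  dir_eq := fun h _ => sign_congr (hout h)
  conn := fun _ _ _ h => joined_curves hi h

theorem count_of_isIso {σ : Equiv.Perm (Fin 2)} {φ : G.H ≃ G'.H}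
    (hφ : G.toFramedFourGraph.IsIso G'.toFramedFourGraph σ φ) (hout : ∀ h, φ h ∈ G'.out ↔ h ∈ G.out)
    (hi : i ∈ S) (hj : j ∈ S) (hij : σ i = j) : count L vL G i hi = count L vL G' j hj := by
  have := (curves_erasure (G := G') (G' := G) (X := ∅) hj hi (φ := φ) φ.injective (by simp)
    hφ.vtx_iff
    hφ.opp_eq (fun h => ?_) (fun h => ?_) hout).bracket_eq (L := L) (vL := vL)
  · simpa [count] using this.symm
  · rw [← hφ.edge_eq]
    exact .here _ (by simp)
  · rw [hφ.comp_eq, ← hij, σ.injective.eq_iff]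

theorem count_of_isErasure (hi : i ∈ S) {X : Set G.V} (h : G.IsErasure X G')
    (hb : bracket L vL (G.curves i hi) G.vtx ∅ =
      bracket L vL (G.curves i hi) G.vtx {h | G.vtx h ∈ X}) :
    count L vL G i hi = count L vL G' i hi := by
  obtain ⟨φ, hinj, hrange, hvtx, hopp, hpass, hcomp, hout⟩ := h
  exact hb.trans (curves_erasure hi hi hinj hrange hvtx hopp hpass (fun h => by rw [hcomp])
    hout).bracket_eq

section place

variable {k : ℕ} {p : Fin k × Bool → G.H} {w : Fin k → G.V} {ε : Fin k × Bool → Fin k × Bool}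

theorem placed (hi : i ∈ S) (hinj : Function.Injective (G.place p))
    (hp : ∀ y, G.edge (p y) = p (ε y)) :
    (G.curves i hi).Placed ε (G.place p) := by
  refine ⟨hinj, opp_place, ?_⟩
  rintro ⟨v, s, b⟩ (rfl : b = false)
  exact hp (v, s)

theorem crossesBy (hi : i ∈ S) (hinj : Function.Injective (G.place p)) (hw : Function.Injective w)
    (hv : ∀ y, G.vtx (p y) = w y.1) : (G.curves i hi).CrossesBy G.vtx (G.place p) (·.1) := by
  refine ⟨fun x z => ?_, fun h x hh => ?_⟩
  · rw [vtx_place hv, vtx_place hv, hw.eq_iff]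
  · exact (mem_range_place hinj hv h).2 ⟨x.1, by rw [hh, vtx_place hv]⟩

theorem mixed_place_iff (hi : i ∈ S) (hinj : Function.Injective (G.place p))
    (hw : Function.Injective w)
    (hv : ∀ y, G.vtx (p y) = w y.1) (x : TangleHalf k) :
    (G.curves i hi).Mixed G.vtx (G.place p x) ↔
      ∃ s, ¬(G.comp (p (x.1, s)) = i ↔ G.comp (p (x.1, x.2.1)) = i) := by
  constructor
  · rintro ⟨h, hh, hn⟩
    obtain ⟨z, rfl⟩ := (mem_range_place hinj hv h).2 ⟨x.1, by rw [hh, vtx_place hv]⟩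
    rw [vtx_place hv, vtx_place hv, hw.eq_iff] at hh
    refine ⟨z.2.1, ?_⟩
    rw [← hh]
    nth_rewrite 2 [hh]
    rwa [← comp_place z, ← comp_place x]
  · rintro ⟨s, hs⟩
    refine ⟨G.place p (x.1, s, false), by rw [vtx_place hv, vtx_place hv], ?_⟩
    show ¬(G.comp _ = i ↔ G.comp _ = i)
    rwa [comp_place, comp_place]

end place

theorem count_of_reidemeister1 (hi : i ∈ S) (h : G.Reidemeister1 G') :
    count L vL G i hi = count L vL G' i hi := by
  obtain ⟨v, ⟨a, ha, hea, hne⟩, hE⟩ := h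
  refine count_of_isErasure hi hE ?_
  let p : Fin 1 × Bool → G.H := fun y => if y.2 then G.edge a else a
  have hv : ∀ y, G.vtx (p y) = (![v] : Fin 1 → G.V) y.1 := by
    rintro ⟨j, s⟩
    fin_cases j
    cases s
    exacts [ha, hea]
  have hw : Function.Injective (![v] : Fin 1 → G.V) := fun _ _ _ => Subsingleton.elim _ _
  have hinj := place_injective hw hv (fun _ => (G.edge_ne a).symm) fun _ => hne.symm
  have hX : {h | G.vtx h ∈ ({v} : Set G.V)} = Set.range (G.place p) := by
    ext h
    rw [mem_range_place hinj hv]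
    simp
  rw [hX]
  refine bracket_loop (placed hi hinj ?_) (crossesBy hi hinj hw hv) G.vtx_opp fun x => ?_
  · rintro ⟨_, s⟩
    cases s
    exacts [rfl, G.edge_edge a]
  · have hcomp : ∀ y, G.comp (p y) = G.comp a := by
      rintro ⟨_, s⟩
      cases s
      exacts [rfl, G.comp_edge a]
    rw [mixed_place_iff hi hinj hw hv]
    simp [hcomp]

theorem count_of_reidemeister2 (hL : Reduced L vL) (hi : i ∈ S) (h : G.Reidemeister2 G') :
    count L vL G i hi = count L vL G' i hi := by
  obtain ⟨v, v', ⟨hvv, a, b, hab, ha, hb, hea, heb, hoa, hoe⟩, hE⟩ := h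
  refine count_of_isErasure hi hE ?_
  let p : Fin 2 × Bool → G.H := fun y => if y.1 = 0 then (if y.2 then b else a) else
    if y.2 then G.edge b else G.edge a
  have hv : ∀ y, G.vtx (p y) = (![v, v'] : Fin 2 → G.V) y.1 := by
    rintro ⟨j, s⟩
    fin_cases j <;> cases s
    exacts [ha, hb, hea, heb]
  have hw : Function.Injective (![v, v'] : Fin 2 → G.V) := by
    intro j j' h
    fin_cases j <;> fin_cases j'
    exacts [rfl, absurd h hvv, absurd h.symm hvv, rfl]
  have hinj : Function.Injective (G.place p) := by
    refine place_injective hw hv (fun j => ?_) fun j => ?_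
    · fin_cases j
      exacts [hab, fun h => hab (by rw [← G.edge_edge a, ← G.edge_edge b]; exact congrArg _ h)]
    · fin_cases j
      exacts [hoa, hoe]
  have hX : {h | G.vtx h ∈ ({v, v'} : Set G.V)} = Set.range (G.place p) := by
    ext h
    rw [mem_range_place hinj hv]
    simp [Fin.exists_fin_two]
  have hp := placed (ε := TangleHalf.bigonEdge) hi hinj (by
    rintro ⟨j, s⟩
    fin_cases j <;> cases s
    exacts [rfl, rfl, G.edge_edge a, G.edge_edge b])
  have hcomp : ∀ j s, G.comp (p (j, s)) = if s then G.comp b else G.comp a := by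
    intro j s
    fin_cases j <;> cases s
    exacts [rfl, rfl, G.comp_edge a, G.comp_edge b]
  rw [hX]
  by_cases hc : G.comp a = i ↔ G.comp b = i
  · refine bracket_bigon_pure hp (crossesBy hi hinj hw hv) G.vtx_opp fun x => ?_
    rw [mixed_place_iff hi hinj hw hv]
    rintro ⟨s, hs⟩
    rw [hcomp, hcomp] at hs
    revert hs
    cases s <;> cases x.2.1 <;> simp [hc]
  · refine bracket_bigon_mixed hL hp (crossesBy hi hinj hw hv) G.vtx_opp fun x => ?_
    rw [mixed_place_iff hi hinj hw hv]
    refine ⟨!x.2.1, ?_⟩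
    rw [hcomp, hcomp]
    cases x.2.1
    · simpa using fun h => hc h.symm
    · simpa using hc

/-- On each side of a triangle, the third Reidemeister move exchanges the two crossings. -/
theorem strandSwap_mul (hi : i ∈ S) {a b c : G.H} {p : Fin 3 × Bool → G.H}
    (hp : (G.curves i hi).Placed TangleHalf.triangleEdge (G.place p))
    (ha : p (0, false) = a) (hb : p (0, true) = b) (hc : p (1, true) = c) :
    ⇑(G.strandSwap a * G.strandSwap b * G.strandSwap c) =
      lift (G.place p) (TangleHalf.slide TangleHalf.triangleEdge) := by
  have hopp : ∀ v s b, G.opp (G.place p (v, s, b)) = G.place p (v, s, !b) :=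
    fun v s b => opp_place _
  have hedge : ∀ v s, G.edge (G.place p (v, s, false)) =
      G.place p (TangleHalf.edge TangleHalf.triangleEdge (v, s, false)) :=
    fun v s => hp.edge_eq (v, s, false) rfl
  have ha' : a = G.place p (0, false, false) := ha.symm
  have hb' : b = G.place p (0, true, false) := hb.symm
  have hc' : c = G.place p (1, true, false) := hc.symm
  have hswap := fun x y z => @Function.Injective.swap_apply _ _ _
    (fun a b => Classical.propDecidable (a = b)) _ hp.inj x y z
  funext h
  by_cases hr : h ∈ Set.range (G.place p)
  · obtain ⟨x, rfl⟩ := hr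
    rw [lift_apply hp.inj]
    simp only [strandSwap, ha', hb', hc', hopp, hedge, TangleHalf.edge, Equiv.Perm.mul_apply, hswap]
    refine congrArg (G.place p) ?_
    revert x
    decide +kernel
  · have hsw := fun x y => @Equiv.swap_apply_of_ne_of_ne _
      (fun a b => Classical.propDecidable (a = b)) (G.place p x) (G.place p y) h
      (fun hx => hr ⟨x, hx.symm⟩) fun hy => hr ⟨y, hy.symm⟩
    rw [lift_of_not_mem hr]
    simp only [strandSwap, ha', hb', hc', hopp, hedge, TangleHalf.edge, Equiv.Perm.mul_apply, hsw]

theorem count_of_reidemeister3 (hL : Reduced L vL) (hi : i ∈ S) (h : G.Reidemeister3 G') :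
    count L vL G i hi = count L vL G' i hi := by
  obtain ⟨a, b, c, ⟨h0, h1, h2, h01, h02, h12, ho0, ho1, ho2⟩, φ, hvtx, hopp, hedge, hcomp, hout⟩ :=
    h
  have hne : ∀ {x y : G.H}, G.vtx (G.edge x) ≠ G.vtx (G.edge y) → x ≠ y := fun h hxy =>
    h (by rw [hxy])
  let p : Fin 3 × Bool → G.H := fun y =>
    ![if y.2 then b else a, if y.2 then c else G.edge a, if y.2 then G.edge c else G.edge b] y.1
  have hv : ∀ y, G.vtx (p y) = (![G.vtx a, G.vtx c, G.vtx (G.edge c)] : Fin 3 → G.V) y.1 := by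
    rintro ⟨j, s⟩
    fin_cases j <;> cases s
    exacts [rfl, h0.symm, h1, rfl, h2, rfl]
  have hw : Function.Injective (![G.vtx a, G.vtx c, G.vtx (G.edge c)] : Fin 3 → G.V) := by
    intro j j' h
    fin_cases j <;> fin_cases j'
    exacts [rfl, absurd h h01, absurd h h02, absurd h.symm h01, rfl, absurd h h12,
      absurd h.symm h02, absurd h.symm h12, rfl]
  have hinj : Function.Injective (G.place p) := by
    refine place_injective hw hv (fun j => ?_) fun j => ?_
    · fin_cases j
      · exact hne (x := a) (y := b) (by rw [h1, h2]; exact h12)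
      · exact hne (x := G.edge a) (y := c) (by rw [G.edge_edge]; exact h02)
      · exact hne (x := G.edge b) (y := G.edge c) (by rwa [G.edge_edge, G.edge_edge, ← h0])
    · fin_cases j
      exacts [ho0, ho1, ho2]
  have hp := placed (ε := TangleHalf.triangleEdge) hi hinj (by
    rintro ⟨j, s⟩
    fin_cases j <;> cases s
    exacts [rfl, rfl, G.edge_edge a, rfl, G.edge_edge b, G.edge_edge c])
  have hs := strandSwap_mul (a := a) (b := b) (c := c) hi hp rfl rfl rfl
  have hb := bracket_triangle hL hp (crossesBy hi hinj hw hv) G.vtx_opp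
  refine hb.trans (slid_erasure (C' := G'.curves i hi) hp φ.bijective hvtx hopp (fun h => ?_)
    (fun h => ?_)
    (fun h _ => sign_congr (hout h)) G.vtx_opp).bracket_eq
  · rw [hedge, hs]
  · show G.comp (φ h) = i ↔ G'.comp h = i
    rw [hcomp]

end OrientedGraph

/-! ### Diagrams all of whose crossings are mixed -/

namespace Curves

variable {V VL : Type} {C L : Curves} {vtx : C.H → V} {vL : L.H → VL}

open scoped Classical in
/-- If all crossings are mixed, then there is nothing to smooth, and a copy of a diagram with the
same number of half-edges contains all crossings. -/
theorem bracket_of_mixed (hm : ∀ h, C.Mixed vtx h) (hvo : ∀ h, vtx (C.opp h) = vtx h)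
    (hcard : Nat.card C.H ≤ Nat.card L.H) :
    bracket L vL C vtx ∅ = if IsCopy L vL C vtx ∅ C.opp Set.univ then 1 else 0 := by
  have hst : C.IsState vtx ∅ C.opp := ⟨hvo, C.opp_opp, fun _ _ => rfl, fun h _ hh =>
    absurd (hm h) hh⟩
  unfold bracket
  rw [Finset.sum_eq_single C.opp]
  · unfold copies
    refine Finset.sum_eq_single _ (fun Y _ hY => if_neg fun h => hY ?_) (by simp)
    obtain ⟨O, -, -, φ, hφ⟩ := h.exists_embedding
    have := C.finite_H
    rw [← hφ.range_eq]
    exact (hφ.inj.bijective_of_nat_card_le hcard).2.range_eq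
  · intro τ hτ hne
    simp only [Finset.mem_filter, Finset.mem_univ, true_and] at hτ
    exact absurd (funext fun h => hτ.straight h (Or.inr (hm h))) hne
  · simp [hst]

theorem joined_univ {τ : C.H → C.H} {x y : C.H} (h : C.Joined τ Set.univ x y) :
    y = x ∨ y = C.edge x := by
  induction h with
  | rel x y h =>
    rcases h with h | h
    · exact Or.inr h
    · exact absurd (Set.mem_univ _) h.1
  | refl => exact Or.inl rfl
  | symm x y _ ih =>
    rcases ih with rfl | rfl
    · exact Or.inl rfl
    · exact Or.inr (C.edge_edge _).symm
  | trans x y z _ _ ih1 ih2 =>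
    rcases ih1 with rfl | rfl <;> rcases ih2 with rfl | rfl
    · exact Or.inl rfl
    · exact Or.inr rfl
    · exact Or.inr rfl
    · exact Or.inl (C.edge_edge _)

/-- Two directions of a connected curve are equal or opposite. -/
theorem Directs.add_eq {O : C.H → ZMod 2} (hO : C.Directs C.opp O) {x y : C.H}
    (h : C.Joined C.opp ∅ x y) :
    (x ∈ C.first ↔ y ∈ C.first) ∧ (x ∈ C.first → O x + C.dir x = O y + C.dir y) := by
  have h2 : ∀ a b : ZMod 2, a + b = a + 1 + (b + 1) := by decide
  induction h with
  | rel x y h =>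
    rcases h with rfl | ⟨-, rfl⟩
    · refine ⟨(C.edge_first x).symm, fun hx => ?_⟩
      rw [(hO x hx).1, C.dir_edge x hx, ← h2]
    · refine ⟨(C.opp_first x).symm, fun hx => ?_⟩
      rw [(hO x hx).2, C.dir_opp x hx, ← h2]
  | refl => exact ⟨Iff.rfl, fun _ => rfl⟩
  | symm x y _ ih => exact ⟨ih.1.symm, fun hx => (ih.2 (ih.1.2 hx)).symm⟩
  | trans x y z _ _ ih1 ih2 =>
    exact ⟨ih1.1.trans ih2.1, fun hx => (ih1.2 hx).trans (ih2.2 (ih1.1.1 hx))⟩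

/-- A copy that contains all crossings is an isomorphism. The direction that agrees with the given
one at an odd number of crossings cannot be the opposite one, which agrees with it at none. -/
theorem IsCopy.exists_equiv (h : IsCopy L vL C vtx ∅ C.opp Set.univ) :
    ∃ φ : L.H ≃ C.H, (∀ h k, vtx (φ h) = vtx (φ k) ↔ vL h = vL k) ∧
      (∀ h, φ (L.edge h) = C.edge (φ h)) ∧ (∀ h, φ (L.opp h) = C.opp (φ h)) ∧
      (∀ h, φ h ∈ C.first ↔ h ∈ L.first) ∧ ∀ h ∈ L.first, C.dir (φ h) = L.dir h := by
  obtain ⟨O, hO, hag, φ, hφ⟩ := h.exists_embedding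
  have hOd : ∀ x ∈ C.first, O x = C.dir x := by
    intro x hx
    by_contra hne
    have h2 : ∀ a b c d : ZMod 2, a ≠ b → a + b = c + d → c * d = 0 := by decide
    have : C.agreement vtx ∅ O = 0 := by
      refine Finset.sum_eq_zero fun y _ => ?_
      split_ifs with hy
      · exact h2 _ _ _ _ hne ((hO.add_eq (h.conn x y (iff_of_true hx hy.1))).2 hx)
      · rfl
    exact zero_ne_one (this.symm.trans hag)
  refine ⟨Equiv.ofBijective φ ⟨hφ.inj, Set.range_eq_univ.1 hφ.range_eq⟩, hφ.vtx_iff, fun h => ?_,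
    hφ.opp_eq, hφ.first_iff, fun h hh => ?_⟩
  · exact (joined_univ (hφ.joined h)).resolve_left fun he => L.edge_ne h (hφ.inj he)
  · rw [← hφ.dir_eq h hh]
    exact (hOd _ ((hφ.first_iff h).2 hh)).symm

end Curves

namespace OrientedGraph

open Curves FramedFourGraph

variable {S : Set (Fin 2)} {G : OrientedGraph (Fin 2) S} {i j : Fin 2}

theorem reduced_curves (hG : G.Irreducible) (hi : i ∈ S) : Reduced (G.curves i hi) G.vtx := by
  intro a b hab hv he hne ho
  by_contra hoe
  exact hG _ _ ⟨hne, a, b, hab, rfl, hv.symm, rfl, he.symm, ho, hoe⟩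

theorem mixed_curves (hG : G.AllCrossingsMixed) (hi : i ∈ S) (h : G.H) :
    (G.curves i hi).Mixed G.vtx h := by
  obtain ⟨k, hk, hki⟩ := hG (G.vtx h) (G.comp h + 1)
  refine ⟨k, hk, ?_⟩
  show ¬(G.comp k = i ↔ G.comp h = i)
  rw [hki]
  clear hki hi
  generalize G.comp h = c
  revert i c
  decide

/-- The `i`-th component passes through every crossing exactly once. -/
theorem exists_unique_out (hG : G.AllCrossingsMixed) (hi : i ∈ S) (v : G.V) :
    ∃! h, G.vtx h = v ∧ G.comp h = i ∧ h ∈ G.out := by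
  obtain ⟨h, hv, hc⟩ := hG v i
  have hex : ∃ h, G.vtx h = v ∧ G.comp h = i ∧ h ∈ G.out := by
    by_cases ho : h ∈ G.out
    · exact ⟨h, hv, hc, ho⟩
    · exact ⟨G.opp h, by rw [G.vtx_opp, hv], by rw [G.comp_opp, hc],
        (G.opp_mem h (by rwa [hc])).2 ho⟩
  clear h hv hc
  obtain ⟨h, hv, hc, ho⟩ := hex
  refine ⟨h, ⟨hv, hc, ho⟩, fun k ⟨hkv, hkc, hko⟩ => ?_⟩
  by_contra hne
  -- Otherwise all four half-edges at the crossing would lie on the `i`-th component.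
  let p : Fin 1 × Bool → G.H := fun y => if y.2 then k else h
  have hp : ∀ y, G.vtx (p y) = (![v] : Fin 1 → G.V) y.1 := by
    rintro ⟨j, s⟩
    fin_cases j
    cases s
    exacts [hv, hkv]
  have hinj := place_injective (fun _ _ _ => Subsingleton.elim _ _) hp (fun _ => Ne.symm hne)
    fun _ (hk : G.opp h = k) => (G.opp_mem h (by rwa [hc])).1 (by rwa [hk]) ho
  obtain ⟨l, hl, hlc⟩ := hG v (i + 1)
  obtain ⟨⟨_, s, b⟩, rfl⟩ := (mem_range_place hinj hp l).2 ⟨0, hl⟩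
  have hpc : ∀ y, G.comp (p y) = i := by
    rintro ⟨j, s⟩
    cases s
    exacts [hc, hkc]
  rw [comp_place, hpc] at hlc
  revert hlc
  clear * -
  revert i
  decide

theorem isCopy_self (hG : G.AllCrossingsMixed) (hodd : Odd (Nat.card G.V)) (hi : i ∈ S) :
    IsCopy (G.curves i hi) G.vtx (G.curves i hi) G.vtx ∅ G.opp Set.univ := by
  classical
  have := G.finite_H
  have := G.finite_V
  refine ⟨fun _ _ _ _ => Set.mem_univ _, fun h _ => ⟨mixed_curves hG hi h, by simp⟩,
    fun x y h => joined_curves hi h, G.sign, fun h hh => ?_, ?_, id,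
    ⟨Function.injective_id, Set.range_id, fun _ _ => Iff.rfl, fun _ => rfl, fun _ => Iff.rfl,
      fun h => .edge (C := G.curves i hi) h, fun _ _ => rfl⟩⟩
  · exact ⟨(G.curves i hi).dir_edge h hh, (G.curves i hi).dir_opp h hh⟩
  · let _ : Fintype G.H := Curves.instFintypeH (G.curves i hi)
    have h1 : (G.curves i hi).agreement G.vtx ∅ G.sign =
        ∑ h : G.H, if G.comp h = i ∧ h ∈ G.out then 1 else 0 := by
      refine Finset.sum_congr rfl fun h _ => ?_
      by_cases h1 : G.comp h = i <;> by_cases h2 : h ∈ G.out <;>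
        simp [mixed_curves hG hi h, h1, h2, sign]
    let e : G.V → G.H := fun v => (exists_unique_out hG hi v).choose
    have he : ∀ v, G.vtx (e v) = v ∧ G.comp (e v) = i ∧ e v ∈ G.out := fun v =>
      (exists_unique_out hG hi v).choose_spec.1
    have h2 : Nat.card G.V = (Finset.univ.filter fun h : G.H =>
        G.comp h = i ∧ h ∈ G.out).card := by
      have := Fintype.ofFinite G.V
      rw [Nat.card_eq_fintype_card, ← Finset.card_univ]
      refine Finset.card_bij (fun v _ => e v) (fun v _ => by simpa using (he v).2)
        (fun v _ v' _ h => ?_) fun h hh => ⟨G.vtx h, Finset.mem_univ _, ?_⟩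
      · rw [← (he v).1, h, (he v').1]
      · simp only [Finset.mem_filter, Finset.mem_univ, true_and] at hh
        exact (exists_unique_out hG hi (G.vtx h)).unique (he _) ⟨rfl, hh⟩
    rw [h1, Finset.sum_boole, ← h2]
    exact (ZMod.natCast_eq_one_iff_odd).2 hodd

theorem count_self (hG : G.AllCrossingsMixed) (hodd : Odd (Nat.card G.V)) (hi : i ∈ S) :
    count (G.curves i hi) G.vtx G i hi = 1 := by
  classical
  rw [count, bracket_of_mixed (mixed_curves hG hi) G.vtx_opp le_rfl,
    if_pos (isCopy_self hG hodd hi)]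

/-- If a diagram with as many half-edges contains a copy of `G`, then it is isomorphic to `G`. -/
theorem exists_isIso_of_count {G' : OrientedGraph (Fin 2) S} (hG' : G'.AllCrossingsMixed)
    (hcard : Nat.card G'.H ≤ Nat.card G.H) (hi : i ∈ S) (hj : j ∈ S) {σ : Equiv.Perm (Fin 2)}
    (hσ : σ i = j) (h : count (G.curves i hi) G.vtx G' j hj ≠ 0) :
    ∃ φ : G.H ≃ G'.H, G.toFramedFourGraph.IsIso G'.toFramedFourGraph σ φ ∧
      ∀ h, G.comp h = i → (φ h ∈ G'.out ↔ h ∈ G.out) := by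
  classical
  rw [count, bracket_of_mixed (mixed_curves hG' hj) G'.vtx_opp hcard, ne_eq, ite_eq_right_iff,
    Classical.not_imp] at h
  obtain ⟨φ, hvtx, hedge, hopp, hfirst, hdir⟩ := h.1.exists_equiv
  refine ⟨φ, ⟨hvtx, hedge, hopp, fun h => ?_⟩, fun h hh => ?_⟩
  · have := hfirst h
    simp only [Set.mem_ofPred_eq] at this
    subst hσ
    have key : ∀ (σ : Equiv.Perm (Fin 2)) (i a b : Fin 2), (a = σ i ↔ b = i) → a = σ b := by decide
    exact key _ _ _ _ this
  · have := hdir h hh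
    by_cases h1 : h ∈ G.out <;> by_cases h2 : φ h ∈ G'.out <;> simp_all [sign]

/-! ### Invertibility -/

theorem count_of_step {L : Curves} {VL : Type} {vL : L.H → VL} (hL : Reduced L vL)
    {G G' : OrientedGraph (Fin 2) {0}} (h : G.Step G') :
    count L vL G 0 (Set.mem_singleton 0) = count L vL G' 0 (Set.mem_singleton 0) := by
  rcases h with ⟨σ, φ, hφ, hσ, hout⟩ | h | h | h
  · exact count_of_isIso hφ hout _ _ ((hσ 0).2 rfl)
  · exact count_of_reidemeister1 _ h
  · exact count_of_reidemeister2 hL _ h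
  · exact count_of_reidemeister3 hL _ h

theorem count_add_count_of_step {L : Curves} {VL : Type} {vL : L.H → VL} (hL : Reduced L vL)
    {G G' : OrientedGraph (Fin 2) Set.univ} (h : G.Step G') :
    count L vL G 0 (Set.mem_univ 0) + count L vL G 1 (Set.mem_univ 1) =
      count L vL G' 0 (Set.mem_univ 0) + count L vL G' 1 (Set.mem_univ 1) := by
  rcases h with ⟨σ, φ, hφ, -, hout⟩ | h | h | h
  · have h01 : (σ 0 = 0 ∧ σ 1 = 1) ∨ (σ 0 = 1 ∧ σ 1 = 0) := by
      clear * -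
      revert σ
      decide
    rcases h01 with ⟨h0, h1⟩ | ⟨h0, h1⟩
    · rw [count_of_isIso hφ hout _ _ h0, count_of_isIso hφ hout _ _ h1]
    · rw [count_of_isIso hφ hout _ _ h0, count_of_isIso hφ hout _ _ h1, add_comm]
  · rw [count_of_reidemeister1 _ h, count_of_reidemeister1 _ h]
  · rw [count_of_reidemeister2 hL _ h, count_of_reidemeister2 hL _ h]
  · rw [count_of_reidemeister3 hL _ h, count_of_reidemeister3 hL _ h]

theorem not_isInvertible {L : OrientedGraph (Fin 2) {0}} (hodd : Odd (Nat.card L.V))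
    (hmix : L.AllCrossingsMixed) (hirr : L.Irreducible) (hrev : ¬L.Isomorphic L.reverse) :
    ¬L.IsInvertible := by
  intro h
  replace h : Quot.mk _ _ = Quot.mk _ _ := h
  have hinv := congrArg (Quot.lift (fun G => count (L.curves 0 (Set.mem_singleton 0))
    L.vtx G 0 (Set.mem_singleton 0))
    fun _ _ hs => count_of_step (reduced_curves hirr (Set.mem_singleton 0)) hs) h
  have h1 : count (L.curves 0 (Set.mem_singleton 0)) L.vtx L.reverse 0 (Set.mem_singleton 0) = 1 :=
    hinv.symm.trans (count_self hmix hodd (Set.mem_singleton 0))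
  obtain ⟨φ, hφ, hout⟩ := exists_isIso_of_count (G := L) (G' := L.reverse) (σ := 1)
    hmix le_rfl (Set.mem_singleton 0) (Set.mem_singleton 0) rfl
    (by rw [h1]; exact one_ne_zero)
  refine hrev ⟨1, φ, hφ, fun _ => Iff.rfl, fun h => ?_⟩
  by_cases hh : L.comp h = 0
  · exact hout h hh
  · exact iff_of_false (fun h' => hh ((hφ.comp_eq h).symm.trans (L.reverse.comp_mem _ h')))
      fun h' => hh (L.comp_mem _ h')

/-- When both components are oriented, then either of them can correspond to the first curve, so
that the copies of both kinds are counted. -/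
theorem not_isInvertible_of_restrict {M : OrientedGraph (Fin 2) Set.univ}
    (hodd : Odd (Nat.card M.V)) (hmix : M.AllCrossingsMixed) (hirr : M.Irreducible)
    (hrev : ¬(M.restrict {0} (Set.subset_univ _)).Isomorphic
      (M.restrict {0} (Set.subset_univ _)).reverse)
    (hswap : ¬M.HasComponentSwap) : ¬M.IsInvertible := by
  intro h
  replace h : Quot.mk _ _ = Quot.mk _ _ := h
  have hinv : count (M.curves 0 (Set.mem_univ 0)) M.vtx M 0 (Set.mem_univ 0)
    + count (M.curves 0 (Set.mem_univ 0)) M.vtx M 1 (Set.mem_univ 1) =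
      count (M.curves 0 (Set.mem_univ 0)) M.vtx M.reverse 0 (Set.mem_univ 0) +
        count (M.curves 0 (Set.mem_univ 0)) M.vtx M.reverse 1 (Set.mem_univ 1) :=
    congrArg (Quot.lift (fun G => count (M.curves 0 (Set.mem_univ 0)) M.vtx G 0 (Set.mem_univ 0) +
      count (M.curves 0 (Set.mem_univ 0)) M.vtx G 1 (Set.mem_univ 1))
      fun _ _ hs => count_add_count_of_step (reduced_curves hirr (Set.mem_univ _)) hs) h
  have h1 : count (M.curves 0 (Set.mem_univ 0)) M.vtx M 1 (Set.mem_univ 1) = 0 := by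
    by_contra hne
    obtain ⟨φ, hφ, -⟩ := exists_isIso_of_count (G := M) (G' := M) hmix le_rfl (Set.mem_univ _)
      (Set.mem_univ _) (Equiv.swap_apply_left 0 1) hne
    exact hswap ⟨φ, hφ⟩
  have h2 : count (M.curves 0 (Set.mem_univ 0)) M.vtx M.reverse 1 (Set.mem_univ 1) = 0 := by
    by_contra hne
    obtain ⟨φ, hφ, -⟩ := exists_isIso_of_count (G := M) (G' := M.reverse)
      hmix le_rfl (Set.mem_univ _) (Set.mem_univ _)
      (Equiv.swap_apply_left 0 1) hne
    exact hswap ⟨φ, hφ⟩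
  have h3 : count (M.curves 0 (Set.mem_univ 0)) M.vtx M.reverse 0 (Set.mem_univ 0) = 0 := by
    by_contra hne
    obtain ⟨φ, hφ, hout⟩ := exists_isIso_of_count (G := M) (G' := M.reverse) (σ := 1)
      hmix le_rfl (Set.mem_univ _) (Set.mem_univ _)
      rfl hne
    refine hrev ⟨1, φ, hφ, fun _ => Iff.rfl, fun h => ?_⟩
    have hc : M.comp (φ h) = M.comp h := hφ.comp_eq h
    have ho := hout h
    show (M.comp (φ h) = 0 ∧ ¬(M.comp (φ h) = 0 ∧ φ h ∈ M.out)) ↔ (M.comp h = 0 ∧ h ∈ M.out)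
    change M.comp h = 0 → ((True ∧ φ h ∉ M.out) ↔ h ∈ M.out) at ho
    rw [hc]
    tauto
  rw [count_self hmix hodd, h1, h2, h3] at hinv
  simp at hinv

end OrientedGraph

/-! ### The eleven-crossing example -/

theorem exampleLink_allCrossingsMixed : exampleLink.AllCrossingsMixed := by
  show ∀ (v : Fin 11) (i : Fin 2), ∃ h : Fin 2 × Fin 11 × Bool,
    (if h.1 = 0 then examplePosition h.2.1 else h.2.1) = v ∧ h.1 = i
  decide +kernel

/-- The vertices of the example on an explicit type. -/
def exampleVtx (h : Fin 2 × Fin 11 × Bool) : Fin 11 :=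
  if h.1 = 0 then examplePosition h.2.1 else h.2.1

/-- The edges of the example on an explicit type. -/
def exampleEdge (h : Fin 2 × Fin 11 × Bool) : Fin 2 × Fin 11 × Bool :=
  if h.2.2 then (h.1, h.2.1 + 1, false) else (h.1, h.2.1 - 1, true)

/-- The framing of the example on an explicit type. -/
def exampleOpp (h : Fin 2 × Fin 11 × Bool) : Fin 2 × Fin 11 × Bool := (h.1, h.2.1, !h.2.2)

set_option synthInstance.maxSize 1000 in
theorem exampleLink_irreducible : exampleLink.Irreducible := by
  rintro v w ⟨hvw, a, b, hab, rfl, hb, rfl, hw, ho, hoe⟩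
  have key : ∀ a b : Fin 2 × Fin 11 × Bool, exampleVtx b = exampleVtx a →
      exampleVtx (exampleEdge b) = exampleVtx (exampleEdge a) →
      a = b ∨ exampleOpp a = b ∨ exampleOpp (exampleEdge a) = exampleEdge b := by
    decide +kernel
  rcases key a b hb hw with h | h | h
  · exact hab h
  · exact ho h
  · exact hoe h

/-- A map that preserves edges and opposite half-edges runs along the image of a component at
constant speed. -/
theorem exampleGraph_map_eq {φ : exampleGraph.H → exampleGraph.H}
    (hedge : ∀ h, φ (exampleGraph.edge h) = exampleGraph.edge (φ h))
    (hopp : ∀ h, φ (exampleGraph.opp h) = exampleGraph.opp (φ h)) {i i' : Fin 2} {m : Fin 11}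
    {d : Bool}
    (h0 : φ (i, 0, true) = (i', m, d)) (k : Fin 11) :
    φ (i, k, true) = (i', if d then m + k else m - k, d) := by
  induction k using Fin.induction with
  | zero =>
    refine h0.trans (congrArg (fun x => (i', x, d)) ?_)
    cases d
    exacts [(sub_zero m).symm, (add_zero m).symm]
  | succ k ih =>
    rw [← Fin.coeSucc_eq_succ]
    have h1 : φ (i, k.castSucc + 1, true) =
        exampleGraph.opp (exampleGraph.edge (φ (i, k.castSucc, true))) :=
      (hopp (exampleGraph.edge (i, k.castSucc, true))).trans (congrArg _ (hedge _))
    refine (h1.trans (congrArg (fun x => exampleGraph.opp (exampleGraph.edge x)) ih)).trans ?_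
    cases d
    · exact congrArg (fun x => (i', x, false)) (sub_sub m _ 1)
    · exact congrArg (fun x => (i', x, true)) (add_assoc m _ 1)

/-- An isomorphism maps the positions along the two components to each other. -/
theorem exampleGraph_position {φ : exampleGraph.H → exampleGraph.H}
    (hvtx : ∀ h k, exampleGraph.vtx (φ h) = exampleGraph.vtx (φ k) ↔
      exampleGraph.vtx h = exampleGraph.vtx k)
    (hedge : ∀ h, φ (exampleGraph.edge h) = exampleGraph.edge (φ h))
    (hopp : ∀ h, φ (exampleGraph.opp h) = exampleGraph.opp (φ h)) {i i' : Fin 2} {m m' : Fin 11}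
    {d d' : Bool} (h0 : φ (0, 0, true) = (i, m, d)) (h1 : φ (1, 0, true) = (i', m', d'))
    (j : Fin 11) :
    exampleGraph.vtx (i, if d then m + j else m - j, d) =
      exampleGraph.vtx (i', if d' then m' + examplePosition j else m' - examplePosition j, d') := by
  rw [← exampleGraph_map_eq hedge hopp h0, ← exampleGraph_map_eq hedge hopp h1]
  exact (hvtx _ _).2 rfl

theorem exampleLink_not_isomorphic_reverse : ¬exampleLink.Isomorphic exampleLink.reverse := by
  rintro ⟨σ, φ, hφ, hσ, hout⟩
  have key : ∀ (m m' : Fin 11) (d' : Bool), ∃ j : Fin 11, examplePosition (m - j) ≠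
      if d' then m' + examplePosition j else m' - examplePosition j := by
    decide +kernel
  have hσ0 : σ 0 = 0 := (hσ 0).2 rfl
  have hσ1 : σ 1 = 1 := by
    clear * - hσ0
    revert σ
    decide
  obtain ⟨⟨i, m, d⟩, h0⟩ : ∃ x : Fin 2 × Fin 11 × Bool, φ (0, 0, true) = x := ⟨_, rfl⟩
  obtain ⟨⟨i', m', d'⟩, h1⟩ : ∃ x : Fin 2 × Fin 11 × Bool, φ (1, 0, true) = x := ⟨_, rfl⟩
  have hi : i = 0 := by
    have : exampleGraph.comp (φ (0, 0, true)) = σ 0 := hφ.comp_eq _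
    rw [h0] at this
    exact this.trans hσ0
  have hi' : i' = 1 := by
    have : exampleGraph.comp (φ (1, 0, true)) = σ 1 := hφ.comp_eq _
    rw [h1] at this
    exact this.trans hσ1
  have hd : d = false := by
    have : φ (0, 0, true) ∈ exampleLink.reverse.out := (hout _).2 ⟨rfl, rfl⟩
    rw [h0] at this
    by_contra hd
    exact this.2 ⟨hi, by simpa using hd⟩
  subst hi hi' hd
  obtain ⟨j, hj⟩ := key m m' d'
  exact hj (exampleGraph_position hφ.vtx_iff hφ.edge_eq hφ.opp_eq h0 h1 j)

theorem exampleLink_not_hasComponentSwap : ¬exampleLink.HasComponentSwap := by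
  rintro ⟨φ, hφ⟩
  have key : ∀ (m m' : Fin 11) (d d' : Bool), ∃ j : Fin 11, (if d then m + j else m - j) ≠
      examplePosition (if d' then m' + examplePosition j else m' - examplePosition j) := by
    decide +kernel
  obtain ⟨⟨i, m, d⟩, h0⟩ : ∃ x : Fin 2 × Fin 11 × Bool, φ (0, 0, true) = x := ⟨_, rfl⟩
  obtain ⟨⟨i', m', d'⟩, h1⟩ : ∃ x : Fin 2 × Fin 11 × Bool, φ (1, 0, true) = x := ⟨_, rfl⟩
  have hi : i = 1 := by
    have : exampleGraph.comp (φ (0, 0, true)) = Equiv.swap 0 1 0 := hφ.comp_eq _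
    rw [h0] at this
    exact this.trans (Equiv.swap_apply_left 0 1)
  have hi' : i' = 0 := by
    have : exampleGraph.comp (φ (1, 0, true)) = Equiv.swap 0 1 1 := hφ.comp_eq _
    rw [h1] at this
    exact this.trans (Equiv.swap_apply_right 0 1)
  subst hi hi'
  obtain ⟨j, hj⟩ := key m m' d d'
  exact hj (exampleGraph_position hφ.vtx_iff hφ.edge_eq hφ.opp_eq h0 h1 j)

open OrientedGraph in
theorem exampleLink_not_isInvertible : ¬exampleLink.IsInvertible :=
  not_isInvertible (by rw [show Nat.card exampleLink.V = 11 from Nat.card_fin 11]; decide)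
    exampleLink_allCrossingsMixed exampleLink_irreducible exampleLink_not_isomorphic_reverse

theorem mainTheorem2 :
    (∀ L : OrientedGraph (Fin 2) {0},
      Odd (Nat.card L.V) →
      L.AllCrossingsMixed →
      L.Irreducible →
      ¬ L.Isomorphic L.reverse →
      ¬ L.HasComponentSwap →
      ¬ L.IsInvertible ∧
        ∀ M : OrientedGraph (Fin 2) Set.univ,
          M.restrict {0} (Set.subset_univ _) = L → ¬ M.IsInvertible) ∧
    (Nat.card exampleLink.V = 11 ∧
      exampleLink.AllCrossingsMixed ∧
      exampleLink.Irreducible ∧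
      ¬ exampleLink.Isomorphic exampleLink.reverse ∧
      ¬ exampleLink.HasComponentSwap ∧
      ¬ exampleLink.IsInvertible) := by
  refine ⟨fun L hodd hmix hirr hrev hswap =>
    ⟨OrientedGraph.not_isInvertible hodd hmix hirr hrev, ?_⟩, Nat.card_fin 11,
    exampleLink_allCrossingsMixed, exampleLink_irreducible, exampleLink_not_isomorphic_reverse,
    exampleLink_not_hasComponentSwap, exampleLink_not_isInvertible⟩
  rintro M rfl
  exact OrientedGraph.not_isInvertible_of_restrict hodd hmix hirr hrev hswap
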